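/- **Lemma (alignment of singularities of Fuchsian systems).** A *Fuchsian system* of dimension $n$ is a linear system $\dot X=A(t)X$ with $A(t)=\sum_j \frac{A_j}{t-t_j}$, a finite sum over distinct points $t_j\in\mathbb C$ with residues $0\ne A_j\in\mathrm{Mat}_{n\times n}(\mathbb C)$; its residue at infinity is $A_\infty=-\sum_j A_j$, and $t=\infty$ is singular iff $A_\infty\neq0$. Its polar locus is $\Sigma=\{t_j\}$, and its height is $\sum_j\|A_j\|+\|A_\infty\|$, where $\|\cdot\|$ is the operator norm on matrices induced by the maximum norm on $\mathbb C^n$. It belongs to the class $\mathcal F(n,m,r)$, $n,m,r\in\mathbb N$, if it has at most $m$ singular points in $\mathbb CP^1$ (including $\infty$) and height at most $r$. For a germ $X$ of a fundamental matrix solution at a nonsingular point, $\mathbb C(X)$ is the field of germs of meromorphic functions generated over $\mathbb C$ by $t$ and the entries $x_{ij}(t)$ of $X$ (the Picard–Vessiot field of the system). An element $f\in\mathbb C(X)$ has degree $\le d$ if $f=g/h$, where $h\not\equiv0$ and $g,h$ are values, at $t$ and the $x_{ij}$, of polynomials with complex coefficients of total degree $\le d$. The system satisfies the *simple-loop spectral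 condition* if for every simple closed curve $\gamma$ in $\mathbb C\setminus\Sigma$ all eigenvalues of the monodromy factor $M_\gamma$ (defined by $\Delta_\gamma X=XM_\gamma$, where $\Delta_\gamma$ is analytic continuation along $\gamma$) have modulus $1$. There exist primitive recursive functions $D,N,M,R:\mathbb N^3\to\mathbb N$ such that for all $n,m,r\in\mathbb N$ and every Fuchsian system in $\mathcal F(n,m,r)$ with polar locus $\Sigma$ there exist a nonconstant rational map $\varphi\in\mathbb C(t)$ and a Fuchsian system of some dimension $n'$, with polar locus $\Sigma'$, with the following properties. 1. Let $b\in\mathbb C\setminus\Sigma'$, $a\in\mathbb C\setminus\Sigma$, let $\psi$ be any germ at $b$ of a holomorphic branch of $\varphi^{-1}$ with $\psi(b)=a$, and let $X$ and $Y$ be any germs, at $a$ and $b$ respectively, of fundamental matrix solutions of the first and of the second system. Then $\psi^*\mathbb C(X)=\mathbb C(\psi^*X)\subseteq\mathbb C(Y)$, where $\psi^*f=f\circ\psi$ and $\mathbb C(\psi^*X)$ is the field generated over $\mathbb C$ by $\psi$ and the functions $x_{ij}\circ\psi$. 2. In the situation of 1, if $f\in\mathbb C(X)$ has degree $\le d$,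 then $\psi^*f$ has degree $\le d$ as an element of $\mathbb C(Y)$. 3. All singular points of the second system are finite and real (in particular, $\infty$ is nonsingular), and all its residue matrices are real. 4. $\deg\varphi\le D(n,m,r)$, $n'\le N(n,m,r)$, and the second system has at most $M(n,m,r)$ singular points and height at most $R(n,m,r)$. 5. If the first system satisfies the simple-loop spectral condition, then so does the second. -/

import Mathlib

open Filter Topology

noncomputable section

/-- An `n × n` Fuchsian system `dX/dt = (∑ⱼ Aⱼ / (t - tⱼ)) X` on the Riemann sphere, given by its
finitely many finite residue matrices: `residue t` is the residue of the coefficient matrix at `t`,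
and the finite singular points are exactly the points with a nonzero residue. -/
structure FuchsianSystem (n : ℕ) where
  residue : ℂ →₀ Matrix (Fin n) (Fin n) ℂ

namespace FuchsianSystem

variable {n : ℕ}

/-- The finite singular points (the polar locus). -/
def poles (S : FuchsianSystem n) : Finset ℂ := S.residue.support

/-- The coefficient matrix `A(t) = ∑ⱼ Aⱼ / (t - tⱼ)`. -/
def coeff (S : FuchsianSystem n) (t : ℂ) : Matrix (Fin n) (Fin n) ℂ :=
  ∑ a ∈ S.poles, (t - a)⁻¹ • S.residue a

/-- The residue at infinity, `-(A₁ + ⋯ + Aₘ)`. -/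
def residueInfty (S : FuchsianSystem n) : Matrix (Fin n) (Fin n) ℂ :=
  -∑ a ∈ S.poles, S.residue a

open Classical in
/-- The number of singular points on the Riemann sphere, the point at infinity included. -/
def numSingular (S : FuchsianSystem n) : ℕ :=
  S.poles.card + if S.residueInfty = 0 then 0 else 1

section Height

attribute [local instance] Matrix.linftyOpNormedAddCommGroup

/-- The height: the sum of the norms of all residues, that at infinity included. The norm is the
operator norm on matrices induced by the maximum norm on `ℂⁿ`. -/
def height (S : FuchsianSystem n) : ℝ :=
  ∑ a ∈ S.poles, ‖S.residue a‖ + ‖S.residueInfty‖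

end Height

/-- Membership in the Fuchsian class with parameters `(n, m, r)`: at most `m` singular points on
the sphere (including infinity) and height at most `r`. -/
def InClass (S : FuchsianSystem n) (m r : ℕ) : Prop :=
  S.numSingular ≤ m ∧ S.height ≤ r

/-- The matrix function `X` satisfies `dX/dt = A(t) X` in a neighbourhood of `b`. -/
def IsSolutionNear (S : FuchsianSystem n) (b : ℂ) (X : ℂ → Matrix (Fin n) (Fin n) ℂ) : Prop :=
  ∀ᶠ t in 𝓝 b, ∀ i j, HasDerivAt (fun u => X u i j) ((S.coeff t * X t) i j) t

/-- `X` represents the germ at `b` of a fundamental matrix solution. -/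
def IsFundamentalAt (S : FuchsianSystem n) (b : ℂ) (X : ℂ → Matrix (Fin n) (Fin n) ℂ) : Prop :=
  S.IsSolutionNear b X ∧ (X b).det ≠ 0

/-- `Z` is the analytic continuation of a matrix solution along the path `γ : [0,1] → ℂ`:
locally along the path, `Z s` is the value at `γ s` of a holomorphic matrix solution. -/
def IsContinuationAlong (S : FuchsianSystem n) (γ : ℝ → ℂ)
    (Z : ℝ → Matrix (Fin n) (Fin n) ℂ) : Prop :=
  ∀ s ∈ Set.Icc (0 : ℝ) 1, ∃ F : ℂ → Matrix (Fin n) (Fin n) ℂ,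
    S.IsSolutionNear (γ s) F ∧ ∀ᶠ s' in 𝓝[Set.Icc (0 : ℝ) 1] s, Z s' = F (γ s')

/-- `M` is the monodromy factor, along the closed path `γ`, of some fundamental solution:
continuation along `γ` transforms `X` into `X M`. -/
def IsMonodromyFactor (S : FuchsianSystem n) (γ : ℝ → ℂ) (M : Matrix (Fin n) (Fin n) ℂ) : Prop :=
  ∃ Z : ℝ → Matrix (Fin n) (Fin n) ℂ,
    S.IsContinuationAlong γ Z ∧ (Z 0).det ≠ 0 ∧ Z 1 = Z 0 * M

end FuchsianSystem

/-- A simple loop: a closed non-selfintersecting continuous curve `γ : [0,1] → ℂ`. -/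
def IsSimpleLoop (γ : ℝ → ℂ) : Prop :=
  ContinuousOn γ (Set.Icc 0 1) ∧ γ 0 = γ 1 ∧ Set.InjOn γ (Set.Ico 0 1)

/-- The simple-loop spectral condition: the eigenvalues of the monodromy factors along all simple
loops avoiding the finite singular points lie on the unit circle. -/
def FuchsianSystem.SpectralCondition {n : ℕ} (S : FuchsianSystem n) : Prop :=
  ∀ γ : ℝ → ℂ, IsSimpleLoop γ → (∀ s ∈ Set.Icc (0 : ℝ) 1, γ s ∉ S.poles) →
    ∀ M : Matrix (Fin n) (Fin n) ℂ, S.IsMonodromyFactor γ M → ∀ μ ∈ spectrum ℂ M, ‖μ‖ = 1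

/-- Germs at `b` of functions on punctured neighbourhoods of `b`; the field of germs at `b` of
meromorphic functions is a subring of it. -/
abbrev PuncturedGerm (b : ℂ) : Type := Germ (𝓝[≠] b) ℂ

namespace PuncturedGerm

variable {ι : Type} {b : ℂ}

/-- The embedding of the constants `ℂ` into the germs. -/
def constHom (b : ℂ) : ℂ →+* PuncturedGerm b :=
  (Germ.coeRingHom (𝓝[≠] b)).comp (Pi.constRingHom ℂ ℂ)

/-- The value of a polynomial with complex coefficients at a family of germs. -/
def evalPoly (g : ι → PuncturedGerm b) (P : MvPolynomial ι ℂ) : PuncturedGerm b :=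
  MvPolynomial.eval₂ (constHom b) g P

/-- `f` is a quotient of two polynomials of degree at most `d` in the generators `g`. -/
def DegreeLE (g : ι → PuncturedGerm b) (d : ℕ) (f : PuncturedGerm b) : Prop :=
  ∃ P Q : MvPolynomial ι ℂ, P.totalDegree ≤ d ∧ Q.totalDegree ≤ d ∧
    evalPoly g Q ≠ 0 ∧ f = evalPoly g P / evalPoly g Q

/-- The field of all rational combinations, with coefficients in `ℂ`, of the generators `g`. -/
def generatedField (g : ι → PuncturedGerm b) : Set (PuncturedGerm b) :=
  {f | ∃ d, DegreeLE g d f}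

end PuncturedGerm

/-- The generators of `ℂ(X)` as germs at `b`: the independent variable `t` (index `none`) and the
entries of the matrix `X`. -/
def pvGenerators {n : ℕ} (X : ℂ → Matrix (Fin n) (Fin n) ℂ) (b : ℂ) :
    Option (Fin n × Fin n) → PuncturedGerm b
  | none => ((fun t : ℂ => t) : ℂ → ℂ)
  | some ij => ((fun t : ℂ => X t ij.1 ij.2) : ℂ → ℂ)

/-- The Picard–Vessiot field `ℂ(X)`, realized by germs at `b`. -/
def pvField {n : ℕ} (X : ℂ → Matrix (Fin n) (Fin n) ℂ) (b : ℂ) : Set (PuncturedGerm b) :=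
  PuncturedGerm.generatedField (pvGenerators X b)

/-- The degree of `f`, as an element of `ℂ(X)` realized by germs at `b`, is at most `d`. -/
def PVDegreeLE {n : ℕ} (X : ℂ → Matrix (Fin n) (Fin n) ℂ) (b : ℂ) (d : ℕ)
    (f : PuncturedGerm b) : Prop :=
  PuncturedGerm.DegreeLE (pvGenerators X b) d f

/-- The degree of a rational map of the Riemann sphere. -/
def ratMapDegree (φ : RatFunc ℂ) : ℕ := max φ.num.natDegree φ.denom.natDegree

/-- `ψ` is (a representative of) a germ at `b`, with value `a`, of a branch of the inverse of the
rational map `φ`. -/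
structure IsInverseBranch (φ : RatFunc ℂ) (ψ : ℂ → ℂ) (b a : ℂ) : Prop where
  analyticAt : AnalyticAt ℂ ψ b
  map_base : ψ b = a
  right_inverse : ∀ᶠ z in 𝓝 b,
    φ.denom.eval (ψ z) ≠ 0 ∧ φ.eval (RingHom.id ℂ) (ψ z) = z

theorem IsInverseBranch.tendsto {φ : RatFunc ℂ} {ψ : ℂ → ℂ} {b a : ℂ}
    (h : IsInverseBranch φ ψ b a) : Tendsto ψ (𝓝[≠] b) (𝓝[≠] a) := by
  have hb := h.right_inverse.self_of_nhds.2
  rw [h.map_base] at hb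
  refine tendsto_nhdsWithin_iff.2 ⟨?_, ?_⟩
  · have := h.analyticAt.continuousAt.tendsto
    rw [h.map_base] at this
    exact this.mono_left nhdsWithin_le_nhds
  · filter_upwards [h.right_inverse.filter_mono nhdsWithin_le_nhds, self_mem_nhdsWithin]
      with z hz hzb hza
    rw [Set.mem_singleton_iff] at hza
    rw [hza, hb] at hz
    exact hzb hz.2.symm

/-- The pullback `ψ*f = f ∘ ψ` of germs. -/
def IsInverseBranch.pullback {φ : RatFunc ℂ} {ψ : ℂ → ℂ} {b a : ℂ}
    (h : IsInverseBranch φ ψ b a) (f : PuncturedGerm a) : PuncturedGerm b :=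
  f.compTendsto ψ h.tendsto

end

/-! The second system is reached by elementary moves, each of which `Dominates` its predecessor.
Locally, `1`, `t` and the solution components of the old system, multiplied by one common
nonvanishing factor `v`, become affine combinations of the new variable and of new solution
components; unimodularity of multipliers along simple loops is inherited. The relation is
transitive. Multiplying numerator and denominator of a quotient of degree `d` in `t` and `X` by `v ^
d` gives a quotient of degree `d` in the new variable and `Y`, so the inclusion of fields and the
degree bound come together (`Dominates.pvDegreeLE_pullback`).

Folding (`dominates_foldSystem`): let `c` be the real part of a nonreal singular point and `s = t -
c`. The map `z = s²` makes this point real and keeps real points real. The vector `(x, g x, s)` with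
`g = s ρ(z)` solves a Fuchsian system in `z`. For `ρ = 1` its residues would contain `d` and `1 / d`
with `d = p - c`, which the class does not control. Hence `ρ` is a rational function with real zeros
and poles whose size imitates `|z|^(-1/2)` at all relevant points. With `τ` listing the moduli of
the nonzero `d`, it has poles of size about `τ_l²` and zeros of size about `τ_l τ_(l+1)`, chosen on
the negative axis and kept relatively apart from each other and from the `d²`. All residues are then
bounded in terms of the number of points and the old residues (`exists_foldData`), and `m` folds
make all singular points real (`exists_real_dominating`).

A simple loop in the `z`-plane lifts either to a simple loop, with the same multiplier, or to two
arcs that together form a simple loop, with the multiplier squared (`norm_multiplier_foldSystem`).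
This is how the spectral condition survives.

A real Möbius map then makes infinity nonsingular (`dominates_mobiusSystem`), and the doubling
`[[Re, -Im], [Im, Re]]` makes the residues real (`dominates_realification`). The map `φ` is the
reciprocal of a polynomial of degree `2 ^ m`, and all bounds come from iterating one explicit step.
-/

/-! ### Rational functions with simple poles, given by their residues. -/

/-- The sum of the principal parts `(t - a)⁻¹ • R a`. -/
noncomputable def polarPart {E : Type*} [AddCommGroup E] [Module ℂ E] (R : ℂ →₀ E) (t : ℂ) : E :=
  R.sum fun a M => (t - a)⁻¹ • M

section PolarPart

variable {E F : Type*} [AddCommGroup E] [Module ℂ E] [AddCommGroup F] [Module ℂ F]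

theorem polarPart_add (R R' : ℂ →₀ E) (t : ℂ) :
    polarPart (R + R') t = polarPart R t + polarPart R' t :=
  Finsupp.sum_add_index' (by simp) (by simp)

@[simp]
theorem polarPart_zero (t : ℂ) : polarPart (0 : ℂ →₀ E) t = 0 := by
  simp [polarPart]

theorem polarPart_sub (R R' : ℂ →₀ E) (t : ℂ) :
    polarPart (R - R') t = polarPart R t - polarPart R' t :=
  Finsupp.sum_sub_index fun a M N => smul_sub (t - a)⁻¹ M N

@[simp]
theorem polarPart_single (a : ℂ) (M : E) (t : ℂ) :
    polarPart (Finsupp.single a M) t = (t - a)⁻¹ • M := by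
  simp [polarPart]

theorem polarPart_sum {κ : Type*} (s : Finset κ) (R : κ → ℂ →₀ E) (t : ℂ) :
    polarPart (∑ k ∈ s, R k) t = ∑ k ∈ s, polarPart (R k) t := by
  classical
  induction s using Finset.induction_on with
  | empty => simp
  | insert k s hk ih => rw [Finset.sum_insert hk, Finset.sum_insert hk, polarPart_add, ih]

theorem polarPart_mapRange (T : E →ₗ[ℂ] F) (R : ℂ →₀ E) (t : ℂ) :
    polarPart (R.mapRange T T.map_zero) t = T (polarPart R t) := by
  rw [polarPart, Finsupp.sum_mapRange_index (by simp), polarPart, Finsupp.sum, Finsupp.sum, map_sum]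
  simp

theorem polarPart_eq_sum {s : Finset ℂ} {R : ℂ →₀ E} (h : R.support ⊆ s) (t : ℂ) :
    polarPart R t = ∑ a ∈ s, (t - a)⁻¹ • R a :=
  Finsupp.sum_of_support_subset _ h _ (by simp)

end PolarPart

/-! ### Uniqueness for linear systems in the complex domain. -/

section Solutions

variable {ι : Type} [Fintype ι]

/-- `x` is a vector solution of the Fuchsian system with residues `R` in a neighbourhood of `b`. -/
def IsVecSolution (R : ℂ →₀ Matrix ι ι ℂ) (b : ℂ) (x : ℂ → ι → ℂ) : Prop :=
  ∀ᶠ t in 𝓝 b, HasDerivAt x ((polarPart R t).mulVec (x t)) t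

theorem IsVecSolution.continuousAt {R : ℂ →₀ Matrix ι ι ℂ} {b : ℂ} {x : ℂ → ι → ℂ}
    (h : IsVecSolution R b x) : ContinuousAt x b :=
  h.self_of_nhds.continuousAt

theorem IsVecSolution.sub {R : ℂ →₀ Matrix ι ι ℂ} {b : ℂ} {x y : ℂ → ι → ℂ}
    (hx : IsVecSolution R b x) (hy : IsVecSolution R b y) : IsVecSolution R b (x - y) := by
  filter_upwards [hx, hy] with t h1 h2
  simpa [Matrix.mulVec_sub] using h1.sub h2

theorem IsVecSolution.const_smul {R : ℂ →₀ Matrix ι ι ℂ} {b : ℂ} {x : ℂ → ι → ℂ}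
    (hx : IsVecSolution R b x) (c : ℂ) : IsVecSolution R b (c • x) := by
  filter_upwards [hx] with t h1
  simpa [Matrix.mulVec_smul] using h1.const_smul c

section
attribute [local instance] Matrix.linftyOpNormedAddCommGroup Matrix.linftyOpNormedSpace

theorem analyticAt_polarPart {R : ℂ →₀ Matrix ι ι ℂ} {b : ℂ} (hb : b ∉ R.support) :
    AnalyticAt ℂ (polarPart R) b := by
  have : polarPart R = fun t => ∑ a ∈ R.support, (t - a)⁻¹ • R a := rfl
  rw [this]
  refine Finset.analyticAt_fun_sum _ fun a ha => ?_
  have : b - a ≠ 0 := sub_ne_zero.2 fun h => hb (h ▸ ha)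
  exact ((analyticAt_id.sub analyticAt_const).inv this).smul analyticAt_const

/-- On each segment issuing from `b` the equation becomes a real linear equation with bounded
coefficients, to which Grönwall's inequality applies. -/
theorem IsVecSolution.eventually_eq_zero {R : ℂ →₀ Matrix ι ι ℂ} {b : ℂ} {x : ℂ → ι → ℂ}
    (h : IsVecSolution R b x) (hb : b ∉ R.support) (h0 : x b = 0) : ∀ᶠ t in 𝓝 b, x t = 0 := by
  set K : ℝ := ‖polarPart R b‖ + 1 with hK
  have hbd : ∀ᶠ t in 𝓝 b, ‖polarPart R t‖ < K :=
    (analyticAt_polarPart hb).continuousAt.norm.eventually_lt_const (by linarith)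
  obtain ⟨δ, hδ, hball⟩ := Metric.eventually_nhds_iff_ball.1 (h.and hbd)
  filter_upwards [Metric.ball_mem_nhds b hδ] with t ht
  have hmem : ∀ s ∈ Set.Icc (0 : ℝ) 1, b + s * (t - b) ∈ Metric.ball b δ := by
    intro s hs
    rw [mem_ball_iff_norm] at ht ⊢
    rw [add_sub_cancel_left, norm_mul, Complex.norm_real, Real.norm_of_nonneg hs.1]
    nlinarith [norm_nonneg (t - b), hs.2]
  have hder : ∀ s ∈ Set.Icc (0 : ℝ) 1, HasDerivAt (fun s : ℝ => x (b + s * (t - b)))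
      ((t - b) • (polarPart R (b + s * (t - b))).mulVec (x (b + s * (t - b)))) s := by
    intro s hs
    have h1 := (hball _ (hmem s hs)).1
    have h2 : HasDerivAt (fun s : ℝ => b + (s : ℂ) * (t - b)) (t - b) s := by
      simpa using ((Complex.ofRealCLM.hasDerivAt (x := s)).mul_const (t - b)).const_add b
    exact h1.scomp s h2
  have key := eq_zero_of_abs_deriv_le_mul_abs_self_of_eq_zero_right
    (f := fun s : ℝ => x (b + s * (t - b))) (a := 0) (b := 1) (K := ‖t - b‖ * K)
    (fun s hs => (hder s hs).continuousAt.continuousWithinAt)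
    (fun s hs => (hder s ⟨hs.1, hs.2.le⟩).hasDerivWithinAt) (by simpa using h0)
    (fun s hs => by
      rw [norm_smul, mul_assoc]
      gcongr
      exact (Matrix.linfty_opNorm_mulVec _ _).trans
        (by gcongr; exact (hball _ (hmem s ⟨hs.1, hs.2.le⟩)).2.le))
  simpa using key 1 (by simp)

end

theorem IsVecSolution.eventually_eq {R : ℂ →₀ Matrix ι ι ℂ} {b : ℂ} {x y : ℂ → ι → ℂ}
    (hx : IsVecSolution R b x) (hy : IsVecSolution R b y) (hb : b ∉ R.support) (h0 : x b = y b) :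
    ∀ᶠ t in 𝓝 b, x t = y t := by
  filter_upwards [(hx.sub hy).eventually_eq_zero hb (by simp [h0])] with t ht
  exact sub_eq_zero.1 ht

end Solutions

/-! ### Local existence by power series. -/

section LocalExistence

variable {𝔸 : Type*} [NormedRing 𝔸] [NormedAlgebra ℂ 𝔸]

/-- The Taylor coefficients of the solution of `X' = A X`, `X(b) = 1`, in terms of those of `A`. -/
noncomputable def odeCoeff (a : ℕ → 𝔸) : ℕ → 𝔸
  | 0 => 1
  | k + 1 => ((k + 1 : ℂ)⁻¹) • ∑ i : Fin (k + 1), a (k - i) * odeCoeff a i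

theorem odeCoeff_succ (a : ℕ → 𝔸) (k : ℕ) :
    ((k + 1 : ℕ) : ℂ) • odeCoeff a (k + 1) =
      ∑ p ∈ Finset.HasAntidiagonal.antidiagonal k, a p.1 * odeCoeff a p.2 := by
  have hk : ((k : ℂ) + 1) ≠ 0 := by exact_mod_cast Nat.succ_ne_zero k
  rw [odeCoeff, smul_smul]
  push_cast
  rw [mul_inv_cancel₀ hk, one_smul,
    Fin.sum_univ_eq_sum_range (fun i => a (k - i) * odeCoeff a i) (k + 1),
    ← Finset.Nat.sum_antidiagonal_swap, Finset.Nat.sum_antidiagonal_eq_sum_range_succ_mk]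
  rfl

/-- Geometric majorant: the `k + 1` terms of the recursion are each at most `C * L ^ k`, and the
division by `k + 1` cancels their number. -/
theorem norm_odeCoeff_le (a : ℕ → 𝔸) {C K L : ℝ} (hK : 0 ≤ K) (hKL : K ≤ L) (hCL : C ≤ L)
    (h1 : ‖(1 : 𝔸)‖ ≤ 1) (ha : ∀ i, ‖a i‖ ≤ C * K ^ i) (k : ℕ) : ‖odeCoeff a k‖ ≤ L ^ k := by
  have hC : 0 ≤ C := by simpa using (norm_nonneg _).trans (ha 0)
  have hL : 0 ≤ L := hC.trans hCL
  induction k using Nat.strong_induction_on with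
  | _ k ih =>
    rcases k with _ | k
    · simpa [odeCoeff] using h1
    · have hpos : (0 : ℝ) < (k + 1 : ℕ) := by positivity
      have h2 : ‖((k + 1 : ℕ) : ℂ) • odeCoeff a (k + 1)‖ ≤ (k + 1 : ℕ) * (C * L ^ k) := by
        rw [odeCoeff_succ]
        refine (norm_sum_le _ _).trans ?_
        rw [← nsmul_eq_mul, ← Finset.Nat.card_antidiagonal k]
        refine Finset.sum_le_card_nsmul _ _ _ fun p hp => ?_
        rw [Finset.HasAntidiagonal.mem_antidiagonal] at hp
        calc ‖a p.1 * odeCoeff a p.2‖ ≤ ‖a p.1‖ * ‖odeCoeff a p.2‖ := norm_mul_le _ _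
          _ ≤ (C * K ^ p.1) * L ^ p.2 := by
              gcongr
              · exact ha _
              · exact ih _ (by omega)
          _ ≤ (C * L ^ p.1) * L ^ p.2 := by gcongr
          _ = C * L ^ k := by rw [mul_assoc, ← pow_add, hp]
      rw [norm_smul, Complex.norm_natCast] at h2
      have h3 := le_of_mul_le_mul_left h2 hpos
      calc _ ≤ C * L ^ k := h3
        _ ≤ L * L ^ k := by gcongr
        _ = L ^ (k + 1) := by ring

/-- Local existence of a holomorphic fundamental solution of a linear equation. -/
theorem exists_hasDerivAt_eq_mul [CompleteSpace 𝔸] {A : ℂ → 𝔸} {b : ℂ} (hA : AnalyticAt ℂ A b)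
    (h1 : ‖(1 : 𝔸)‖ ≤ 1) :
    ∃ X : ℂ → 𝔸, X b = 1 ∧ ∀ᶠ t in 𝓝 b, HasDerivAt X (A t * X t) t := by
  obtain ⟨p, hp⟩ := hA
  obtain ⟨r', hp⟩ := hp
  obtain ⟨r, hr0, hr⟩ := ENNReal.lt_iff_exists_nnreal_btwn.1 hp.r_pos
  have hr0' : 0 < r := by exact_mod_cast hr0
  obtain ⟨C, hC, hbd⟩ := p.norm_mul_pow_le_of_lt_radius (hr.trans_le hp.r_le)
  set a : ℕ → 𝔸 := fun i => p.coeff i with ha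
  have hbd' : ∀ i, ‖a i‖ ≤ C * ((r : ℝ)⁻¹) ^ i := by
    intro i
    have h2 := hbd i
    rw [p.norm_apply_eq_norm_coef] at h2
    rw [inv_pow, ← div_eq_mul_inv, le_div_iff₀ (by positivity)]
    exact h2
  -- `L` exceeds both `C` and `r⁻¹`, as the majorant requires. On the disc of radius `1 / (2L)` all
  -- series below are then dominated by geometric ones of ratio `1 / 2`.
  set L : ℝ := C + (r : ℝ)⁻¹ with hL
  have hri : 0 < (r : ℝ)⁻¹ := by positivity
  have hLpos : 0 < L := by positivity
  have hcoef := norm_odeCoeff_le a hri.le (L := L) (by linarith) (by linarith) h1 hbd'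
  set x : ℕ → 𝔸 := odeCoeff a with hx
  refine ⟨fun t => ∑' k, (t - b) ^ k • x k, ?_, ?_⟩
  · change ∑' k, (b - b) ^ k • x k = 1
    rw [tsum_eq_single 0]
    · simp [hx, odeCoeff]
    · intro k hk
      simp [hk]
  have hq : ∀ t ∈ Metric.ball b (2 * L)⁻¹, ‖t - b‖ * L ≤ 1 / 2 := by
    intro t ht
    rw [mem_ball_iff_norm] at ht
    have : ‖t - b‖ * L ≤ (2 * L)⁻¹ * L := by gcongr
    refine this.trans (le_of_eq ?_)
    field_simp
  filter_upwards [Metric.ball_mem_nhds b (show 0 < (2 * L)⁻¹ by positivity)] with t ht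
  have hterm : ∀ t ∈ Metric.ball b (2 * L)⁻¹, ∀ k, ‖(t - b) ^ k • x k‖ ≤ (1 / 2) ^ k := by
    intro t ht k
    rw [norm_smul, norm_pow]
    calc ‖t - b‖ ^ k * ‖x k‖ ≤ ‖t - b‖ ^ k * L ^ k := by gcongr; exact hcoef k
      _ = (‖t - b‖ * L) ^ k := by rw [mul_pow]
      _ ≤ _ := by gcongr; exact hq t ht
  have hsx : Summable fun k => ‖(t - b) ^ k • x k‖ :=
    Summable.of_nonneg_of_le (fun _ => norm_nonneg _) (hterm t ht)
      (summable_geometric_of_lt_one (by norm_num) (by norm_num))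
  have hterma : ∀ k, ‖(t - b) ^ k • a k‖ ≤ C * (1 / 2) ^ k := by
    intro k
    rw [norm_smul, norm_pow]
    calc ‖t - b‖ ^ k * ‖a k‖ ≤ ‖t - b‖ ^ k * (C * ((r : ℝ)⁻¹) ^ k) := by gcongr; exact hbd' k
      _ ≤ ‖t - b‖ ^ k * (C * L ^ k) := by gcongr; linarith
      _ = C * (‖t - b‖ * L) ^ k := by rw [mul_pow]; ring
      _ ≤ _ := by gcongr; exact hq t ht
  have hsa : Summable fun k => ‖(t - b) ^ k • a k‖ :=
    Summable.of_nonneg_of_le (fun _ => norm_nonneg _) hterma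
      ((summable_geometric_of_lt_one (by norm_num) (by norm_num)).mul_left C)
  have hAt : A t = ∑' k, (t - b) ^ k • a k := by
    have hmem : t ∈ Metric.eball b r' := by
      have h3 : ‖t - b‖ < r := by
        have h4 := hq t ht
        have h5 : (r : ℝ)⁻¹ ≤ L := by linarith
        have h6 : ‖t - b‖ * (r : ℝ)⁻¹ ≤ 1 / 2 := le_trans (by gcongr) h4
        rw [← div_eq_mul_inv, div_le_iff₀ (by positivity)] at h6
        have : (0 : ℝ) < r := by exact_mod_cast hr0'
        linarith
      rw [Metric.mem_eball, edist_dist, dist_eq_norm]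
      refine lt_of_le_of_lt ?_ hr
      rw [ENNReal.ofReal_le_iff_le_toReal (by simp)]
      simpa using h3.le
    have h7 := hp.hasSum_sub hmem
    rw [← h7.tsum_eq]
    simp [ha]
  have hder : HasDerivAt (fun t => ∑' k, (t - b) ^ k • x k)
      (∑' k : ℕ, ((k : ℂ) * (t - b) ^ (k - 1)) • x k) t := by
    refine hasDerivAt_tsum_of_isPreconnected (t := Metric.ball b (2 * L)⁻¹)
      (u := fun k : ℕ => (2 * L) * ((k : ℝ) ^ 1 * (1 / 2) ^ k)) ?_
      (g' := fun (k : ℕ) y => ((k : ℂ) * (y - b) ^ (k - 1)) • x k)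
      Metric.isOpen_ball (convex_ball _ _).isPreconnected ?_ ?_ ht hsx.of_norm ht
    · exact (summable_pow_mul_geometric_of_norm_lt_one 1
        (show ‖(1 / 2 : ℝ)‖ < 1 by norm_num)).mul_left _
    · intro k y hy
      have := ((hasDerivAt_id y).sub_const b).pow k
      simpa using this.smul_const (x k)
    · intro k y hy
      rcases k with _ | k
      · simp
      rw [norm_smul, norm_mul, norm_pow, Complex.norm_natCast, Nat.add_sub_cancel]
      calc ((k + 1 : ℕ) : ℝ) * ‖y - b‖ ^ k * ‖x (k + 1)‖
          ≤ ((k + 1 : ℕ) : ℝ) * ‖y - b‖ ^ k * L ^ (k + 1) := by gcongr; exact hcoef _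
        _ = L * ((k + 1 : ℕ) * (‖y - b‖ * L) ^ k) := by rw [mul_pow]; ring
        _ ≤ L * ((k + 1 : ℕ) * (1 / 2) ^ k) := by gcongr; exact hq y hy
        _ = _ := by ring
  have hsd : Summable fun k : ℕ => ((k : ℂ) * (t - b) ^ (k - 1)) • x k := by
    rw [← summable_nat_add_iff 1]
    have h8 := (summable_norm_sum_mul_antidiagonal_of_summable_norm hsa hsx).of_norm
    refine h8.congr fun k => ?_
    rw [Nat.add_sub_cancel, mul_comm, mul_smul, odeCoeff_succ, Finset.smul_sum]
    refine Finset.sum_congr rfl fun p hp => ?_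
    rw [Finset.HasAntidiagonal.mem_antidiagonal] at hp
    rw [smul_mul_smul_comm, ← pow_add, hp]
  convert hder using 1
  rw [hAt, tsum_mul_tsum_eq_tsum_sum_antidiagonal_of_summable_norm hsa hsx, hsd.tsum_eq_zero_add]
  simp only [Nat.cast_zero, zero_mul, zero_smul, zero_add]
  refine tsum_congr fun k => ?_
  rw [Nat.add_sub_cancel, mul_comm (((k + 1 : ℕ) : ℂ)), mul_smul, odeCoeff_succ, Finset.smul_sum]
  refine Finset.sum_congr rfl fun p hp => ?_
  rw [Finset.HasAntidiagonal.mem_antidiagonal] at hp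
  rw [smul_mul_smul_comm, ← pow_add, hp]

end LocalExistence

/-! ### Continuation of fundamental matrices along paths. -/

namespace FuchsianSystem

variable {n : ℕ} (S : FuchsianSystem n)

theorem polarPart_residue (t : ℂ) : polarPart S.residue t = S.coeff t := rfl

variable {S}

theorem isSolutionNear_iff {b : ℂ} {X : ℂ → Matrix (Fin n) (Fin n) ℂ} :
    S.IsSolutionNear b X ↔ ∀ j, IsVecSolution S.residue b fun t i => X t i j := by
  simp only [IsSolutionNear, IsVecSolution, polarPart_residue, hasDerivAt_pi]
  rw [← eventually_all]
  refine eventually_congr (Eventually.of_forall fun t => ?_)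
  exact forall_comm

theorem IsSolutionNear.mulVec {b : ℂ} {X : ℂ → Matrix (Fin n) (Fin n) ℂ}
    (h : S.IsSolutionNear b X) (c : Fin n → ℂ) :
    IsVecSolution S.residue b fun t => (X t).mulVec c := by
  filter_upwards [h] with t ht
  rw [hasDerivAt_pi]
  intro i
  rw [polarPart_residue, Matrix.mulVec_mulVec]
  simp only [Matrix.mulVec, dotProduct]
  exact HasDerivAt.fun_sum fun j _ => (ht i j).mul_const (c j)

theorem IsSolutionNear.mul_const {b : ℂ} {X : ℂ → Matrix (Fin n) (Fin n) ℂ}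
    (h : S.IsSolutionNear b X) (C : Matrix (Fin n) (Fin n) ℂ) :
    S.IsSolutionNear b fun t => X t * C := by
  rw [isSolutionNear_iff]
  intro j
  exact h.mulVec fun i => C i j

theorem IsSolutionNear.eventually_eq {b : ℂ} {X Y : ℂ → Matrix (Fin n) (Fin n) ℂ}
    (hX : S.IsSolutionNear b X) (hY : S.IsSolutionNear b Y) (hb : b ∉ S.poles) (h0 : X b = Y b) :
    ∀ᶠ t in 𝓝 b, X t = Y t := by
  rw [isSolutionNear_iff] at hX hY
  have := eventually_all.2 fun j => (hX j).eventually_eq (hY j) hb (by simp [h0])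
  filter_upwards [this] with t ht
  ext i j
  exact congr_fun (ht j) i

theorem IsSolutionNear.continuousAt {b : ℂ} {X : ℂ → Matrix (Fin n) (Fin n) ℂ}
    (h : S.IsSolutionNear b X) : ContinuousAt X b :=
  continuousAt_pi.2 fun i => continuousAt_pi.2 fun j => (h.self_of_nhds i j).continuousAt

section
attribute [local instance] Matrix.linftyOpNormedRing Matrix.linftyOpNormedAlgebra

theorem exists_isSolutionNear {b : ℂ} (hb : b ∉ S.poles) :
    ∃ X, S.IsSolutionNear b X ∧ X b = 1 := by
  obtain ⟨X, h1, hX⟩ := exists_hasDerivAt_eq_mul (analyticAt_polarPart hb) (by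
    rw [← Matrix.diagonal_one, Matrix.linfty_opNorm_diagonal]
    exact (pi_norm_const_le _).trans_eq norm_one)
  refine ⟨X, ?_, h1⟩
  filter_upwards [hX] with t ht i j
  exact hasDerivAt_pi.1 (hasDerivAt_pi.1 ht i) j

end

/-- A fundamental solution can be continued along any path avoiding the poles. -/
theorem exists_isContinuationAlong {γ : ℝ → ℂ} (hγ : ContinuousOn γ (Set.Icc 0 1))
    (hS : ∀ s ∈ Set.Icc (0 : ℝ) 1, γ s ∉ S.poles) :
    ∃ Z, S.IsContinuationAlong γ Z ∧ Z 0 = 1 := by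
  have hloc : ∀ s : Set.Icc (0 : ℝ) 1, ∃ F : ℂ → Matrix (Fin n) (Fin n) ℂ, ∃ U : Set ℂ,
      IsOpen U ∧ γ s ∈ U ∧ ∀ u ∈ U, S.IsSolutionNear u F ∧ (F u).det ≠ 0 := by
    intro s
    obtain ⟨F, hF, hF1⟩ := exists_isSolutionNear (hS s s.2)
    have hdet : ∀ᶠ u in 𝓝 (γ s), (F u).det ≠ 0 := by
      refine (Continuous.matrix_det continuous_id).continuousAt.comp hF.continuousAt
        |>.eventually_ne ?_
      simp [hF1]
    obtain ⟨U, hU, hUo, hUs⟩ := eventually_nhds_iff.1 ((eventually_eventually_nhds.2 hF).and hdet)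
    exact ⟨F, U, hUo, hUs, hU⟩
  choose F U hUo hUs hFU using hloc
  -- Compactness cuts the path into finitely many arcs, each inside the domain of one local
  -- fundamental solution.
  obtain ⟨τ, hτ0, hτm, ⟨k, hk⟩, hτ⟩ := exists_monotone_Icc_subset_open_cover_unitInterval
    (c := fun s => (Set.Icc (0 : ℝ) 1).domRestrict γ ⁻¹' U s)
    (fun s => (hUo s).preimage hγ.domRestrict)
    (fun s _ => Set.mem_iUnion.2 ⟨s, hUs s⟩)
  have key : ∀ j : ℕ, ∃ Z : ℝ → Matrix (Fin n) (Fin n) ℂ, Z 0 = 1 ∧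
      ∀ s ∈ Set.Icc (0 : ℝ) (τ j), ∃ F : ℂ → Matrix (Fin n) (Fin n) ℂ,
        S.IsSolutionNear (γ s) F ∧ ∀ᶠ s' in 𝓝[Set.Icc (0 : ℝ) (τ j)] s, Z s' = F (γ s') := by
    intro j
    induction j with
    | zero =>
      obtain ⟨G, hG, hG1⟩ := exists_isSolutionNear (hS 0 (by simp))
      refine ⟨fun s => G (γ s), hG1, fun s hs => ⟨G, ?_, Eventually.of_forall fun _ => rfl⟩⟩
      rw [hτ0] at hs
      have : s = 0 := le_antisymm hs.2 hs.1
      rwa [this]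
    | succ j ih =>
      obtain ⟨Z, hZ0, hZ⟩ := ih
      obtain ⟨p, hp⟩ := hτ j
      have hjj : (τ j : ℝ) ≤ τ (j + 1) := hτm (Nat.le_succ j)
      have hsub : Set.Icc (0 : ℝ) (τ (j + 1)) ⊆ Set.Icc 0 1 :=
        Set.Icc_subset_Icc le_rfl (τ (j + 1)).2.2
      have hp' : ∀ s ∈ Set.Icc (τ j : ℝ) (τ (j + 1)), γ s ∈ U p := fun s hs =>
        hp (a := ⟨s, hsub ⟨(τ j).2.1.trans hs.1, hs.2⟩⟩) hs
      -- The constant right factor that makes the next local solution take the value already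
      -- reached.
      set C := (F p (γ (τ j)))⁻¹ * Z (τ j) with hC
      have hFj := hFU p _ (hp' _ ⟨le_rfl, hjj⟩)
      have hFC : F p (γ (τ j)) * C = Z (τ j) := by
        rw [hC, ← mul_assoc, Matrix.mul_nonsing_inv _ (isUnit_iff_ne_zero.2 hFj.2), one_mul]
      refine ⟨fun s => if s ≤ τ j then Z s else F p (γ s) * C,
        by simp [(τ j).2.1, hZ0], fun s hs => ?_⟩
      rcases lt_trichotomy s (τ j) with h | h | h
      · obtain ⟨G, hG, hGe⟩ := hZ s ⟨hs.1, h.le⟩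
        refine ⟨G, hG, ?_⟩
        rw [eventually_nhdsWithin_iff] at hGe ⊢
        filter_upwards [hGe, Iio_mem_nhds h] with u hu hu' hu2
        have hu' : u < τ j := hu'
        rw [if_pos hu'.le]
        exact hu ⟨hu2.1, hu'.le⟩
      · obtain ⟨G, hG, hGe⟩ := hZ s ⟨hs.1, h.le⟩
        refine ⟨G, hG, ?_⟩
        have hGs : Z s = G (γ s) := hGe.self_of_nhdsWithin ⟨hs.1, h.le⟩
        -- Uniqueness identifies the two germs at the junction, so `G` alone describes the
        -- continuation on both sides.
        have huniq : ∀ᶠ u in 𝓝 (γ s), G u = F p u * C := by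
          refine hG.eventually_eq ?_ (hS _ (hsub hs)) ?_
          · rw [h]
            exact hFj.1.mul_const C
          · rw [← hGs, h, hFC]
        have huniq' := ((hγ s (hsub hs)).mono hsub).eventually huniq
        rw [eventually_nhdsWithin_iff] at hGe huniq' ⊢
        filter_upwards [hGe, huniq'] with u hu hu' hu2
        split_ifs with h3
        · exact hu ⟨hu2.1, h3⟩
        · exact (hu' hu2).symm
      · refine ⟨fun u => F p u * C, (hFU p _ (hp' s ⟨h.le, hs.2⟩)).1.mul_const C, ?_⟩
        refine mem_nhdsWithin_of_mem_nhds ?_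
        filter_upwards [Ioi_mem_nhds h] with u hu
        exact if_neg (not_le.2 hu)
  obtain ⟨Z, hZ0, hZ⟩ := key k
  rw [hk k le_rfl] at hZ
  exact ⟨Z, hZ, hZ0⟩

end FuchsianSystem

/-! ### The spectral condition in terms of eigenvectors. -/

section Continuation

variable {ι : Type} [Fintype ι]

/-- `y` is the continuation of a vector solution along the path `γ : [0,1] → ℂ`. -/
def IsVecContinuation (R : ℂ →₀ Matrix ι ι ℂ) (γ : ℝ → ℂ) (y : ℝ → ι → ℂ) : Prop :=
  ∀ s ∈ Set.Icc (0 : ℝ) 1, ∃ F : ℂ → ι → ℂ,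
    IsVecSolution R (γ s) F ∧ ∀ᶠ s' in 𝓝[Set.Icc (0 : ℝ) 1] s, y s' = F (γ s')

theorem eq_of_locally_const_Icc {α : Type*} {f : ℝ → α}
    (h : ∀ s ∈ Set.Icc (0 : ℝ) 1, ∀ᶠ u in 𝓝[Set.Icc (0 : ℝ) 1] s, f u = f s) : f 1 = f 0 := by
  have hlc : IsLocallyConstant ((Set.Icc (0 : ℝ) 1).domRestrict f) := by
    rw [IsLocallyConstant.iff_eventually_eq]
    intro s
    have := h s s.2
    rw [nhdsWithin_eq_map_subtype_coe s.2] at this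
    exact this
  exact hlc.apply_eq_of_isPreconnected (s := Set.univ) isPreconnected_univ
    (x := ⟨1, by simp⟩) (y := ⟨0, by simp⟩) trivial trivial

/-- The truth value of `y s = 0` is locally constant: where it holds by uniqueness, where it fails
by continuity. -/
theorem IsVecContinuation.eq_zero {R : ℂ →₀ Matrix ι ι ℂ} {γ : ℝ → ℂ} {y : ℝ → ι → ℂ}
    (h : IsVecContinuation R γ y) (hγ : ContinuousOn γ (Set.Icc 0 1))
    (hR : ∀ s ∈ Set.Icc (0 : ℝ) 1, γ s ∉ R.support) (h0 : y 0 = 0) : y 1 = 0 := by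
  have := eq_of_locally_const_Icc (f := fun s => y s = 0) fun s hs => by
    obtain ⟨F, hF, hFy⟩ := h s hs
    have hs0 : y s = F (γ s) := hFy.self_of_nhdsWithin hs
    by_cases hz : y s = 0
    · have := (hγ s hs).eventually (hF.eventually_eq_zero (hR s hs) (hs0 ▸ hz))
      filter_upwards [hFy, this] with u h1 h2
      simp [h1, h2, hz]
    · have := (hF.continuousAt.comp_continuousWithinAt (hγ s hs)).eventually_ne (hs0 ▸ hz)
      filter_upwards [hFy, this] with u h1 h2
      simp only [Function.comp_apply] at h2
      simp [h1, h2, hz]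
  rw [this]
  exact h0

/-- The simple-loop spectral condition for vector solutions and loops avoiding `σ`. -/
def VecSpectralCondition (R : ℂ →₀ Matrix ι ι ℂ) (σ : Finset ℂ) : Prop :=
  ∀ γ : ℝ → ℂ, IsSimpleLoop γ → (∀ s ∈ Set.Icc (0 : ℝ) 1, γ s ∉ σ) →
    ∀ (μ : ℂ) (y : ℝ → ι → ℂ), IsVecContinuation R γ y → y 0 ≠ 0 → y 1 = μ • y 0 → ‖μ‖ = 1

/-- Let `Z` be the continuation of the fundamental matrix starting at `1`. Then `Z` applied to `y 0`
and `y` itself continue the same initial value, so `y 0` is an eigenvector of the monodromy factor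
`Z 1`. -/
theorem FuchsianSystem.SpectralCondition.vec {n : ℕ} {S : FuchsianSystem n}
    (h : S.SpectralCondition) : VecSpectralCondition S.residue S.poles := by
  intro γ hγ hS μ y hy hy0 hy1
  obtain ⟨Z, hZ, hZ0⟩ := FuchsianSystem.exists_isContinuationAlong hγ.1 hS
  refine h γ hγ hS (Z 1) ⟨Z, hZ, by simp [hZ0], by simp [hZ0]⟩ μ ?_
  have hsub : IsVecContinuation S.residue γ fun s => (Z s).mulVec (y 0) - y s := by
    intro s hs
    obtain ⟨F, hF, hFZ⟩ := hZ s hs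
    obtain ⟨G, hG, hGy⟩ := hy s hs
    refine ⟨_, (hF.mulVec (y 0)).sub hG, ?_⟩
    filter_upwards [hFZ, hGy] with u h1 h2
    simp [h1, h2]
  have h1 := hsub.eq_zero hγ.1 hS (by simp [hZ0])
  rw [sub_eq_zero, hy1] at h1
  rw [← Matrix.spectrum_toLin', ← Module.End.hasEigenvalue_iff_mem_spectrum]
  exact Module.End.hasEigenvalue_of_hasEigenvector
    (Module.End.hasEigenvector_iff.2 ⟨Module.End.mem_eigenspace_iff.2 (by simpa using h1), hy0⟩)

/-- An eigenvector `v` of the monodromy factor gives the multiplicative vector solution `Z v`. -/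
theorem VecSpectralCondition.spectralCondition {n : ℕ} {S : FuchsianSystem n}
    (h : VecSpectralCondition S.residue S.poles) : S.SpectralCondition := by
  intro γ hγ hS M ⟨Z, hZ, hZ0, hZ1⟩ μ hμ
  rw [← Matrix.spectrum_toLin', ← Module.End.hasEigenvalue_iff_mem_spectrum] at hμ
  obtain ⟨v, hv⟩ := hμ.exists_hasEigenvector
  have hv1 : M.mulVec v = μ • v := by simpa using hv.apply_eq_smul
  refine h γ hγ hS μ (fun s => (Z s).mulVec v) ?_ ?_ ?_
  · intro s hs
    obtain ⟨F, hF, hFZ⟩ := hZ s hs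
    exact ⟨_, hF.mulVec v, hFZ.mono fun u hu => by simp [hu]⟩
  · intro h0
    exact hv.2 (Matrix.eq_zero_of_mulVec_eq_zero hZ0 h0)
  · simp only [hZ1]
    rw [← Matrix.mulVec_mulVec, hv1, Matrix.mulVec_smul]

end Continuation

/-! ### The domination relation between systems. -/

section Domination

variable {ι κ ν : Type} [Fintype ι] [Fintype κ] [Fintype ν]

/-- The span of `1`, of the independent variable and of the components of the solutions near `b`. -/
def affineSolutionSpan (R : ℂ →₀ Matrix ι ι ℂ) (b : ℂ) : Submodule ℂ (ℂ → ℂ) :=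
  Submodule.span ℂ ({fun _ => 1, fun z => z} ∪
    {f | ∃ (x : ℂ → ι → ℂ) (i : ι), IsVecSolution R b x ∧ f = fun t => x t i})

theorem one_mem_affineSolutionSpan (R : ℂ →₀ Matrix ι ι ℂ) (b : ℂ) :
    (fun _ => 1) ∈ affineSolutionSpan R b :=
  Submodule.subset_span (by simp)

theorem id_mem_affineSolutionSpan (R : ℂ →₀ Matrix ι ι ℂ) (b : ℂ) :
    (fun z => z) ∈ affineSolutionSpan R b :=
  Submodule.subset_span (by simp)

theorem IsVecSolution.mem_affineSolutionSpan {R : ℂ →₀ Matrix ι ι ℂ} {b : ℂ} {x : ℂ → ι → ℂ}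
    (hx : IsVecSolution R b x) (i : ι) : (fun t => x t i) ∈ affineSolutionSpan R b :=
  Submodule.subset_span (Or.inr ⟨x, i, hx, rfl⟩)

/-- The system `R'` with singular set `σ'` dominates, through the map `φ`, the system `R` with
singular set `σ`: locally, solutions of `R` are ratios of affine combinations of solutions of `R'`
with a common denominator, and the spectral condition is inherited. -/
structure Dominates (φ : ℂ → ℂ) (R : ℂ →₀ Matrix ι ι ℂ) (σ : Finset ℂ)
    (R' : ℂ →₀ Matrix κ κ ℂ) (σ' : Finset ℂ) : Prop where
  avoid : ∀ a, φ a ∉ σ' → a ∉ σ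
  cont : ∀ a, φ a ∉ σ' → ContinuousAt φ a
  lift : ∀ a, φ a ∉ σ' → ∃ v : ℂ → ℂ, (∀ᶠ t in 𝓝 a, v t ≠ 0) ∧
    ∀ f ∈ affineSolutionSpan R a, ∃ F ∈ affineSolutionSpan R' (φ a),
      ∀ᶠ t in 𝓝 a, F (φ t) = v t * f t
  spec : VecSpectralCondition R σ → VecSpectralCondition R' σ'

theorem forall_mem_affineSolutionSpan {φ : ℂ → ℂ} {R : ℂ →₀ Matrix ι ι ℂ} {R' : ℂ →₀ Matrix κ κ ℂ}
    {a : ℂ} {v : ℂ → ℂ}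
    (h1 : ∃ F ∈ affineSolutionSpan R' (φ a), ∀ᶠ t in 𝓝 a, F (φ t) = v t)
    (h2 : ∃ F ∈ affineSolutionSpan R' (φ a), ∀ᶠ t in 𝓝 a, F (φ t) = v t * t)
    (h3 : ∀ x, IsVecSolution R a x → ∀ i, ∃ F ∈ affineSolutionSpan R' (φ a),
      ∀ᶠ t in 𝓝 a, F (φ t) = v t * x t i) :
    ∀ f ∈ affineSolutionSpan R a, ∃ F ∈ affineSolutionSpan R' (φ a),
      ∀ᶠ t in 𝓝 a, F (φ t) = v t * f t := by
  intro f hf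
  refine Submodule.span_induction (p := fun f _ => ∃ F ∈ affineSolutionSpan R' (φ a),
      ∀ᶠ t in 𝓝 a, F (φ t) = v t * f t) ?_ ?_ ?_ ?_ hf
  · rintro f ((rfl | rfl) | ⟨x, i, hx, rfl⟩)
    · simpa using h1
    · exact h2
    · exact h3 x hx i
  · exact ⟨0, zero_mem _, by simp⟩
  · rintro f g _ _ ⟨F, hF, hFf⟩ ⟨G, hG, hGg⟩
    refine ⟨F + G, add_mem hF hG, ?_⟩
    filter_upwards [hFf, hGg] with t h h'
    simp [h, h', mul_add]
  · rintro c f _ ⟨F, hF, hFf⟩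
    refine ⟨c • F, Submodule.smul_mem _ c hF, ?_⟩
    filter_upwards [hFf] with t h
    simp only [Pi.smul_apply, smul_eq_mul, h]
    ring

theorem Dominates.trans {φ φ' : ℂ → ℂ} {R : ℂ →₀ Matrix ι ι ℂ} {σ : Finset ℂ}
    {R' : ℂ →₀ Matrix κ κ ℂ} {σ' : Finset ℂ} {R'' : ℂ →₀ Matrix ν ν ℂ} {σ'' : Finset ℂ}
    (h : Dominates φ R σ R' σ') (h' : Dominates φ' R' σ' R'' σ'') :
    Dominates (φ' ∘ φ) R σ R'' σ'' where
  avoid a ha := h.avoid a (h'.avoid _ ha)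
  cont a ha := (h'.cont _ ha).comp (h.cont a (h'.avoid _ ha))
  lift a ha := by
    have ha' := h'.avoid _ ha
    obtain ⟨v, hv, hf⟩ := h.lift a ha'
    obtain ⟨v', hv', hf'⟩ := h'.lift _ ha
    refine ⟨fun t => v' (φ t) * v t, ?_, ?_⟩
    · filter_upwards [hv, (h.cont a ha').eventually hv'] with t h1 h2
      exact mul_ne_zero h2 h1
    · intro f hfa
      obtain ⟨F, hF, hFe⟩ := hf f hfa
      obtain ⟨G, hG, hGe⟩ := hf' F hF
      refine ⟨G, hG, ?_⟩
      filter_upwards [hFe, (h.cont a ha').eventually hGe] with t h1 h2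
      rw [Function.comp_apply, h2, h1, mul_assoc]
  spec hR := h'.spec (h.spec hR)

theorem Dominates.refl (R : ℂ →₀ Matrix ι ι ℂ) (σ : Finset ℂ) : Dominates id R σ R σ where
  avoid _ ha := ha
  cont _ _ := continuousAt_id
  lift _ _ := ⟨fun _ => 1, by simp, fun f hf => ⟨f, hf, by simp⟩⟩
  spec h := h

/-- Relabelling the coordinates. -/
theorem dominates_reindex (e : ι ≃ κ) (R : ℂ →₀ Matrix ι ι ℂ) (σ : Finset ℂ) :
    Dominates id R σ (R.mapRange (Matrix.reindexLinearEquiv ℂ ℂ e e) (map_zero _)) σ := by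
  have hpol : ∀ t, polarPart (R.mapRange (Matrix.reindexLinearEquiv ℂ ℂ e e) (map_zero _)) t =
      Matrix.reindex e e (polarPart R t) := fun t =>
    polarPart_mapRange (Matrix.reindexLinearEquiv ℂ ℂ e e).toLinearMap R t
  have hsol : ∀ b x, IsVecSolution R b x → IsVecSolution
      (R.mapRange (Matrix.reindexLinearEquiv ℂ ℂ e e) (map_zero _)) b fun t k => x t (e.symm k) := by
    intro b x hx
    filter_upwards [hx] with t ht
    rw [hasDerivAt_pi] at ht ⊢
    intro k
    convert ht (e.symm k) using 1
    rw [hpol, Matrix.reindex_apply]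
    simp only [Matrix.mulVec, dotProduct, Matrix.submatrix_apply]
    exact e.symm.sum_comp fun j => polarPart R t (e.symm k) j * x t j
  have hsol' : ∀ b y, IsVecSolution
      (R.mapRange (Matrix.reindexLinearEquiv ℂ ℂ e e) (map_zero _)) b y →
      IsVecSolution R b fun t i => y t (e i) := by
    intro b y hy
    filter_upwards [hy] with t ht
    rw [hasDerivAt_pi] at ht ⊢
    intro i
    convert ht (e i) using 1
    rw [hpol, Matrix.reindex_apply]
    simp only [Matrix.mulVec, dotProduct, Matrix.submatrix_apply, Equiv.symm_apply_apply]
    rw [← e.sum_comp]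
    simp
  refine ⟨fun _ ha => ha, fun _ _ => continuousAt_id, fun a ha => ⟨fun _ => 1, by simp, ?_⟩, ?_⟩
  · refine forall_mem_affineSolutionSpan ⟨_, one_mem_affineSolutionSpan _ _, by simp⟩
      ⟨_, id_mem_affineSolutionSpan _ _, by simp⟩ fun x hx i =>
      ⟨_, (hsol _ _ hx).mem_affineSolutionSpan (e i), by simp⟩
  · intro h γ hγ hσ μ y hy hy0 hy1
    refine h γ hγ hσ μ (fun s i => y s (e i)) (fun s hs => ?_) (fun h0 => hy0 ?_) ?_
    · obtain ⟨F, hF, hFy⟩ := hy s hs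
      exact ⟨_, hsol' _ _ hF, hFy.mono fun u hu => by simp [hu]⟩
    · funext k
      simpa using congr_fun h0 (e.symm k)
    · funext i
      simp [hy1]

end Domination

/-! ### Real residues by doubling the dimension. -/

section Realification

variable {ι : Type}

/-- The residues of the realification `[[Re, -Im], [Im, Re]]` of a system. -/
noncomputable def realification (R : ℂ →₀ Matrix ι ι ℂ) : ℂ →₀ Matrix (ι ⊕ ι) (ι ⊕ ι) ℂ :=
  R.mapRange (fun M => Matrix.fromBlocks (M.map fun z => (z.re : ℂ)) (-(M.map fun z => (z.im : ℂ)))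
    (M.map fun z => (z.im : ℂ)) (M.map fun z => (z.re : ℂ)))
    (by ext (i | i) (j | j) <;> simp)

theorem im_realification (R : ℂ →₀ Matrix ι ι ℂ) (z : ℂ) (i j : ι ⊕ ι) :
    (realification R z i j).im = 0 := by
  rcases i with i | i <;> rcases j with j | j <;> simp [realification]

theorem norm_realification_le {R : ℂ →₀ Matrix ι ι ℂ} {C : ℝ} (h : ∀ z i j, ‖R z i j‖ ≤ C) (z : ℂ)
    (i j : ι ⊕ ι) : ‖realification R z i j‖ ≤ C := by
  have h1 : ∀ i j, |(R z i j).re| ≤ C := fun i j => (Complex.abs_re_le_norm _).trans (h z i j)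
  have h2 : ∀ i j, |(R z i j).im| ≤ C := fun i j => (Complex.abs_im_le_norm _).trans (h z i j)
  rcases i with i | i <;> rcases j with j | j <;> simp [realification, h1, h2]

theorem support_realification (R : ℂ →₀ Matrix ι ι ℂ) : (realification R).support = R.support := by
  refine Finsupp.support_mapRange_of_injective _ _ fun M N h => ?_
  ext i j
  have h1 := congr_fun (congr_fun h (Sum.inl i)) (Sum.inl j)
  have h2 := congr_fun (congr_fun h (Sum.inr i)) (Sum.inl j)
  simp only [Matrix.fromBlocks_apply₁₁, Matrix.fromBlocks_apply₂₁, Matrix.map_apply,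
    Complex.ofReal_inj] at h1 h2
  exact Complex.ext h1 h2

theorem sum_realification {R : ℂ →₀ Matrix ι ι ℂ} (h : ∑ a ∈ R.support, R a = 0) :
    ∑ a ∈ (realification R).support, realification R a = 0 := by
  have h' : ∀ i j, ∑ a ∈ R.support, R a i j = 0 := fun i j => by
    simpa [Matrix.sum_apply] using congr_fun (congr_fun h i) j
  have hre : ∀ i j, ∑ a ∈ R.support, ((R a i j).re : ℂ) = 0 := fun i j => by
    have := congrArg Complex.re (h' i j)
    rw [Complex.re_sum] at this
    exact_mod_cast this
  have him : ∀ i j, ∑ a ∈ R.support, ((R a i j).im : ℂ) = 0 := fun i j => by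
    have := congrArg Complex.im (h' i j)
    rw [Complex.im_sum] at this
    exact_mod_cast this
  rw [support_realification]
  ext (i | i) (j | j) <;> simp [Matrix.sum_apply, realification, hre, him]

variable [Fintype ι]

theorem polarPart_realification_mulVec_inl (R : ℂ →₀ Matrix ι ι ℂ) (t : ℂ) (y : ι ⊕ ι → ℂ) (i : ι) :
    ((polarPart (realification R) t).mulVec y) (Sum.inl i) =
      ∑ a ∈ R.support, (t - a)⁻¹ * ∑ j, ((R a i j).re * y (Sum.inl j) -
        (R a i j).im * y (Sum.inr j)) := by
  rw [polarPart_eq_sum (support_realification R).le, Matrix.sum_mulVec, Finset.sum_apply]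
  refine Finset.sum_congr rfl fun a _ => ?_
  rw [Matrix.smul_mulVec, Pi.smul_apply, smul_eq_mul]
  rw [Finset.sum_sub_distrib, sub_eq_add_neg (∑ j, _) (∑ j, _)]
  simp [Matrix.mulVec, dotProduct, realification, Fintype.sum_sum_type]

theorem polarPart_realification_mulVec_inr (R : ℂ →₀ Matrix ι ι ℂ) (t : ℂ) (y : ι ⊕ ι → ℂ) (i : ι) :
    ((polarPart (realification R) t).mulVec y) (Sum.inr i) =
      ∑ a ∈ R.support, (t - a)⁻¹ * ∑ j, ((R a i j).im * y (Sum.inl j) +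
        (R a i j).re * y (Sum.inr j)) := by
  rw [polarPart_eq_sum (support_realification R).le, Matrix.sum_mulVec, Finset.sum_apply]
  refine Finset.sum_congr rfl fun a _ => ?_
  rw [Matrix.smul_mulVec, Pi.smul_apply, smul_eq_mul]
  simp [Matrix.mulVec, dotProduct, realification, Fintype.sum_sum_type, Finset.sum_add_distrib]

theorem polarPart_mulVec_apply (R : ℂ →₀ Matrix ι ι ℂ) (t : ℂ) (x : ι → ℂ) (i : ι) :
    ((polarPart R t).mulVec x) i = ∑ a ∈ R.support, (t - a)⁻¹ * ∑ j, R a i j * x j := by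
  rw [polarPart_eq_sum subset_rfl, Matrix.sum_mulVec, Finset.sum_apply]
  refine Finset.sum_congr rfl fun a _ => ?_
  rw [Matrix.smul_mulVec, Pi.smul_apply, smul_eq_mul]
  rfl

/-- A solution `x` lifts to `(x, -i x)`. Conversely, for a solution `(y₁, y₂)` the sum `y₁ + i y₂`
solves the original system, while `y₁ - i y₂` solves the one with conjugate residues. As the poles
are real, conjugating both the path and the values turns the latter into a solution of the original
system. -/
theorem dominates_realification {R : ℂ →₀ Matrix ι ι ℂ} {σ : Finset ℂ}
    (hreal : ∀ z ∈ R.support, z.im = 0) (hσ : ∀ z ∈ σ, z.im = 0) :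
    Dominates id R σ (realification R) σ := by
  have hI : Complex.I * Complex.I = -1 := Complex.I_mul_I
  have hM : ∀ z : ℂ, z = z.re + z.im * Complex.I := fun z => (Complex.re_add_im z).symm
  refine ⟨fun _ ha => ha, fun _ _ => continuousAt_id, fun a ha => ⟨fun _ => 1, by simp, ?_⟩, ?_⟩
  · refine forall_mem_affineSolutionSpan ⟨_, one_mem_affineSolutionSpan _ _, by simp⟩
      ⟨_, id_mem_affineSolutionSpan _ _, by simp⟩ fun x hx i => ?_
    have hy : IsVecSolution (realification R) a
        fun t => Sum.elim (x t) (fun j => -Complex.I * x t j) := by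
      filter_upwards [hx] with t ht
      rw [hasDerivAt_pi] at ht ⊢
      rintro (i | i)
      · simp only [Sum.elim_inl]
        convert ht i using 1
        rw [polarPart_realification_mulVec_inl, polarPart_mulVec_apply]
        refine Finset.sum_congr rfl fun a _ => congrArg _ (Finset.sum_congr rfl fun j _ => ?_)
        conv_rhs => rw [hM (R a i j)]
        simp only [Sum.elim_inl, Sum.elim_inr]
        ring
      · simp only [Sum.elim_inr]
        refine ((ht i).const_mul (-Complex.I)).congr_deriv (Eq.symm ?_)
        rw [polarPart_realification_mulVec_inr, polarPart_mulVec_apply, Finset.mul_sum]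
        refine Finset.sum_congr rfl fun a _ => ?_
        rw [mul_left_comm]
        refine congrArg _ ?_
        rw [Finset.mul_sum]
        refine Finset.sum_congr rfl fun j _ => ?_
        conv_rhs => rw [hM (R a i j)]
        simp only [Sum.elim_inl, Sum.elim_inr]
        linear_combination ((R a i j).im * x t j) * hI
    exact ⟨_, hy.mem_affineSolutionSpan (Sum.inl i), by simp⟩
  intro h γ hγ hγσ μ y hy hy0 hy1
  -- If `y₁ + i y₂` vanishes then `y₁ - i y₂` does not, and its conjugate has multiplier `conj μ`
  -- along the conjugate loop. Otherwise `y₁ + i y₂` has multiplier `μ` along `γ`.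
  by_cases hp : (fun i => y 0 (Sum.inl i) + Complex.I * y 0 (Sum.inr i)) = 0
  · have hconj : ∀ z : ℂ, z.im = 0 → (starRingEnd ℂ) z = z := fun z hz =>
      Complex.conj_eq_iff_im.2 hz
    have hγ' : IsSimpleLoop fun s => (starRingEnd ℂ) (γ s) :=
      ⟨Complex.continuous_conj.comp_continuousOn hγ.1, by simp [hγ.2.1],
        fun s hs u hu hsu => hγ.2.2 hs hu ((starRingEnd ℂ).injective hsu)⟩
    have := h _ hγ' (fun s hs hmem => hγσ s hs (by
        have := hconj _ (hσ _ hmem)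
        rw [Complex.conj_conj] at this
        rwa [this])) ((starRingEnd ℂ) μ)
      (fun s i => (starRingEnd ℂ) (y s (Sum.inl i) - Complex.I * y s (Sum.inr i))) ?_ ?_ ?_
    · simpa using this
    · intro s hs
      obtain ⟨F, hF, hFy⟩ := hy s hs
      refine ⟨fun t i => (starRingEnd ℂ) (F ((starRingEnd ℂ) t) (Sum.inl i) -
        Complex.I * F ((starRingEnd ℂ) t) (Sum.inr i)), ?_,
        hFy.mono fun u hu => by simp [hu]⟩
      have hF' : ∀ᶠ t in 𝓝 ((starRingEnd ℂ) (γ s)), HasDerivAt F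
          ((polarPart (realification R) ((starRingEnd ℂ) t)).mulVec (F ((starRingEnd ℂ) t)))
          ((starRingEnd ℂ) t) := by
        have hc : Tendsto (starRingEnd ℂ) (𝓝 ((starRingEnd ℂ) (γ s))) (𝓝 (γ s)) := by
          simpa using (Complex.continuous_conj.tendsto ((starRingEnd ℂ) (γ s)))
        exact hc.eventually hF
      filter_upwards [hF'] with t ht
      rw [hasDerivAt_pi] at ht ⊢
      intro i
      have h1 := ((ht (Sum.inl i)).sub ((ht (Sum.inr i)).const_mul Complex.I)).conj_conj
      rw [Complex.conj_conj] at h1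
      refine h1.congr_deriv (Eq.symm ?_)
      rw [polarPart_realification_mulVec_inl, polarPart_realification_mulVec_inr,
        polarPart_mulVec_apply, Finset.mul_sum, ← Finset.sum_sub_distrib, map_sum]
      refine Finset.sum_congr rfl fun a ha => ?_
      rw [mul_left_comm, ← mul_sub, map_mul, map_inv₀, map_sub, Complex.conj_conj,
        hconj a (hreal a ha)]
      refine congrArg _ ?_
      rw [Finset.mul_sum, ← Finset.sum_sub_distrib, map_sum]
      refine Finset.sum_congr rfl fun j _ => ?_
      conv_lhs => rw [hM (R a i j)]
      simp only [map_sub, map_mul, map_add, Complex.conj_I, Complex.conj_ofReal]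
      linear_combination ((R a i j).im * (starRingEnd ℂ) (F ((starRingEnd ℂ) t) (Sum.inr j))) * hI
    · intro h0
      apply hy0
      have h1 : ∀ i, y 0 (Sum.inl i) - Complex.I * y 0 (Sum.inr i) = 0 := fun i => by
        simpa only [map_eq_zero, Pi.zero_apply] using congr_fun h0 i
      have h2 : ∀ i, y 0 (Sum.inl i) + Complex.I * y 0 (Sum.inr i) = 0 := fun i => congr_fun hp i
      funext k
      rcases k with i | i
      · show y 0 (Sum.inl i) = 0
        linear_combination (h1 i + h2 i) / 2
      · show y 0 (Sum.inr i) = 0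
        linear_combination (h1 i - h2 i) * Complex.I / 2 + y 0 (Sum.inr i) * hI
    · funext i
      simp [hy1]
      ring
  · refine h γ hγ hγσ μ (fun s i => y s (Sum.inl i) + Complex.I * y s (Sum.inr i)) ?_ hp ?_
    · intro s hs
      obtain ⟨F, hF, hFy⟩ := hy s hs
      refine ⟨fun t i => F t (Sum.inl i) + Complex.I * F t (Sum.inr i), ?_,
        hFy.mono fun u hu => by simp [hu]⟩
      filter_upwards [hF] with t ht
      rw [hasDerivAt_pi] at ht ⊢
      intro i
      refine ((ht (Sum.inl i)).add ((ht (Sum.inr i)).const_mul Complex.I)).congr_deriv (Eq.symm ?_)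
      rw [polarPart_realification_mulVec_inl, polarPart_realification_mulVec_inr,
        polarPart_mulVec_apply, Finset.mul_sum, ← Finset.sum_add_distrib]
      refine Finset.sum_congr rfl fun a _ => ?_
      rw [mul_left_comm, ← mul_add]
      refine congrArg _ ?_
      rw [Finset.mul_sum, ← Finset.sum_add_distrib]
      refine Finset.sum_congr rfl fun j _ => ?_
      conv_lhs => rw [hM (R a i j)]
      linear_combination ((R a i j).im * F t (Sum.inr j)) * hI
    · funext i
      simp [hy1]
      ring

end Realification

/-! ### Auxiliary derivative, norm and multiplier estimates. -/

theorem hasDerivAt_prod_ratio {κ : Type*} (s : Finset κ) (a b : κ → ℂ) {z : ℂ}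
    (ha : ∀ k ∈ s, z ≠ a k) (hb : ∀ k ∈ s, z ≠ b k) :
    HasDerivAt (fun z => ∏ k ∈ s, (z - a k) / (z - b k))
      ((∑ k ∈ s, ((z - a k)⁻¹ - (z - b k)⁻¹)) * ∏ k ∈ s, (z - a k) / (z - b k)) z := by
  classical
  induction s using Finset.induction_on with
  | empty => simpa using hasDerivAt_const z (1 : ℂ)
  | insert k s hk ih =>
    have h1 : z - a k ≠ 0 := sub_ne_zero.2 (ha k (by simp))
    have h2 : z - b k ≠ 0 := sub_ne_zero.2 (hb k (by simp))
    have ih' := ih (fun j hj => ha j (by simp [hj])) (fun j hj => hb j (by simp [hj]))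
    have h3 : HasDerivAt (fun z => (z - a k) / (z - b k))
        ((1 * (z - b k) - (z - a k) * 1) / (z - b k) ^ 2) z :=
      ((hasDerivAt_id z).sub_const (a k)).div ((hasDerivAt_id z).sub_const (b k)) h2
    simp only [Finset.prod_insert hk, Finset.sum_insert hk]
    refine (h3.mul ih').congr_deriv ?_
    field_simp

theorem norm_single_apply_le {ι : Type} (a z : ℂ) (M : Matrix ι ι ℂ) (i j : ι) :
    ‖(Finsupp.single a M) z i j‖ ≤ ‖M i j‖ := by
  classical
  rw [Finsupp.single_apply]
  split_ifs <;> simp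

section Multipliers

variable {ι : Type} [Fintype ι]

/-- `G` is a function on the plane, so it returns to its value along the closed path. Constancy of
`y_i ^ k * G` therefore forces `μ ^ k = 1`. This handles the scalar coordinates adjoined by the
constructions below. -/
theorem IsVecContinuation.norm_multiplier_eq_one {R : ℂ →₀ Matrix ι ι ℂ} {γ : ℝ → ℂ}
    {y : ℝ → ι → ℂ} (hy : IsVecContinuation R γ y) (hγ : IsSimpleLoop γ) (G : ℂ → ℂ) (i : ι)
    {k : ℕ} (hk : k ≠ 0) (hG : G (γ 0) ≠ 0)
    (hF : ∀ s ∈ Set.Icc (0 : ℝ) 1, ∀ F, IsVecSolution R (γ s) F →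
      ∀ᶠ t in 𝓝 (γ s), HasDerivAt (fun t => F t i ^ k * G t) 0 t)
    {μ : ℂ} (hy0 : y 0 i ≠ 0) (hy1 : y 1 = μ • y 0) : ‖μ‖ = 1 := by
  have h := eq_of_locally_const_Icc (f := fun s => y s i ^ k * G (γ s)) fun s hs => by
    obtain ⟨F, hFs, hFy⟩ := hy s hs
    obtain ⟨δ, hδ, hball⟩ := Metric.eventually_nhds_iff_ball.1 (hF s hs F hFs)
    have hconst : ∀ t ∈ Metric.ball (γ s) δ, F t i ^ k * G t = F (γ s) i ^ k * G (γ s) := by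
      intro t ht
      refine Metric.isOpen_ball.is_const_of_deriv_eq_zero (convex_ball _ _).isPreconnected
        (fun u hu => (hball u hu).differentiableAt.differentiableWithinAt)
        (fun u hu => (hball u hu).deriv) ht (Metric.mem_ball_self hδ)
    have hs0 : y s = F (γ s) := hFy.self_of_nhdsWithin hs
    filter_upwards [hFy, (hγ.1 s hs).eventually (Metric.ball_mem_nhds _ hδ)] with u h1 h2
    rw [h1, hs0]
    exact hconst _ h2
  simp only [← hγ.2.1, hy1, Pi.smul_apply, smul_eq_mul] at h
  have h1 := mul_right_cancel₀ hG h
  rw [mul_pow] at h1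
  have h2 : μ ^ k = 1 := mul_right_cancel₀ (pow_ne_zero k hy0) (by rw [h1, one_mul])
  exact Complex.norm_eq_one_of_pow_eq_one h2 hk

end Multipliers

/-! ### The Möbius map that makes infinity nonsingular. -/

section Mobius

variable {ι : Type}

/-- The embedding of the residues into the lower right block. -/
def lowerBlock (ι : Type) : Matrix ι ι ℂ →ₗ[ℂ] Matrix (Bool ⊕ ι) (Bool ⊕ ι) ℂ where
  toFun M := Matrix.fromBlocks 0 0 0 M
  map_add' M N := by simp [Matrix.fromBlocks_add]
  map_smul' c M := by simp [Matrix.fromBlocks_smul]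

/-- The projector to the coordinate `true` of the upper left block. -/
def trueProj (ι : Type) : Matrix (Bool ⊕ ι) (Bool ⊕ ι) ℂ :=
  Matrix.fromBlocks (Matrix.diagonal fun b => if b then 1 else 0) 0 0 0

/-- The points, other than the auxiliary one, that are singular after the Möbius map
`w = (z - c)⁻¹`. -/
noncomputable def mobiusPoints (σ : Finset ℂ) (c : ℂ) : Finset ℂ :=
  insert 0 (σ.image fun p => (p - c)⁻¹)

/-- The residues of the system for `q (w) • (1, (w - e) / w, x)`, where `w = (z - c)⁻¹` and `q` is
the product of `(w - p) / (w - e)` over the singular points `p`. -/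
noncomputable def mobiusSystem [DecidableEq ι] (R : ℂ →₀ Matrix ι ι ℂ) (σ : Finset ℂ) (c e : ℂ) :
    ℂ →₀ Matrix (Bool ⊕ ι) (Bool ⊕ ι) ℂ :=
  ∑ p ∈ σ, (Finsupp.single (p - c)⁻¹ (lowerBlock ι (R p)) - Finsupp.single 0 (lowerBlock ι (R p))) +
    ∑ p ∈ mobiusPoints σ c, (Finsupp.single p 1 - Finsupp.single e 1) +
    (Finsupp.single e (trueProj ι) - Finsupp.single 0 (trueProj ι))

variable [DecidableEq ι]

theorem mobiusSystem_apply_false (R : ℂ →₀ Matrix ι ι ℂ) (σ : Finset ℂ) (c e z : ℂ) :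
    mobiusSystem R σ c e z (Sum.inl false) (Sum.inl false) =
      (if z ∈ mobiusPoints σ c then 1 else 0) -
        if z = e then ((mobiusPoints σ c).card : ℂ) else 0 := by
  have hs : ∀ (a : ℂ) (M : Matrix (Bool ⊕ ι) (Bool ⊕ ι) ℂ),
      (Finsupp.single a M) z (Sum.inl false) (Sum.inl false) =
        if z = a then M (Sum.inl false) (Sum.inl false) else 0 := by
    intro a M
    rw [Finsupp.single_apply]
    by_cases h : a = z
    · simp [h]
    · simp [h, Ne.symm h]
  simp only [mobiusSystem, Finsupp.add_apply, Matrix.add_apply, Finsupp.finsetSum_apply,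
    Matrix.sum_apply, Finsupp.sub_apply, Matrix.sub_apply, hs]
  simp [lowerBlock, trueProj, Finset.sum_sub_distrib, Finset.sum_ite_eq]

/-- The factor `q` has a simple zero at each listed point and a pole at `e`, so the coordinate
`false` has a nonzero residue at every one of them, whatever `R` is. The polar locus thus equals the
set that loops must avoid for the spectral argument, including `0`, the image of infinity. -/
theorem support_mobiusSystem (R : ℂ →₀ Matrix ι ι ℂ) {σ : Finset ℂ} {c e : ℂ}
    (he : e ∉ mobiusPoints σ c) :
    (mobiusSystem R σ c e).support = insert e (mobiusPoints σ c) := by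
  ext z
  rw [Finsupp.mem_support_iff]
  constructor
  · contrapose!
    intro hz
    have h1 : ∀ p ∈ σ, (p - c)⁻¹ ≠ z := fun p hp h => hz (by
      rw [← h]
      exact Finset.mem_insert_of_mem (Finset.mem_insert_of_mem (Finset.mem_image_of_mem _ hp)))
    have h2 : (0 : ℂ) ≠ z := fun h => hz (by simp [← h, mobiusPoints])
    have h3 : e ≠ z := fun h => hz (by simp [← h])
    have h4 : ∀ p ∈ mobiusPoints σ c, p ≠ z := fun p hp h =>
      hz (Finset.mem_insert_of_mem (h ▸ hp))
    simp only [mobiusSystem, Finsupp.add_apply, Finsupp.finsetSum_apply, Finsupp.sub_apply]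
    rw [Finset.sum_eq_zero, Finset.sum_eq_zero]
    · simp [h2, h3]
    · intro p hp
      simp [h3, h4 p hp]
    · intro p hp
      simp [h2, h1 p hp]
  · intro hz h0
    have h := mobiusSystem_apply_false R σ c e z
    rw [h0] at h
    rcases Finset.mem_insert.1 hz with rfl | hz
    · rw [if_neg he, if_pos rfl] at h
      have : (mobiusPoints σ c).card ≠ 0 := by simp [mobiusPoints]
      apply this
      simpa using h
    · rw [if_pos hz, if_neg (fun h' : z = e => he (h' ▸ hz))] at h
      simp at h

/-- The residues come in opposite pairs: every summand is a difference of two point masses of the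
same matrix. -/
theorem sum_mobiusSystem (R : ℂ →₀ Matrix ι ι ℂ) (σ : Finset ℂ) (c e : ℂ) :
    ∑ a ∈ (mobiusSystem R σ c e).support, mobiusSystem R σ c e a = 0 := by
  have h : ∀ Q : ℂ →₀ Matrix (Bool ⊕ ι) (Bool ⊕ ι) ℂ, ∑ a ∈ Q.support, Q a =
      Finsupp.liftAddHom (fun _ => AddMonoidHom.id _) Q := fun Q => rfl
  rw [h]
  have hs : ∀ (a : ℂ) (M : Matrix (Bool ⊕ ι) (Bool ⊕ ι) ℂ),
      Finsupp.liftAddHom (fun _ => AddMonoidHom.id _) (Finsupp.single a M) = M := by simp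
  simp only [mobiusSystem, map_add, map_sum, map_sub, hs, sub_self, Finset.sum_const_zero, add_zero]

theorem norm_mobiusSystem_le {R : ℂ →₀ Matrix ι ι ℂ} (σ : Finset ℂ) (c e : ℂ) {C : ℝ}
    (hC : ∀ z i j, ‖R z i j‖ ≤ C) (hC0 : 0 ≤ C) (z : ℂ) (i j : Bool ⊕ ι) :
    ‖mobiusSystem R σ c e z i j‖ ≤ σ.card * (2 * C) + (σ.card + 1) * 2 + 2 := by
  have h1 : ∀ (a a' : ℂ) (M : Matrix (Bool ⊕ ι) (Bool ⊕ ι) ℂ) (K : ℝ), ‖M i j‖ ≤ K →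
      ‖(Finsupp.single a M - Finsupp.single a' M) z i j‖ ≤ 2 * K := by
    intro a a' M K hK
    rw [Finsupp.sub_apply, Matrix.sub_apply]
    have := norm_sub_le ((Finsupp.single a M) z i j) ((Finsupp.single a' M) z i j)
    linarith [norm_single_apply_le a z M i j, norm_single_apply_le a' z M i j]
  simp only [mobiusSystem, Finsupp.add_apply, Matrix.add_apply, Finsupp.finsetSum_apply,
    Matrix.sum_apply]
  refine (norm_add₃_le).trans (add_le_add_three ?_ ?_ ?_)
  · rw [← nsmul_eq_mul]
    refine (norm_sum_le _ _).trans (Finset.sum_le_card_nsmul _ _ _ fun p _ => h1 _ _ _ _ ?_)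
    rcases i with i | i <;> rcases j with j | j <;> simp [lowerBlock, hC, hC0]
  · have h2 : (((mobiusPoints σ c).card : ℕ) : ℝ) ≤ σ.card + 1 := by
      exact_mod_cast (Finset.card_insert_le _ _).trans (Nat.succ_le_succ Finset.card_image_le)
    refine le_trans ?_ (mul_le_mul_of_nonneg_right h2 zero_le_two)
    rw [← nsmul_eq_mul]
    refine (norm_sum_le _ _).trans (Finset.sum_le_card_nsmul _ _ _ fun p _ => ?_)
    rw [← mul_one (2 : ℝ)]
    refine h1 _ _ _ _ ?_
    rw [Matrix.one_apply]
    split_ifs <;> simp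
  · rw [← mul_one (2 : ℝ)]
    refine h1 _ _ _ _ ?_
    rcases i with i | i <;> rcases j with j | j <;>
      simp [trueProj, Matrix.diagonal_apply]
    split_ifs <;> simp

theorem card_support_mobiusSystem_le (R : ℂ →₀ Matrix ι ι ℂ) {σ : Finset ℂ} {c e : ℂ}
    (he : e ∉ mobiusPoints σ c) : (mobiusSystem R σ c e).support.card ≤ σ.card + 2 := by
  rw [support_mobiusSystem R he]
  refine (Finset.card_insert_le _ _).trans (Nat.succ_le_succ ?_)
  exact (Finset.card_insert_le _ _).trans (Nat.succ_le_succ Finset.card_image_le)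

/-- Since `dz = -w⁻² dw`, the form `dz / (z - p)` becomes `dw / (w - (p - c)⁻¹) - dw / w`, which
explains the opposite residue at `0`. The other two summands are the logarithmic derivatives of `q`
and of `(w - e) / w`. -/
theorem polarPart_mobiusSystem {R : ℂ →₀ Matrix ι ι ℂ} {σ : Finset ℂ} (hR : R.support ⊆ σ)
    {c e w : ℂ} (hc : c ∉ σ) (hw : w ∉ mobiusPoints σ c) :
    polarPart (mobiusSystem R σ c e) w =
      lowerBlock ι (-(w ^ 2)⁻¹ • polarPart R (c + w⁻¹)) +
      (∑ p ∈ mobiusPoints σ c, ((w - p)⁻¹ - (w - e)⁻¹)) • 1 +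
      ((w - e)⁻¹ - w⁻¹) • trueProj ι := by
  have hw0 : w ≠ 0 := fun h => hw (by simp [h, mobiusPoints])
  rw [mobiusSystem, polarPart_add, polarPart_add, polarPart_sum, polarPart_sum, polarPart_eq_sum hR,
    Finset.smul_sum, map_sum, Finset.sum_smul]
  simp only [polarPart_sub, polarPart_single, sub_zero, sub_smul]
  congr 2
  refine Finset.sum_congr rfl fun p hp => ?_
  rw [smul_smul, map_smul, ← sub_smul]
  congr 1
  have h1 : p - c ≠ 0 := sub_ne_zero.2 fun h => hc (h ▸ hp)
  have h2 : w - (p - c)⁻¹ ≠ 0 := sub_ne_zero.2 fun h => hw (by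
    rw [h]
    exact Finset.mem_insert_of_mem (Finset.mem_image_of_mem _ hp))
  have h3 : c + w⁻¹ - p ≠ 0 := by
    intro h
    apply h2
    have : p - c = w⁻¹ := by linear_combination -h
    rw [this, inv_inv, sub_self]
  have h4 : w * (p - c) - 1 ≠ 0 := by
    intro h
    apply h2
    field_simp
    linear_combination h
  have h5 : c + w⁻¹ - p = -(w * (p - c) - 1) / w := by
    field_simp
    ring
  have h6 : w - (p - c)⁻¹ = (w * (p - c) - 1) / (p - c) := by
    field_simp
  rw [h5, h6]
  field_simp
  ring

variable [Fintype ι]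

theorem polarPart_mobiusSystem_mulVec {R : ℂ →₀ Matrix ι ι ℂ} {σ : Finset ℂ} (hR : R.support ⊆ σ)
    {c e w : ℂ} (hc : c ∉ σ) (hw : w ∉ mobiusPoints σ c) (y : Bool ⊕ ι → ℂ) :
    (polarPart (mobiusSystem R σ c e) w).mulVec y = Sum.elim
      (fun b => (∑ p ∈ mobiusPoints σ c, ((w - p)⁻¹ - (w - e)⁻¹)) * y (Sum.inl b) +
        (if b then ((w - e)⁻¹ - w⁻¹) * y (Sum.inl b) else 0))
      (fun i => (∑ p ∈ mobiusPoints σ c, ((w - p)⁻¹ - (w - e)⁻¹)) * y (Sum.inr i) -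
        (w ^ 2)⁻¹ * (polarPart R (c + w⁻¹)).mulVec (fun j => y (Sum.inr j)) i) := by
  rw [polarPart_mobiusSystem hR hc hw, Matrix.add_mulVec, Matrix.add_mulVec, Matrix.smul_mulVec,
    Matrix.smul_mulVec, Matrix.one_mulVec]
  funext k
  rcases k with b | i
  · simp only [lowerBlock, trueProj, LinearMap.coe_mk, AddHom.coe_mk, Matrix.fromBlocks_mulVec,
      Pi.add_apply, Sum.elim_inl, Pi.smul_apply, smul_eq_mul]
    rcases b with _ | _ <;> simp [Matrix.mulVec_diagonal]
  · simp only [lowerBlock, trueProj, LinearMap.coe_mk, AddHom.coe_mk, Matrix.fromBlocks_mulVec,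
      Pi.add_apply, Sum.elim_inr, Pi.smul_apply, smul_eq_mul]
    simp [Matrix.smul_mulVec, Matrix.neg_mulVec]
    have : (y ∘ Sum.inr) = fun j => y (Sum.inr j) := rfl
    rw [this]
    ring

/-- The product of `(w - p) / (w - e)` over the singular points `p`. -/
noncomputable def mobiusFactor (σ : Finset ℂ) (c e w : ℂ) : ℂ :=
  ∏ p ∈ mobiusPoints σ c, (w - p) / (w - e)

section
variable {σ : Finset ℂ} {c e w : ℂ}

theorem ne_zero_of_notMem_mobius (hw : w ∉ insert e (mobiusPoints σ c)) : w ≠ 0 := fun h =>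
  hw (by simp [h, mobiusPoints])

theorem sub_ne_zero_of_notMem_mobius (hw : w ∉ insert e (mobiusPoints σ c)) : w - e ≠ 0 :=
  sub_ne_zero.2 fun h => hw (by simp [h])

theorem eventually_notMem_mobius (hw : w ∉ insert e (mobiusPoints σ c)) :
    ∀ᶠ u in 𝓝 w, u ∉ insert e (mobiusPoints σ c) :=
  (Finset.isClosed _).isOpen_compl.mem_nhds hw

theorem mobiusFactor_ne_zero (hw : w ∉ insert e (mobiusPoints σ c)) : mobiusFactor σ c e w ≠ 0 :=
  Finset.prod_ne_zero_iff.2 fun p hp => div_ne_zero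
    (sub_ne_zero.2 fun h => hw (by simp [h, hp])) (sub_ne_zero_of_notMem_mobius hw)

theorem hasDerivAt_mobiusFactor (hw : w ∉ insert e (mobiusPoints σ c)) :
    HasDerivAt (mobiusFactor σ c e) ((∑ p ∈ mobiusPoints σ c, ((w - p)⁻¹ - (w - e)⁻¹)) *
      mobiusFactor σ c e w) w :=
  hasDerivAt_prod_ratio _ _ _ (fun p hp h => hw (by simp [h, hp]))
    (fun p hp => sub_ne_zero.1 (sub_ne_zero_of_notMem_mobius hw))

theorem hasDerivAt_sub_div_self (hw : w ≠ 0) :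
    HasDerivAt (fun w : ℂ => (w - e) / w) (e / w ^ 2) w :=
  (((hasDerivAt_id w).sub_const e).div (hasDerivAt_id w) hw).congr_deriv (by simp)

end

/-- The coefficients `α` and `β` are free because the scalar coordinates are decoupled from `x`;
taking `x = 0` isolates the two scalar solutions. -/
theorem IsVecSolution.mobiusSystem {R : ℂ →₀ Matrix ι ι ℂ} {σ : Finset ℂ} (hR : R.support ⊆ σ)
    {c e w₀ : ℂ} (hc : c ∉ σ) (hw₀ : w₀ ∉ insert e (mobiusPoints σ c)) {x : ℂ → ι → ℂ}
    (hx : IsVecSolution R (c + w₀⁻¹) x) (α β : ℂ) :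
    IsVecSolution (mobiusSystem R σ c e) w₀ fun w => Sum.elim
      (fun b => if b then β * (mobiusFactor σ c e w * ((w - e) / w)) else α * mobiusFactor σ c e w)
      (fun i => mobiusFactor σ c e w * x (c + w⁻¹) i) := by
  have hback : Tendsto (fun w : ℂ => c + w⁻¹) (𝓝 w₀) (𝓝 (c + w₀⁻¹)) :=
    continuousAt_const.add (continuousAt_id.inv₀ (ne_zero_of_notMem_mobius hw₀))
  filter_upwards [eventually_notMem_mobius hw₀, hback.eventually hx] with w hw hxw
  have hw0 := ne_zero_of_notMem_mobius hw
  have hwe := sub_ne_zero_of_notMem_mobius hw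
  have hq := hasDerivAt_mobiusFactor hw
  rw [hasDerivAt_pi, polarPart_mobiusSystem_mulVec hR hc
    (fun h => hw (Finset.mem_insert_of_mem h))]
  rw [hasDerivAt_pi] at hxw
  generalize (∑ p ∈ mobiusPoints σ c, ((w - p)⁻¹ - (w - e)⁻¹)) = l at hq ⊢
  rintro ((_ | _) | i)
  · simp only [Sum.elim_inl, Bool.false_eq_true, if_false, add_zero]
    exact (hq.const_mul α).congr_deriv (by ring)
  · simp only [Sum.elim_inl, if_true]
    refine ((hq.mul (hasDerivAt_sub_div_self hw0)).const_mul β).congr_deriv ?_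
    field_simp
    ring
  · simp only [Sum.elim_inr]
    have h1 : HasDerivAt (fun w : ℂ => c + w⁻¹) (-(w ^ 2)⁻¹) w :=
      (hasDerivAt_inv hw0).const_add c
    have h2 : HasDerivAt (fun w => x (c + w⁻¹) i) _ w :=
      HasDerivAt.comp (h₂ := fun u => x u i) w (hxw i) h1
    refine (hq.mul h2).congr_deriv ?_
    have h3 : (fun j => mobiusFactor σ c e w * x (c + w⁻¹) j) =
      mobiusFactor σ c e w • x (c + w⁻¹) := rfl
    rw [h3, Matrix.mulVec_smul, Pi.smul_apply, smul_eq_mul]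
    ring

theorem IsVecSolution.of_mobiusSystem {R : ℂ →₀ Matrix ι ι ℂ} {σ : Finset ℂ} (hR : R.support ⊆ σ)
    {c e w₀ : ℂ} (hc : c ∉ σ) (hw₀ : w₀ ∉ insert e (mobiusPoints σ c)) {F : ℂ → Bool ⊕ ι → ℂ}
    (hF : IsVecSolution (_root_.mobiusSystem R σ c e) w₀ F) :
    IsVecSolution R (c + w₀⁻¹) fun t i =>
      (mobiusFactor σ c e (t - c)⁻¹)⁻¹ * F (t - c)⁻¹ (Sum.inr i) := by
  have hs0 := ne_zero_of_notMem_mobius hw₀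
  have hback : Tendsto (fun t : ℂ => (t - c)⁻¹) (𝓝 (c + w₀⁻¹)) (𝓝 w₀) := by
    have : ContinuousAt (fun t : ℂ => (t - c)⁻¹) (c + w₀⁻¹) :=
      (continuousAt_id.sub continuousAt_const).inv₀ (by simpa using hs0)
    simpa [ContinuousAt] using this
  filter_upwards [hback.eventually hF, hback.eventually (eventually_notMem_mobius hw₀)]
    with t hFt ht
  have htc : t - c ≠ 0 := fun h => ne_zero_of_notMem_mobius ht (by rw [h, inv_zero])
  have hq0 := mobiusFactor_ne_zero ht
  have hq := hasDerivAt_mobiusFactor ht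
  rw [polarPart_mobiusSystem_mulVec hR hc (fun h => ht (Finset.mem_insert_of_mem h)),
    hasDerivAt_pi] at hFt
  rw [hasDerivAt_pi]
  intro i
  have hFi := hFt (Sum.inr i)
  rw [Sum.elim_inr] at hFi
  generalize (∑ p ∈ mobiusPoints σ c, (((t - c)⁻¹ - p)⁻¹ - ((t - c)⁻¹ - e)⁻¹)) = l at hq hFi
  have h1 : HasDerivAt (fun t : ℂ => (t - c)⁻¹) (-1 / (t - c) ^ 2) t :=
    ((hasDerivAt_id t).sub_const c).inv htc
  have h2 := HasDerivAt.comp (h₂ := fun u => F u (Sum.inr i)) t hFi h1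
  have h3 := (HasDerivAt.comp (h₂ := mobiusFactor σ c e) t hq h1).inv hq0
  refine (h3.mul h2).congr_deriv ?_
  have h4 : (fun j => (mobiusFactor σ c e (t - c)⁻¹)⁻¹ * F ((t - c)⁻¹) (Sum.inr j)) =
    (mobiusFactor σ c e (t - c)⁻¹)⁻¹ • fun j => F ((t - c)⁻¹) (Sum.inr j) := rfl
  rw [h4, Matrix.mulVec_smul, Pi.smul_apply, smul_eq_mul, inv_inv (t - c), add_sub_cancel]
  simp only [Function.comp_apply, Pi.inv_apply]
  field_simp
  ring

/-- A nonzero scalar coordinate at the start is a multiple of a single-valued function, so its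
multiplier is `1`. If both vanish, dividing the remaining block by the single-valued `q` gives a
solution of the original system along `c + 1 / γ`. This is a simple loop in the plane because `γ`
avoids `0`. -/
theorem vecSpectralCondition_mobiusSystem {R : ℂ →₀ Matrix ι ι ℂ} {σ : Finset ℂ}
    (hR : R.support ⊆ σ) {c e : ℂ} (hc : c ∉ σ) (h : VecSpectralCondition R σ) :
    VecSpectralCondition (mobiusSystem R σ c e) (insert e (mobiusPoints σ c)) := by
  intro γ hγ hγσ μ y hy hy0 hy1
  have h0 := hγσ 0 (by simp)
  by_cases hf : y 0 (Sum.inl false) = 0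
  swap
  · refine hy.norm_multiplier_eq_one hγ (fun w => (mobiusFactor σ c e w)⁻¹) (Sum.inl false)
      one_ne_zero (inv_ne_zero (mobiusFactor_ne_zero h0)) ?_ hf hy1
    intro s hs F hF
    filter_upwards [hF, eventually_notMem_mobius (hγσ s hs)] with w hFw hw
    have h1 := hasDerivAt_pi.1 hFw (Sum.inl false)
    rw [polarPart_mobiusSystem_mulVec hR hc (fun h => hw (Finset.mem_insert_of_mem h))] at h1
    simp only [Sum.elim_inl, Bool.false_eq_true, if_false, add_zero] at h1
    simp only [pow_one]
    have hq0 := mobiusFactor_ne_zero hw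
    refine (h1.mul ((hasDerivAt_mobiusFactor hw).inv hq0)).congr_deriv ?_
    simp only [Pi.inv_apply]
    field_simp
    ring
  by_cases ht : y 0 (Sum.inl true) = 0
  swap
  · refine hy.norm_multiplier_eq_one hγ (fun w => (mobiusFactor σ c e w * ((w - e) / w))⁻¹)
      (Sum.inl true) one_ne_zero (inv_ne_zero (mul_ne_zero (mobiusFactor_ne_zero h0) (div_ne_zero
        (sub_ne_zero_of_notMem_mobius h0) (ne_zero_of_notMem_mobius h0)))) ?_ ht hy1
    intro s hs F hF
    filter_upwards [hF, eventually_notMem_mobius (hγσ s hs)] with w hFw hw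
    have h1 := hasDerivAt_pi.1 hFw (Sum.inl true)
    rw [polarPart_mobiusSystem_mulVec hR hc (fun h => hw (Finset.mem_insert_of_mem h))] at h1
    simp only [Sum.elim_inl, if_true] at h1
    simp only [pow_one]
    have hw0 := ne_zero_of_notMem_mobius hw
    have hwe := sub_ne_zero_of_notMem_mobius hw
    have hq0 := mobiusFactor_ne_zero hw
    have hq := hasDerivAt_mobiusFactor hw
    generalize (∑ p ∈ mobiusPoints σ c, ((w - p)⁻¹ - (w - e)⁻¹)) = l at hq h1
    refine (h1.mul ((hq.mul (hasDerivAt_sub_div_self hw0)).inv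
      (mul_ne_zero hq0 (div_ne_zero hwe hw0)))).congr_deriv ?_
    simp only [Pi.mul_apply, Pi.inv_apply]
    field_simp
    ring
  · refine h (fun s => c + (γ s)⁻¹) ⟨?_, by simp [hγ.2.1], ?_⟩ ?_ μ
      (fun s i => (mobiusFactor σ c e (γ s))⁻¹ * y s (Sum.inr i)) ?_ ?_ ?_
    · exact continuousOn_const.add (hγ.1.inv₀ fun s hs => ne_zero_of_notMem_mobius (hγσ s hs))
    · intro s hs u hu hsu
      exact hγ.2.2 hs hu (inv_injective (add_left_cancel hsu))
    · intro s hs hmem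
      refine hγσ s hs (Finset.mem_insert_of_mem (Finset.mem_insert_of_mem
        (Finset.mem_image.2 ⟨_, hmem, ?_⟩)))
      rw [add_sub_cancel_left, inv_inv]
    · intro s hs
      obtain ⟨F, hF, hFy⟩ := hy s hs
      refine ⟨_, hF.of_mobiusSystem hR hc (hγσ s hs), hFy.mono fun u hu => ?_⟩
      funext i
      simp [hu]
    · intro h1
      apply hy0
      funext k
      rcases k with (_ | _) | i
      · exact hf
      · exact ht
      · simpa [mobiusFactor_ne_zero h0] using congr_fun h1 i
    · funext i
      simp only [hy1, ← hγ.2.1, Pi.smul_apply, smul_eq_mul]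
      ring

/-- As `t = c + 1 / w` and `(w - e) / w = 1 - e / w`, the product `q t` is a linear combination of
the two scalar solutions. The function `1 / w` itself would have a residue at infinity, hence the
use of `(w - e) / w`. -/
theorem affine_mobius_identity {c e t q : ℂ} (he : e ≠ 0) (ht : t - c ≠ 0) :
    (c + e⁻¹) * (1 * q) - e⁻¹ * (1 * (q * (((t - c)⁻¹ - e) / (t - c)⁻¹))) = q * t := by
  field_simp
  ring

theorem dominates_mobiusSystem {R : ℂ →₀ Matrix ι ι ℂ} {σ : Finset ℂ} (hR : R.support ⊆ σ)
    {c e : ℂ} (hc : c ∉ σ) (he : e ∉ mobiusPoints σ c) :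
    Dominates (fun z => (z - c)⁻¹) R σ (mobiusSystem R σ c e) (insert e (mobiusPoints σ c)) := by
  have he0 : e ≠ 0 := fun h => he (by simp [h, mobiusPoints])
  have hpt : ∀ a, (a - c)⁻¹ ∉ insert e (mobiusPoints σ c) → a - c ≠ 0 := fun a ha h =>
    ne_zero_of_notMem_mobius ha (by rw [h, inv_zero])
  have hcont : ∀ a, (a - c)⁻¹ ∉ insert e (mobiusPoints σ c) →
      ContinuousAt (fun z => (z - c)⁻¹) a := fun a ha =>
    (continuousAt_id.sub continuousAt_const).inv₀ (hpt a ha)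
  refine ⟨?_, hcont, ?_, vecSpectralCondition_mobiusSystem hR hc⟩
  · intro a ha h
    exact ha (Finset.mem_insert_of_mem (Finset.mem_insert_of_mem
      (Finset.mem_image_of_mem (fun p => (p - c)⁻¹) h)))
  intro a ha
  change (a - c)⁻¹ ∉ insert e (mobiusPoints σ c) at ha
  have hev := (hcont a ha).tendsto.eventually (eventually_notMem_mobius ha)
  have hsol : ∀ (x : ℂ → ι → ℂ), IsVecSolution R a x → ∀ α β, IsVecSolution
      (mobiusSystem R σ c e) (a - c)⁻¹ fun w => Sum.elim
      (fun b => if b then β * (mobiusFactor σ c e w * ((w - e) / w)) else α * mobiusFactor σ c e w)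
      (fun i => mobiusFactor σ c e w * x (c + w⁻¹) i) := by
    intro x hx α β
    refine IsVecSolution.mobiusSystem hR hc ha ?_ α β
    rwa [inv_inv, add_sub_cancel]
  have hzero : IsVecSolution R a fun _ => 0 :=
    Eventually.of_forall fun t => by simpa using hasDerivAt_const t (0 : ι → ℂ)
  have h1 : (fun w => 1 * mobiusFactor σ c e w) ∈
      affineSolutionSpan (mobiusSystem R σ c e) (a - c)⁻¹ :=
    (hsol _ hzero 1 0).mem_affineSolutionSpan (Sum.inl false)
  have h2 : (fun w => 1 * (mobiusFactor σ c e w * ((w - e) / w))) ∈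
      affineSolutionSpan (mobiusSystem R σ c e) (a - c)⁻¹ :=
    (hsol _ hzero 0 1).mem_affineSolutionSpan (Sum.inl true)
  refine ⟨fun t => mobiusFactor σ c e (t - c)⁻¹, hev.mono fun t ht => mobiusFactor_ne_zero ht,
    forall_mem_affineSolutionSpan (φ := fun z => (z - c)⁻¹) ?_ ?_ ?_⟩
  · exact ⟨fun w => 1 * mobiusFactor σ c e w, h1, Eventually.of_forall fun t => one_mul _⟩
  · refine ⟨_, sub_mem (Submodule.smul_mem _ (c + e⁻¹) h1) (Submodule.smul_mem _ e⁻¹ h2), ?_⟩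
    filter_upwards [hev] with t ht
    have := hpt t ht
    exact affine_mobius_identity he0 this
  · intro x hx i
    refine ⟨fun w => mobiusFactor σ c e w * x (c + w⁻¹) i,
      (hsol x hx 0 0).mem_affineSolutionSpan (Sum.inr i), Eventually.of_forall fun t => ?_⟩
    simp only [inv_inv, add_sub_cancel]

end Mobius

/-! ### Square roots of loops and concatenation of continuations. -/

/-- A path avoiding the origin has a continuous square root. -/
theorem exists_continuous_sq_eq {γ : ℝ → ℂ} (hγ : ContinuousOn γ (Set.Icc 0 1))
    (h0 : ∀ s ∈ Set.Icc (0 : ℝ) 1, γ s ≠ 0) :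
    ∃ r : ℝ → ℂ, Continuous r ∧ ∀ s ∈ Set.Icc (0 : ℝ) 1, r s ^ 2 = γ s := by
  have hcov := isCoveringMap_npow (𝕜 := ℂ) 2 (by norm_num)
  obtain ⟨w, hw⟩ := IsAlgClosed.exists_pow_nat_eq (γ 0) zero_lt_two
  have hw0 : w ≠ 0 := fun h => h0 0 (by simp) (by rw [← hw, h]; ring)
  obtain ⟨Γ, hΓ, -⟩ := hcov.exists_path_lifts
    ⟨fun s : unitInterval => ⟨γ s, h0 s s.2⟩, (hγ.domRestrict).subtype_mk _⟩ ⟨w, hw0⟩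
    (Subtype.ext hw.symm)
  refine ⟨Set.IccExtend zero_le_one fun s => (Γ s : ℂ),
    (continuous_subtype_val.comp Γ.continuous).Icc_extend', fun s hs => ?_⟩
  rw [Set.IccExtend_of_mem _ _ hs]
  exact congrArg Subtype.val (congr_fun hΓ ⟨s, hs⟩)

section Concatenation

variable {ι : Type} [Fintype ι]

theorem IsVecContinuation.const_smul {R : ℂ →₀ Matrix ι ι ℂ} {γ : ℝ → ℂ} {y : ℝ → ι → ℂ}
    (h : IsVecContinuation R γ y) (c : ℂ) : IsVecContinuation R γ fun s => c • y s := by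
  intro s hs
  obtain ⟨F, hF, hFy⟩ := h s hs
  exact ⟨_, hF.const_smul c, hFy.mono fun u hu => by simp [hu]⟩

theorem IsVecContinuation.concat {R : ℂ →₀ Matrix ι ι ℂ} {γ₁ γ₂ : ℝ → ℂ} {y₁ y₂ : ℝ → ι → ℂ}
    (h₁ : IsVecContinuation R γ₁ y₁) (h₂ : IsVecContinuation R γ₂ y₂)
    (hc₁ : Continuous γ₁) (hγ : γ₁ 1 = γ₂ 0) (hy : y₁ 1 = y₂ 0) (hR : γ₁ 1 ∉ R.support) :
    IsVecContinuation R (fun s => if s < 1 / 2 then γ₁ (2 * s) else γ₂ (2 * s - 1))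
      (fun s => if s < 1 / 2 then y₁ (2 * s) else y₂ (2 * s - 1)) := by
  intro s hs
  have hfst : ∀ u : ℝ, Tendsto (fun s : ℝ => 2 * s) (𝓝 u) (𝓝 (2 * u)) := fun u =>
    (continuous_const.mul continuous_id).tendsto u
  have hsnd : ∀ u : ℝ, Tendsto (fun s : ℝ => 2 * s - 1) (𝓝 u) (𝓝 (2 * u - 1)) := fun u =>
    ((continuous_const.mul continuous_id).sub continuous_const).tendsto u
  rcases lt_trichotomy s (1 / 2) with h | h | h
  · obtain ⟨F, hF, hFy⟩ := h₁ (2 * s) ⟨by linarith [hs.1], by linarith⟩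
    refine ⟨F, by beta_reduce; rwa [if_pos h], ?_⟩
    rw [eventually_nhdsWithin_iff] at hFy ⊢
    filter_upwards [(hfst s).eventually hFy, Iio_mem_nhds h] with u hu hu' hu2
    have hu' : u < 1 / 2 := hu'
    rw [if_pos hu', if_pos hu']
    exact hu ⟨by linarith [hu2.1], by linarith⟩
  · obtain ⟨F, hF, hFy⟩ := h₁ 1 (by simp)
    obtain ⟨G, hG, hGy⟩ := h₂ 0 (by simp)
    have hF1 : y₁ 1 = F (γ₁ 1) := hFy.self_of_nhdsWithin (by simp)
    have hG0 : y₂ 0 = G (γ₂ 0) := hGy.self_of_nhdsWithin (by simp)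
    -- At the junction the two germs coincide by uniqueness, so `G` serves on both halves.
    have hFG : ∀ᶠ u in 𝓝 (γ₁ 1), F u = G u := by
      refine hF.eventually_eq (by rwa [hγ]) hR ?_
      rw [← hF1, hy, hG0, hγ]
    have hs1 : 2 * s - 1 = 0 := by linarith
    have hs2 : 2 * s = 1 := by linarith
    refine ⟨G, by beta_reduce; rwa [if_neg h.not_lt, hs1], ?_⟩
    have hFG' : ∀ᶠ u in 𝓝 s, F (γ₁ (2 * u)) = G (γ₁ (2 * u)) := by
      have h3 : Tendsto (fun u => γ₁ (2 * u)) (𝓝 s) (𝓝 (γ₁ (2 * s))) :=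
        (hc₁.tendsto (2 * s)).comp (hfst s)
      rw [hs2] at h3
      exact h3.eventually hFG
    have h1 := hfst s
    have h2 := hsnd s
    rw [hs1] at h2
    rw [hs2] at h1
    rw [eventually_nhdsWithin_iff] at hFy hGy ⊢
    filter_upwards [h1.eventually hFy, h2.eventually hGy, hFG'] with u hu hu' hu2 hu3
    split_ifs with hlt
    · rw [hu ⟨by linarith [hu3.1], by linarith⟩, hu2]
    · exact hu' ⟨by linarith, by linarith [hu3.2]⟩
  · obtain ⟨F, hF, hFy⟩ := h₂ (2 * s - 1) ⟨by linarith, by linarith [hs.2]⟩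
    refine ⟨F, by beta_reduce; rwa [if_neg (not_lt.2 h.le)], ?_⟩
    rw [eventually_nhdsWithin_iff] at hFy ⊢
    filter_upwards [(hsnd s).eventually hFy, Ioi_mem_nhds h] with u hu hu' hu2
    have hu' : 1 / 2 < u := hu'
    rw [if_neg (not_lt.2 hu'.le), if_neg (not_lt.2 hu'.le)]
    exact hu ⟨by linarith, by linarith [hu2.2]⟩

end Concatenation

/-- If a square root of a simple loop is not closed, then it and its opposite form together a
simple loop. -/
theorem IsSimpleLoop.concat_sqrt {γ : ℝ → ℂ} (hγ : IsSimpleLoop γ) {r : ℝ → ℂ} (c : ℂ)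
    (hr : Continuous r) (hsq : ∀ s ∈ Set.Icc (0 : ℝ) 1, r s ^ 2 = γ s)
    (h0 : ∀ s ∈ Set.Icc (0 : ℝ) 1, γ s ≠ 0) (h1 : r 1 = -r 0) :
    IsSimpleLoop fun s => if s < 1 / 2 then c + r (2 * s) else c - r (2 * s - 1) := by
  refine ⟨?_, ?_, ?_⟩
  · have : Continuous fun s : ℝ => if (1 / 2 : ℝ) ≤ s then c - r (2 * s - 1) else c + r (2 * s) := by
      refine Continuous.if_le (by fun_prop) (by fun_prop) continuous_const continuous_id ?_
      intro s hs
      rw [← hs]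
      norm_num [h1, sub_eq_add_neg]
    refine (this.congr fun s => ?_).continuousOn
    by_cases h : s < 1 / 2
    · rw [if_pos h, if_neg (not_le.2 h)]
    · rw [if_neg h, if_pos (not_lt.1 h)]
  · norm_num [h1]
  · have hinj : ∀ u ∈ Set.Ico (0 : ℝ) 1, ∀ v ∈ Set.Ico (0 : ℝ) 1, r u ^ 2 = r v ^ 2 → u = v := by
      intro u hu v hv h
      rw [hsq u ⟨hu.1, hu.2.le⟩, hsq v ⟨hv.1, hv.2.le⟩] at h
      exact hγ.2.2 hu hv h
    -- Points on opposite branches can meet only at equal parameters, where `r u = -r u` would put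
    -- `γ u` at the origin.
    have hne : ∀ u ∈ Set.Ico (0 : ℝ) 1, ∀ v ∈ Set.Ico (0 : ℝ) 1, c + r u ≠ c - r v := by
      intro u hu v hv h
      have h2 : r u = -r v := by linear_combination h
      have h3 := hinj u hu v hv (by rw [h2]; ring)
      have h4 : r u = 0 := by
        rw [← h3] at h2
        linear_combination h2 / 2
      refine h0 u ⟨hu.1, hu.2.le⟩ ?_
      rw [← hsq u ⟨hu.1, hu.2.le⟩, h4]
      ring
    intro u hu v hv h
    simp only at h
    by_cases hu2 : u < 1 / 2 <;> by_cases hv2 : v < 1 / 2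
    · rw [if_pos hu2, if_pos hv2] at h
      have := hinj (2 * u) ⟨by linarith [hu.1], by linarith⟩ (2 * v)
        ⟨by linarith [hv.1], by linarith⟩ (by rw [add_left_cancel h])
      linarith
    · rw [if_pos hu2, if_neg hv2] at h
      exact absurd h (hne _ ⟨by linarith [hu.1], by linarith⟩ _
        ⟨by linarith, by linarith [hv.2]⟩)
    · rw [if_neg hu2, if_pos hv2] at h
      exact absurd h.symm (hne _ ⟨by linarith [hv.1], by linarith⟩ _
        ⟨by linarith, by linarith [hu.2]⟩)
    · rw [if_neg hu2, if_neg hv2] at h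
      have := hinj (2 * u - 1) ⟨by linarith, by linarith [hu.2]⟩ (2 * v - 1)
        ⟨by linarith, by linarith [hv.2]⟩ (by rw [sub_right_inj.1 h])
      linarith

/-! ### Folding a system along `z = (t - c)²`. -/

/-- Auxiliary data for folding along `z = t²` a system with singular points in `T`: a rational
function `ρ` of `z` with zeros and poles in `E`, its logarithmic derivative `L` and the partial
fraction expansions of `d ρ / (z - d²)` and `d / (z ρ (z - d²))`. -/
structure FoldData (T : Finset ℂ) where
  ρ : ℂ → ℂ
  E : Finset ℂ
  L : ℂ →₀ ℂ
  f : ℂ → ℂ →₀ ℂ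
  h : ℂ → ℂ →₀ ℂ
  ρ_ne_zero : ∀ z ∉ insert 0 (E ∪ T.image fun d => d ^ 2), ρ z ≠ 0
  hasDerivAt_ρ : ∀ z ∉ insert 0 (E ∪ T.image fun d => d ^ 2),
    HasDerivAt ρ (polarPart L z * ρ z) z
  polarPart_f : ∀ z ∉ insert 0 (E ∪ T.image fun d => d ^ 2), ∀ d ∈ T,
    polarPart (f d) z = d * ρ z * (z - d ^ 2)⁻¹
  polarPart_h : ∀ z ∉ insert 0 (E ∪ T.image fun d => d ^ 2), ∀ d ∈ T,
    polarPart (h d) z = d * (z * ρ z)⁻¹ * (z - d ^ 2)⁻¹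
  support_L : L.support ⊆ insert 0 (E ∪ T.image fun d => d ^ 2)
  support_f : ∀ d ∈ T, (f d).support ⊆ insert 0 (E ∪ T.image fun d => d ^ 2)
  support_h : ∀ d ∈ T, (h d).support ⊆ insert 0 (E ∪ T.image fun d => d ^ 2)

/-- The singular set of the folded system. -/
noncomputable def FoldData.sing {T : Finset ℂ} (D : FoldData T) : Finset ℂ :=
  insert 0 (D.E ∪ T.image fun d => d ^ 2)

section Fold

variable {ι : Type}

/-- The block matrix with blocks `a M`, `b M`, `c M`, `d M` and a zero last row and column. -/
def foldBlock (a b c d : ℂ) (M : Matrix ι ι ℂ) : Matrix ((ι ⊕ ι) ⊕ Unit) ((ι ⊕ ι) ⊕ Unit) ℂ :=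
  Matrix.fromBlocks (Matrix.fromBlocks (a • M) (b • M) (c • M) (d • M)) 0 0 0

/-- The projector to the last coordinate. -/
def lastProj (ι : Type) : Matrix ((ι ⊕ ι) ⊕ Unit) ((ι ⊕ ι) ⊕ Unit) ℂ :=
  Matrix.fromBlocks 0 0 0 1

/-- The term of the folded system contributed by one singular point with residue `M`. -/
noncomputable def foldTerm {T : Finset ℂ} (D : FoldData T) (d : ℂ) (M : Matrix ι ι ℂ) :
    ℂ →₀ Matrix ((ι ⊕ ι) ⊕ Unit) ((ι ⊕ ι) ⊕ Unit) ℂ :=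
  Finsupp.single (d ^ 2) (foldBlock (1 / 2) 0 0 (1 / 2) M) +
  (D.h d).mapRange (LinearMap.toSpanSingleton ℂ _ (foldBlock 0 (1 / 2) 0 0 M)) (map_zero _) +
  (D.f d).mapRange (LinearMap.toSpanSingleton ℂ _ (foldBlock 0 0 (1 / 2) 0 M)) (map_zero _)

theorem foldBlock_mulVec [Fintype ι] (a b c d : ℂ) (M : Matrix ι ι ℂ) (y : (ι ⊕ ι) ⊕ Unit → ℂ) :
    (foldBlock a b c d M).mulVec y = Sum.elim (Sum.elim
      (fun i => a * M.mulVec (fun j => y (.inl (.inl j))) i +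
        b * M.mulVec (fun j => y (.inl (.inr j))) i)
      (fun i => c * M.mulVec (fun j => y (.inl (.inl j))) i +
        d * M.mulVec (fun j => y (.inl (.inr j))) i)) 0 := by
  rw [foldBlock, Matrix.fromBlocks_mulVec, Matrix.fromBlocks_mulVec]
  funext k
  rcases k with (i | i) | i
  · simp [Matrix.smul_mulVec]
    rfl
  · simp [Matrix.smul_mulVec]
    rfl
  · simp

/-- The even part `½ ∑ R p / (z - (p - c)²)`. -/
noncomputable def foldEven (R : ℂ →₀ Matrix ι ι ℂ) (σ : Finset ℂ) (c z : ℂ) : Matrix ι ι ℂ :=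
  ∑ p ∈ σ, ((1 / 2) * (z - (p - c) ^ 2)⁻¹) • R p

/-- The odd part `½ ∑ (p - c) R p / (z - (p - c)²)`. -/
noncomputable def foldOdd (R : ℂ →₀ Matrix ι ι ℂ) (σ : Finset ℂ) (c z : ℂ) : Matrix ι ι ℂ :=
  ∑ p ∈ σ, ((1 / 2) * (p - c) * (z - (p - c) ^ 2)⁻¹) • R p

/-- With `s = t - c` and `d = p - c`, the term `1 / (2s(s - d))` equals `(s + d) / (2s(s² - d²))`;
its parts even and odd in `s` are separated here. -/
theorem foldEven_add_foldOdd {R : ℂ →₀ Matrix ι ι ℂ} {σ : Finset ℂ} (hR : R.support ⊆ σ) {c t : ℂ}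
    (ht : t - c ≠ 0) (hz : ∀ p ∈ σ, (t - c) ^ 2 ≠ (p - c) ^ 2) :
    foldEven R σ c ((t - c) ^ 2) + (t - c)⁻¹ • foldOdd R σ c ((t - c) ^ 2) =
      (2 * (t - c))⁻¹ • polarPart R t := by
  rw [polarPart_eq_sum hR, foldEven, foldOdd, Finset.smul_sum, Finset.smul_sum,
    ← Finset.sum_add_distrib]
  refine Finset.sum_congr rfl fun p hp => ?_
  rw [smul_smul, smul_smul, ← add_smul]
  congr 1
  have h1 : (t - c) ^ 2 - (p - c) ^ 2 ≠ 0 := sub_ne_zero.2 (hz p hp)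
  have h2 : t - p ≠ 0 := fun h => h1 (by linear_combination (t + p - 2 * c) * h)
  field_simp
  ring

variable [DecidableEq ι]

/-- The residues of the system for `(x, g x, t - c)`, `g = (t - c) ρ(z)`, as functions of
`z = (t - c)²`. -/
noncomputable def foldSystem (R : ℂ →₀ Matrix ι ι ℂ) (σ : Finset ℂ) (c : ℂ)
    (D : FoldData (σ.image fun p => p - c)) :
    ℂ →₀ Matrix ((ι ⊕ ι) ⊕ Unit) ((ι ⊕ ι) ⊕ Unit) ℂ :=
  ∑ p ∈ σ, foldTerm D (p - c) (R p) +
  D.L.mapRange (LinearMap.toSpanSingleton ℂ _ (foldBlock 0 0 0 1 (1 : Matrix ι ι ℂ))) (map_zero _) +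
  Finsupp.single 0 (foldBlock 0 0 0 (1 / 2) (1 : Matrix ι ι ℂ) + (1 / 2 : ℂ) • lastProj ι)

theorem support_foldSystem_subset (R : ℂ →₀ Matrix ι ι ℂ) (σ : Finset ℂ) (c : ℂ)
    (D : FoldData (σ.image fun p => p - c)) : (foldSystem R σ c D).support ⊆ D.sing := by
  intro z hz
  by_contra hmem
  rw [Finsupp.mem_support_iff] at hz
  apply hz
  have h0 : (0 : ℂ) ≠ z := fun h => hmem (by simp [← h, FoldData.sing])
  have hL : D.L z = 0 := Finsupp.notMem_support_iff.1 fun h => hmem (D.support_L h)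
  rw [foldSystem, Finsupp.add_apply, Finsupp.add_apply, Finsupp.finsetSum_apply,
    Finset.sum_eq_zero]
  · simp [hL, h0]
  · intro p hp
    have hpT : p - c ∈ σ.image fun p => p - c := Finset.mem_image_of_mem (fun p => p - c) hp
    have hf : D.f (p - c) z = 0 := Finsupp.notMem_support_iff.1 fun h =>
      hmem (D.support_f _ hpT h)
    have hh : D.h (p - c) z = 0 := Finsupp.notMem_support_iff.1 fun h =>
      hmem (D.support_h _ hpT h)
    have hd : (p - c) ^ 2 ≠ z := fun h => hmem (Finset.mem_insert_of_mem
      (Finset.mem_union_right _ (h ▸ Finset.mem_image_of_mem (fun d => d ^ 2) hpT)))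
    simp [foldTerm, hf, hh, hd]

theorem norm_foldSystem_le {R : ℂ →₀ Matrix ι ι ℂ} {σ : Finset ℂ} {c : ℂ}
    {D : FoldData (σ.image fun p => p - c)} {C K : ℝ} (hR : ∀ z i j, ‖R z i j‖ ≤ C) (hC : 0 ≤ C)
    (hK : 0 ≤ K) (hL : ∀ z, ‖D.L z‖ ≤ K) (hf : ∀ d ∈ σ.image fun p => p - c, ∀ z, ‖D.f d z‖ ≤ K)
    (hh : ∀ d ∈ σ.image fun p => p - c, ∀ z, ‖D.h d z‖ ≤ K) (z : ℂ) (i j : (ι ⊕ ι) ⊕ Unit) :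
    ‖foldSystem R σ c D z i j‖ ≤ σ.card * (C + K * C + K * C) + K + 1 := by
  have hblock : ∀ (a b c' d : ℂ) (M : Matrix ι ι ℂ) (B : ℝ), 0 ≤ B → (∀ i j, ‖M i j‖ ≤ B) →
      ‖a‖ ≤ 1 → ‖b‖ ≤ 1 → ‖c'‖ ≤ 1 → ‖d‖ ≤ 1 → ‖foldBlock a b c' d M i j‖ ≤ B := by
    intro a b c' d M B hB hM ha hb hc hd
    have key : ∀ (e : ℂ) i j, ‖e‖ ≤ 1 → ‖e * M i j‖ ≤ B := fun e i j he => by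
      rw [norm_mul]
      nlinarith [hM i j, norm_nonneg (M i j), norm_nonneg e]
    rcases i with (i | i) | i <;> rcases j with (j | j) | j <;>
      simp only [foldBlock, Matrix.fromBlocks_apply₁₁, Matrix.fromBlocks_apply₁₂,
        Matrix.fromBlocks_apply₂₁, Matrix.fromBlocks_apply₂₂, Matrix.smul_apply, smul_eq_mul,
        Matrix.zero_apply, norm_zero] <;> first | exact hB | exact key _ _ _ ‹_›
  have hone : ∀ i j, ‖(1 : Matrix ι ι ℂ) i j‖ ≤ 1 := fun i j => by
    rw [Matrix.one_apply]
    split_ifs <;> simp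
  have h1 : ‖(0 : ℂ)‖ ≤ 1 := by simp
  have h2 : ‖(1 / 2 : ℂ)‖ ≤ 1 := by norm_num
  have h3 : ‖(1 : ℂ)‖ ≤ 1 := by simp
  have hmap : ∀ (g : ℂ →₀ ℂ) (M : Matrix ((ι ⊕ ι) ⊕ Unit) ((ι ⊕ ι) ⊕ Unit) ℂ) (B : ℝ), 0 ≤ B →
      (∀ z, ‖g z‖ ≤ K) → ‖M i j‖ ≤ B →
      ‖(g.mapRange (LinearMap.toSpanSingleton ℂ _ M) (map_zero _)) z i j‖ ≤ K * B := by
    intro g M B hB hg hM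
    rw [Finsupp.mapRange_apply, LinearMap.toSpanSingleton_apply, Matrix.smul_apply, smul_eq_mul,
      norm_mul]
    exact mul_le_mul (hg z) hM (norm_nonneg _) hK
  rw [foldSystem, Finsupp.add_apply, Finsupp.add_apply, Finsupp.finsetSum_apply, Matrix.add_apply,
    Matrix.add_apply, Matrix.sum_apply]
  refine (norm_add₃_le).trans (add_le_add_three ?_ ?_ ?_)
  · rw [← nsmul_eq_mul]
    refine (norm_sum_le _ _).trans (Finset.sum_le_card_nsmul _ _ _ fun p hp => ?_)
    have hpT : p - c ∈ σ.image fun p => p - c := Finset.mem_image_of_mem (fun p => p - c) hp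
    rw [foldTerm, Finsupp.add_apply, Finsupp.add_apply, Matrix.add_apply, Matrix.add_apply]
    refine (norm_add₃_le).trans (add_le_add_three ?_ ?_ ?_)
    · exact (norm_single_apply_le _ _ _ _ _).trans (hblock _ _ _ _ _ _ hC (hR p) h2 h1 h1 h2)
    · exact hmap _ _ _ hC (hh _ hpT) (hblock _ _ _ _ _ _ hC (hR p) h1 h2 h1 h1)
    · exact hmap _ _ _ hC (hf _ hpT) (hblock _ _ _ _ _ _ hC (hR p) h1 h1 h2 h1)
  · rw [← mul_one K]
    exact hmap _ _ _ zero_le_one hL (hblock _ _ _ _ _ _ zero_le_one hone h1 h1 h1 h3)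
  · refine (norm_single_apply_le _ _ _ _ _).trans ?_
    rw [Matrix.add_apply]
    have h4 := hblock 0 0 0 (1 / 2) 1 1 zero_le_one hone h1 h1 h1 h2
    rcases i with (i | i) | i <;> rcases j with (j | j) | j <;>
      simp [lastProj] at h4 ⊢ <;> first | exact h4 | norm_num [foldBlock]

variable [Fintype ι]

/-- Write `E` and `O` for `foldEven` and `foldOdd`, so that in the variable `z` one has `x' = E x +
s⁻¹ O x`. The odd factor disappears on writing `s⁻¹ x = (z ρ)⁻¹ (g x)` and `g s⁻¹ = ρ`, where `g = s
ρ`. The logarithmic derivative of `g` is that of `ρ` plus `1 / (2z)`. -/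
theorem polarPart_foldSystem_mulVec (R : ℂ →₀ Matrix ι ι ℂ) (σ : Finset ℂ) (c : ℂ)
    (D : FoldData (σ.image fun p => p - c)) {z : ℂ} (hz : z ∉ D.sing) (y : (ι ⊕ ι) ⊕ Unit → ℂ) :
    (polarPart (foldSystem R σ c D) z).mulVec y = Sum.elim (Sum.elim
      (fun i => (foldEven R σ c z).mulVec (fun j => y (.inl (.inl j))) i +
        (z * D.ρ z)⁻¹ * (foldOdd R σ c z).mulVec (fun j => y (.inl (.inr j))) i)
      (fun i => D.ρ z * (foldOdd R σ c z).mulVec (fun j => y (.inl (.inl j))) i +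
        (foldEven R σ c z).mulVec (fun j => y (.inl (.inr j))) i +
        (polarPart D.L z + (2 * z)⁻¹) * y (.inl (.inr i))))
      (fun u => (2 * z)⁻¹ * y (.inr u)) := by
  have hterm : ∀ p ∈ σ, (polarPart (foldTerm D (p - c) (R p)) z).mulVec y = Sum.elim (Sum.elim
      (fun i => (1 / 2) * (z - (p - c) ^ 2)⁻¹ * (R p).mulVec (fun j => y (.inl (.inl j))) i +
        (z * D.ρ z)⁻¹ * ((1 / 2) * (p - c) * (z - (p - c) ^ 2)⁻¹ *
          (R p).mulVec (fun j => y (.inl (.inr j))) i))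
      (fun i => D.ρ z * ((1 / 2) * (p - c) * (z - (p - c) ^ 2)⁻¹ *
          (R p).mulVec (fun j => y (.inl (.inl j))) i) +
        (1 / 2) * (z - (p - c) ^ 2)⁻¹ * (R p).mulVec (fun j => y (.inl (.inr j))) i)) 0 := by
    intro p hp
    have hpT : p - c ∈ σ.image fun p => p - c := Finset.mem_image_of_mem (fun p => p - c) hp
    rw [foldTerm, polarPart_add, polarPart_add, polarPart_mapRange, polarPart_mapRange,
      polarPart_single, LinearMap.toSpanSingleton_apply, LinearMap.toSpanSingleton_apply,
      D.polarPart_f z hz _ hpT, D.polarPart_h z hz _ hpT, Matrix.add_mulVec, Matrix.add_mulVec,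
      Matrix.smul_mulVec, Matrix.smul_mulVec, Matrix.smul_mulVec, foldBlock_mulVec,
      foldBlock_mulVec, foldBlock_mulVec]
    funext k
    rcases k with (i | i) | i
    · simp only [Pi.add_apply, Pi.smul_apply, Sum.elim_inl, smul_eq_mul]
      ring
    · simp only [Pi.add_apply, Pi.smul_apply, Sum.elim_inl, Sum.elim_inr, smul_eq_mul]
      ring
    · simp
  rw [foldSystem, polarPart_add, polarPart_add, polarPart_sum, polarPart_mapRange, polarPart_single,
    LinearMap.toSpanSingleton_apply, Matrix.add_mulVec, Matrix.add_mulVec, Matrix.sum_mulVec,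
    Finset.sum_congr rfl hterm, Matrix.smul_mulVec, Matrix.smul_mulVec, Matrix.add_mulVec,
    foldBlock_mulVec, foldBlock_mulVec, Matrix.smul_mulVec, lastProj, Matrix.fromBlocks_mulVec]
  simp only [foldEven, foldOdd, Matrix.sum_mulVec, Matrix.smul_mulVec]
  funext k
  rcases k with (i | i) | i
  · simp [Finset.sum_apply, Finset.sum_add_distrib, Finset.mul_sum]
  · simp only [Pi.add_apply, Pi.smul_apply, Sum.elim_inl, Sum.elim_inr, smul_eq_mul,
      Finset.sum_apply, Finset.sum_add_distrib, Finset.mul_sum, Matrix.one_mulVec, sub_zero]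
    simp
    ring
  · simp
    ring

end Fold

section Fold

variable {ι : Type} [Fintype ι]

theorem FoldData.eventually_notMem {T : Finset ℂ} (D : FoldData T) {z : ℂ} (hz : z ∉ D.sing) :
    ∀ᶠ u in 𝓝 z, u ∉ D.sing :=
  (Finset.isClosed _).isOpen_compl.mem_nhds hz

theorem FoldData.ne_zero {T : Finset ℂ} (D : FoldData T) {z : ℂ} (hz : z ∉ D.sing) : z ≠ 0 :=
  fun h => hz (by simp [h, FoldData.sing])

theorem FoldData.sub_ne_zero {T : Finset ℂ} (D : FoldData T) {c t : ℂ}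
    (ht : (t - c) ^ 2 ∉ D.sing) : t - c ≠ 0 := fun h => D.ne_zero ht (by rw [h]; ring)

theorem FoldData.sq_ne_sq {σ : Finset ℂ} {c : ℂ} (D : FoldData (σ.image fun p => p - c)) {z : ℂ}
    (hz : z ∉ D.sing) : ∀ p ∈ σ, z ≠ (p - c) ^ 2 := fun _ hp h =>
  hz (Finset.mem_insert_of_mem (Finset.mem_union_right _ (h ▸ Finset.mem_image_of_mem
    (fun d => d ^ 2) (Finset.mem_image_of_mem (fun p => p - c) hp))))

theorem foldEven_mulVec_add {R : ℂ →₀ Matrix ι ι ℂ} {σ : Finset ℂ} (hR : R.support ⊆ σ) {c t : ℂ}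
    (D : FoldData (σ.image fun p => p - c)) (ht : (t - c) ^ 2 ∉ D.sing) (x : ι → ℂ) (i : ι) :
    (foldEven R σ c ((t - c) ^ 2)).mulVec x i +
      (t - c)⁻¹ * (foldOdd R σ c ((t - c) ^ 2)).mulVec x i =
      (2 * (t - c))⁻¹ * (polarPart R t).mulVec x i := by
  have h := congrArg (fun M : Matrix ι ι ℂ => M.mulVec x i)
    (foldEven_add_foldOdd hR (D.sub_ne_zero ht) (D.sq_ne_sq ht))
  simpa [Matrix.add_mulVec, Matrix.smul_mulVec] using h

/-- A local branch of the inverse of `t ↦ (t - c)²`. -/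
theorem exists_local_inverse_sq {a c : ℂ} (ha : a - c ≠ 0) :
    ∃ ψ : ℂ → ℂ, ψ ((a - c) ^ 2) = a ∧ (∀ᶠ t in 𝓝 a, ψ ((t - c) ^ 2) = t) ∧
      ∀ᶠ z in 𝓝 ((a - c) ^ 2), (ψ z - c) ^ 2 = z ∧ ψ z - c ≠ 0 ∧
        HasDerivAt ψ (2 * (ψ z - c))⁻¹ z := by
  set α := a - c with hα
  have hα2 : α ^ 2 ≠ 0 := pow_ne_zero 2 ha
  -- Dividing by `α ^ 2` moves the base point to `1`, where the principal logarithm is holomorphic.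
  set ψ : ℂ → ℂ := fun z => c + α * Complex.exp (Complex.log (z / α ^ 2) / 2) with hψ
  have hsq : ∀ z, z ≠ 0 → (ψ z - c) ^ 2 = z := by
    intro z hz
    have h1 : Complex.exp (Complex.log (z / α ^ 2) / 2) ^ 2 = z / α ^ 2 := by
      rw [← Complex.exp_nat_mul, Nat.cast_two, mul_div_cancel₀ _ (two_ne_zero' ℂ),
        Complex.exp_log (div_ne_zero hz hα2)]
    rw [hψ, add_sub_cancel_left, mul_pow, h1, mul_div_cancel₀ _ hα2]
  have hne : ∀ z, ψ z - c ≠ 0 := fun z => by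
    rw [hψ, add_sub_cancel_left]
    exact mul_ne_zero ha (Complex.exp_ne_zero _)
  have hbase : ψ (α ^ 2) = a := by
    simp [hψ, hα]
  have hder : ∀ᶠ z in 𝓝 (α ^ 2), HasDerivAt ψ (2 * (ψ z - c))⁻¹ z := by
    have hslit : ∀ᶠ z in 𝓝 (α ^ 2), z / α ^ 2 ∈ Complex.slitPlane := by
      refine (continuousAt_id.div_const (α ^ 2)).eventually ?_
      refine Complex.isOpen_slitPlane.mem_nhds ?_
      simp [div_self hα2]
    filter_upwards [hslit, eventually_ne_nhds hα2] with z hz hz0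
    have h1 : HasDerivAt (fun z : ℂ => z / α ^ 2) (1 / α ^ 2) z := (hasDerivAt_id z).div_const _
    have h2 := (((h1.clog hz).div_const 2).cexp.const_mul α).const_add c
    refine h2.congr_deriv ?_
    have h3 : α * Complex.exp (Complex.log (z / α ^ 2) / 2) = ψ z - c := by
      rw [hψ, add_sub_cancel_left]
    rw [← mul_assoc, h3]
    have h4 := hsq z hz0
    have h5 := hne z
    generalize ψ z - c = s at h4 h5
    subst h4
    field_simp
  refine ⟨ψ, hbase, ?_, ?_⟩
  -- `ψ ((t - c) ^ 2) - c` and `t - c` have equal squares. Their sum is nonzero near `a`, which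
  -- excludes opposite signs.
  · have hc : ContinuousAt (fun t => ψ ((t - c) ^ 2) + t - 2 * c) a := by
      have h1 : ContinuousAt ψ ((a - c) ^ 2) := hder.self_of_nhds.continuousAt
      have h2 : ContinuousAt (fun t : ℂ => (t - c) ^ 2) a := by fun_prop
      exact ((ContinuousAt.comp (f := fun t : ℂ => (t - c) ^ 2) h1 h2).add continuousAt_id).sub
        continuousAt_const
    have h3 : ψ ((a - c) ^ 2) + a - 2 * c ≠ 0 := by
      rw [← hα, hbase]
      have : a + a - 2 * c = 2 * α := by rw [hα]; ring
      rw [this]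
      exact mul_ne_zero two_ne_zero ha
    filter_upwards [hc.eventually_ne h3, eventually_ne_nhds (sub_ne_zero.1 ha)] with t ht htc
    have h4 := hsq ((t - c) ^ 2) (pow_ne_zero 2 (sub_ne_zero.2 htc))
    have h5 : (ψ ((t - c) ^ 2) + t - 2 * c) * (ψ ((t - c) ^ 2) - t) = 0 := by
      linear_combination h4
    exact sub_eq_zero.1 ((mul_eq_zero.1 h5).resolve_left ht)
  · filter_upwards [hder, eventually_ne_nhds hα2] with z hz hz0
    exact ⟨hsq z hz0, hne z, hz⟩

theorem mul_inv_eq_inv_of_sq_eq {s z : ℂ} (hs : s ≠ 0) (h : s ^ 2 = z) : s * z⁻¹ = s⁻¹ := by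
  subst h
  field_simp

variable [DecidableEq ι]

theorem IsVecSolution.foldSystem {R : ℂ →₀ Matrix ι ι ℂ} {σ : Finset ℂ} (hR : R.support ⊆ σ)
    {a c : ℂ} (D : FoldData (σ.image fun p => p - c)) (ha : (a - c) ^ 2 ∉ D.sing)
    {ψ : ℂ → ℂ} (hψa : ψ ((a - c) ^ 2) = a)
    (hψ : ∀ᶠ z in 𝓝 ((a - c) ^ 2), (ψ z - c) ^ 2 = z ∧ ψ z - c ≠ 0 ∧
        HasDerivAt ψ (2 * (ψ z - c))⁻¹ z)
    {x : ℂ → ι → ℂ} (hx : IsVecSolution R a x) (α : ℂ) :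
    IsVecSolution (foldSystem R σ c D) ((a - c) ^ 2) fun z => Sum.elim
      (Sum.elim (fun i => x (ψ z) i) (fun i => (ψ z - c) * D.ρ z * x (ψ z) i))
      (fun _ => α * (ψ z - c)) := by
  have hcont : Tendsto ψ (𝓝 ((a - c) ^ 2)) (𝓝 a) := by
    have := hψ.self_of_nhds.2.2.continuousAt.tendsto
    rwa [hψa] at this
  filter_upwards [hψ, hcont.eventually hx, D.eventually_notMem ha] with z ⟨hsq, hs, hd⟩ hxz hz
  have hρ := D.ρ_ne_zero z hz
  have hk := mul_inv_eq_inv_of_sq_eq hs hsq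
  have hdρ := D.hasDerivAt_ρ z hz
  rw [hasDerivAt_pi, polarPart_foldSystem_mulVec R σ c D hz]
  rw [hasDerivAt_pi] at hxz
  have hEO := fun i => foldEven_mulVec_add hR D (by rwa [hsq]) (x (ψ z)) i
  rw [hsq] at hEO
  have hxd : ∀ i, HasDerivAt (fun z => x (ψ z) i) _ z := fun i =>
    HasDerivAt.comp (h₂ := fun u => x u i) z (hxz i) hd
  have hsm : (fun j => (ψ z - c) * D.ρ z * x (ψ z) j) = ((ψ z - c) * D.ρ z) • x (ψ z) := rfl
  rintro ((i | i) | i)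
  · simp only [Sum.elim_inl, Sum.elim_inr]
    refine (hxd i).congr_deriv ?_
    rw [hsm, Matrix.mulVec_smul, Pi.smul_apply, smul_eq_mul, mul_comm, ← hEO i]
    linear_combination (-(foldOdd R σ c z).mulVec (x (ψ z)) i) * hk -
      z⁻¹ * (ψ z - c) * (foldOdd R σ c z).mulVec (x (ψ z)) i * mul_inv_cancel₀ hρ
  · simp only [Sum.elim_inl, Sum.elim_inr]
    refine (((hd.sub_const c).mul hdρ).mul (hxd i)).congr_deriv ?_
    simp only [Pi.mul_apply]
    rw [hsm, Matrix.mulVec_smul, Pi.smul_apply, smul_eq_mul, mul_comm _ (2 * (ψ z - c))⁻¹, ← hEO i]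
    generalize (foldEven R σ c z).mulVec (x (ψ z)) i = E
    generalize (foldOdd R σ c z).mulVec (x (ψ z)) i = O
    generalize polarPart D.L z = l
    generalize D.ρ z = r
    have h4 : (ψ z - c) * (ψ z - c)⁻¹ = 1 := mul_inv_cancel₀ hs
    rw [mul_inv 2 (ψ z - c)]
    linear_combination (-(r * x (ψ z) i) / 2) * hk + r * O * h4
  · simp only [Sum.elim_inr]
    refine ((hd.sub_const c).const_mul α).congr_deriv ?_
    rw [mul_inv 2 (ψ z - c)]
    linear_combination (-α / 2) * hk

/-- The branch of a solution of the folded system that solves the original system. -/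
noncomputable def foldBranch {T : Finset ℂ} (D : FoldData T) (s : ℂ) (y : (ι ⊕ ι) ⊕ Unit → ℂ)
    (i : ι) : ℂ :=
  (y (.inl (.inl i)) + y (.inl (.inr i)) * (s * D.ρ (s ^ 2))⁻¹) / 2

/-- A folded solution without last coordinate has the form `(x₊ + x₋, g (x₊ - x₋))`, where `x₊` and
`x₋` belong to the two preimages of `z`; the average with `1 / g` extracts `x₊`. -/
theorem IsVecSolution.foldBranch {R : ℂ →₀ Matrix ι ι ℂ} {σ : Finset ℂ} (hR : R.support ⊆ σ)
    {a c : ℂ} (D : FoldData (σ.image fun p => p - c)) (ha : (a - c) ^ 2 ∉ D.sing)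
    {F : ℂ → (ι ⊕ ι) ⊕ Unit → ℂ}
    (hF : IsVecSolution (_root_.foldSystem R σ c D) ((a - c) ^ 2) F) :
    IsVecSolution R a fun t => _root_.foldBranch D (t - c) (F ((t - c) ^ 2)) := by
  have hder : ∀ t : ℂ, HasDerivAt (fun t : ℂ => (t - c) ^ 2) (2 * (t - c)) t := fun t =>
    (((hasDerivAt_id t).sub_const c).pow 2).congr_deriv (by simp)
  have hcont : Tendsto (fun t : ℂ => (t - c) ^ 2) (𝓝 a) (𝓝 ((a - c) ^ 2)) :=
    (hder a).continuousAt
  filter_upwards [hcont.eventually hF, hcont.eventually (D.eventually_notMem ha)] with t hFt ht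
  have hs := D.sub_ne_zero ht
  have hρ := D.ρ_ne_zero _ ht
  have hEO := foldEven_mulVec_add hR D ht
  rw [polarPart_foldSystem_mulVec R σ c D ht, hasDerivAt_pi] at hFt
  rw [hasDerivAt_pi]
  intro i
  have h0 := HasDerivAt.comp (h₂ := fun u => F u (.inl (.inl i))) t (hFt (.inl (.inl i))) (hder t)
  have h1 := HasDerivAt.comp (h₂ := fun u => F u (.inl (.inr i))) t (hFt (.inl (.inr i))) (hder t)
  have h2 := HasDerivAt.comp (h₂ := D.ρ) t (D.hasDerivAt_ρ _ ht) (hder t)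
  have h3 := (((hasDerivAt_id t).sub_const c).mul h2).inv (mul_ne_zero hs hρ)
  refine ((h0.add (h1.mul h3)).div_const 2).congr_deriv ?_
  have hlin : _root_.foldBranch D (t - c) (F ((t - c) ^ 2)) = (1 / 2 : ℂ) •
      ((fun j => F ((t - c) ^ 2) (.inl (.inl j))) + ((t - c) * D.ρ ((t - c) ^ 2))⁻¹ •
        fun j => F ((t - c) ^ 2) (.inl (.inr j))) := by
    funext j
    simp only [_root_.foldBranch, Pi.smul_apply, Pi.add_apply, smul_eq_mul]
    ring
  rw [hlin, Matrix.mulVec_smul, Matrix.mulVec_add, Matrix.mulVec_smul]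
  simp only [Pi.smul_apply, Pi.add_apply, smul_eq_mul, Sum.elim_inl, Sum.elim_inr,
    Function.comp_apply, Pi.mul_apply, Pi.inv_apply, id]
  have e0 := hEO (fun j => F ((t - c) ^ 2) (.inl (.inl j))) i
  have e1 := hEO (fun j => F ((t - c) ^ 2) (.inl (.inr j))) i
  have e0' : (polarPart R t).mulVec (fun j => F ((t - c) ^ 2) (.inl (.inl j))) i = 2 * (t - c) *
    ((foldEven R σ c ((t - c) ^ 2)).mulVec (fun j => F ((t - c) ^ 2) (.inl (.inl j))) i +
      (t - c)⁻¹ * (foldOdd R σ c ((t - c) ^ 2)).mulVec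
        (fun j => F ((t - c) ^ 2) (.inl (.inl j))) i) := by
    rw [e0]
    field_simp
  have e1' : (polarPart R t).mulVec (fun j => F ((t - c) ^ 2) (.inl (.inr j))) i = 2 * (t - c) *
    ((foldEven R σ c ((t - c) ^ 2)).mulVec (fun j => F ((t - c) ^ 2) (.inl (.inr j))) i +
      (t - c)⁻¹ * (foldOdd R σ c ((t - c) ^ 2)).mulVec
        (fun j => F ((t - c) ^ 2) (.inl (.inr j))) i) := by
    rw [e1]
    field_simp
  rw [e0', e1']
  field_simp
  ring

end Fold

section Fold

variable {ι : Type}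

theorem foldBranch_smul {T : Finset ℂ} (D : FoldData T) (s μ : ℂ) (y : (ι ⊕ ι) ⊕ Unit → ℂ) :
    foldBranch D s (μ • y) = μ • foldBranch D s y := by
  funext i
  simp only [foldBranch, Pi.smul_apply, smul_eq_mul]
  ring

/-- The sum and the difference of the two branches recover both blocks, `ρ` and `s` being nonzero.
-/
theorem foldBranch_ne_zero {T : Finset ℂ} (D : FoldData T) {s : ℂ} (hs : s ^ 2 ∉ D.sing)
    {y : (ι ⊕ ι) ⊕ Unit → ℂ} (hu : y (.inr ()) = 0) (hy : y ≠ 0) :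
    foldBranch D s y ≠ 0 ∨ foldBranch D (-s) y ≠ 0 := by
  by_contra! h
  have hρ := D.ρ_ne_zero _ hs
  have hs0 : s ≠ 0 := fun h => D.ne_zero hs (by rw [h]; ring)
  have h0 : ∀ i, y (.inl (.inl i)) = 0 ∧ y (.inl (.inr i)) = 0 := by
    intro i
    have h1 := congr_fun h.1 i
    have h2 := congr_fun h.2 i
    simp only [foldBranch, Pi.zero_apply, neg_sq, neg_mul, inv_neg] at h1 h2
    refine ⟨by linear_combination h1 + h2, ?_⟩
    have h3 : y (.inl (.inr i)) * (s * D.ρ (s ^ 2))⁻¹ = 0 := by linear_combination h1 - h2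
    exact (mul_eq_zero.1 h3).resolve_right (inv_ne_zero (mul_ne_zero hs0 hρ))
  apply hy
  funext k
  rcases k with (i | i) | i
  · exact (h0 i).1
  · exact (h0 i).2
  · exact hu

variable [Fintype ι] [DecidableEq ι]

theorem IsVecContinuation.foldBranch {R : ℂ →₀ Matrix ι ι ℂ} {σ : Finset ℂ} (hR : R.support ⊆ σ)
    {c : ℂ} {D : FoldData (σ.image fun p => p - c)} {γ l : ℝ → ℂ} {y : ℝ → (ι ⊕ ι) ⊕ Unit → ℂ}
    (hy : IsVecContinuation (foldSystem R σ c D) γ y)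
    (hγ : ∀ s ∈ Set.Icc (0 : ℝ) 1, γ s ∉ D.sing)
    (hl : ∀ s ∈ Set.Icc (0 : ℝ) 1, (l s - c) ^ 2 = γ s) :
    IsVecContinuation R l fun s => _root_.foldBranch D (l s - c) (y s) := by
  intro s hs
  obtain ⟨F, hF, hFy⟩ := hy s hs
  rw [← hl s hs] at hF
  refine ⟨_, hF.foldBranch hR D (by rw [hl s hs]; exact hγ s hs), ?_⟩
  filter_upwards [hFy, self_mem_nhdsWithin] with u hu hu'
  rw [hl u hu', hu]

/-- Let `r` be a square root along `γ`. If it closes up, `c + r` is a simple loop on which the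
branch has multiplier `μ`. If it changes sign, `c + r` followed by `c - r` is a simple loop.
Continuing the first branch leads to `μ` times the second, so a full turn multiplies by `μ * μ`. -/
theorem norm_multiplier_foldSystem {R : ℂ →₀ Matrix ι ι ℂ} {σ : Finset ℂ} (hR : R.support ⊆ σ)
    {c : ℂ} {D : FoldData (σ.image fun p => p - c)} (h : VecSpectralCondition R σ) {γ r : ℝ → ℂ}
    {y : ℝ → (ι ⊕ ι) ⊕ Unit → ℂ} (hy : IsVecContinuation (foldSystem R σ c D) γ y)
    (hloop : IsSimpleLoop γ) (hγ : ∀ s ∈ Set.Icc (0 : ℝ) 1, γ s ∉ D.sing)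
    (hrc : Continuous r) (hr : ∀ s ∈ Set.Icc (0 : ℝ) 1, r s ^ 2 = γ s) {μ : ℂ}
    (hy1 : y 1 = μ • y 0) (h0 : foldBranch D (r 0) (y 0) ≠ 0) : ‖μ‖ = 1 := by
  have hmem0 : (0 : ℝ) ∈ Set.Icc (0 : ℝ) 1 := by simp
  have hmem1 : (1 : ℝ) ∈ Set.Icc (0 : ℝ) 1 := by simp
  have havoid : ∀ s ∈ Set.Icc (0 : ℝ) 1, ∀ t, (t - c) ^ 2 = γ s → t ∉ σ := fun s hs t ht hmem =>
    D.sq_ne_sq (hγ s hs) t hmem ht.symm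
  have hp : ∀ s ∈ Set.Icc (0 : ℝ) 1, (c + r s - c) ^ 2 = γ s := fun s hs => by
    rw [add_sub_cancel_left, hr s hs]
  have hm : ∀ s ∈ Set.Icc (0 : ℝ) 1, (c - r s - c) ^ 2 = γ s := fun s hs => by
    rw [← hr s hs]
    ring
  have hplus := hy.foldBranch hR hγ hp
  have hminus := hy.foldBranch hR hγ hm
  simp only [add_sub_cancel_left, sub_sub_cancel_left] at hplus hminus
  have hends : r 1 ^ 2 = r 0 ^ 2 := by rw [hr 1 hmem1, hr 0 hmem0, hloop.2.1]
  rcases sq_eq_sq_iff_eq_or_eq_neg.1 hends with h1 | h1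
  · refine h (fun s => c + r s) ⟨(continuous_const.add hrc).continuousOn, by simp [h1], ?_⟩
      (fun s hs => havoid s hs _ (hp s hs)) μ _ hplus h0 ?_
    · intro s hs u hu hsu
      refine hloop.2.2 hs hu ?_
      rw [← hr s ⟨hs.1, hs.2.le⟩, ← hr u ⟨hu.1, hu.2.le⟩, add_left_cancel hsu]
    · simp only [h1, hy1, foldBranch_smul]
  · have hcat := hplus.concat (hminus.const_smul μ) (continuous_const.add hrc)
      (by rw [h1, sub_eq_add_neg]) (by rw [h1, hy1, foldBranch_smul])
      (fun hmem => havoid 1 hmem1 _ (hp 1 hmem1) (hR hmem))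
    have hloop' := hloop.concat_sqrt c hrc hr
      (fun s hs => D.ne_zero (hγ s hs)) h1
    have := h _ hloop' (fun s hs => ?_) (μ * μ) _ hcat (by simpa using h0) ?_
    · rw [norm_mul] at this
      nlinarith [norm_nonneg μ]
    · by_cases hs2 : s < 1 / 2
      · rw [if_pos hs2]
        exact havoid (2 * s) ⟨by linarith [hs.1], by linarith⟩ _
          (hp _ ⟨by linarith [hs.1], by linarith⟩)
      · rw [if_neg hs2]
        exact havoid (2 * s - 1) ⟨by linarith, by linarith [hs.2]⟩ _
          (hm _ ⟨by linarith, by linarith [hs.2]⟩)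
    · norm_num [h1, hy1, foldBranch_smul, smul_smul]

theorem vecSpectralCondition_foldSystem {R : ℂ →₀ Matrix ι ι ℂ} {σ : Finset ℂ}
    (hR : R.support ⊆ σ) {c : ℂ} (D : FoldData (σ.image fun p => p - c))
    (h : VecSpectralCondition R σ) : VecSpectralCondition (foldSystem R σ c D) D.sing := by
  intro γ hγ hγσ μ y hy hy0 hy1
  have hmem0 : (0 : ℝ) ∈ Set.Icc (0 : ℝ) 1 := by simp
  by_cases hu : y 0 (.inr ()) = 0
  swap
  -- The last coordinate is a multiple of a square root of `z`, so its square divided by `z` is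
  -- constant.
  · refine hy.norm_multiplier_eq_one hγ (fun z => z⁻¹) (.inr ()) two_ne_zero
      (inv_ne_zero (D.ne_zero (hγσ 0 hmem0))) ?_ hu hy1
    intro s hs F hF
    filter_upwards [hF, D.eventually_notMem (hγσ s hs)] with z hFz hz
    have h1 := hasDerivAt_pi.1 hFz (.inr ())
    rw [polarPart_foldSystem_mulVec R σ c D hz] at h1
    simp only [Sum.elim_inr] at h1
    have hz0 := D.ne_zero hz
    refine ((h1.pow 2).mul (hasDerivAt_inv hz0)).congr_deriv ?_
    simp only [Pi.pow_apply]
    field_simp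
    ring
  obtain ⟨r, hrc, hr⟩ := exists_continuous_sq_eq hγ.1 fun s hs => D.ne_zero (hγσ s hs)
  have hr0 : r 0 ^ 2 ∉ D.sing := by
    rw [hr 0 hmem0]
    exact hγσ 0 hmem0
  rcases foldBranch_ne_zero D hr0 hu hy0 with h0 | h0
  -- The square root is taken with the sign for which the starting branch is nonzero.
  · exact norm_multiplier_foldSystem hR h hy hγ hγσ hrc hr hy1 h0
  · exact norm_multiplier_foldSystem hR h hy hγ hγσ hrc.neg (fun s hs => by
      rw [Pi.neg_apply, neg_sq, hr s hs]) hy1 h0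

theorem dominates_foldSystem {R : ℂ →₀ Matrix ι ι ℂ} {σ : Finset ℂ} (hR : R.support ⊆ σ) (c : ℂ)
    (D : FoldData (σ.image fun p => p - c)) :
    Dominates (fun t => (t - c) ^ 2) R σ (foldSystem R σ c D) D.sing := by
  refine ⟨fun a ha hmem => D.sq_ne_sq ha a hmem rfl, fun a _ => by fun_prop, ?_,
    vecSpectralCondition_foldSystem hR D⟩
  intro a ha
  change (a - c) ^ 2 ∉ D.sing at ha
  obtain ⟨ψ, hψa, hleft, hψ⟩ := exists_local_inverse_sq (D.sub_ne_zero ha)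
  refine ⟨fun _ => 1, by simp, forall_mem_affineSolutionSpan (φ := fun t => (t - c) ^ 2) ?_ ?_ ?_⟩
  · exact ⟨fun _ => 1, one_mem_affineSolutionSpan _ _, by simp⟩
  · have hzero : IsVecSolution R a fun _ => 0 :=
      Eventually.of_forall fun t => by simpa using hasDerivAt_const t (0 : ι → ℂ)
    have h1 : (fun z => 1 * (ψ z - c)) ∈ affineSolutionSpan (foldSystem R σ c D) ((a - c) ^ 2) :=
      (hzero.foldSystem hR D ha hψa hψ 1).mem_affineSolutionSpan (.inr ())
    have h2 := add_mem h1 (Submodule.smul_mem _ c (one_mem_affineSolutionSpan _ _))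
    refine ⟨_, h2, ?_⟩
    filter_upwards [hleft] with t ht
    simp [ht]
  · intro x hx i
    have h1 : (fun z => x (ψ z) i) ∈ affineSolutionSpan (foldSystem R σ c D) ((a - c) ^ 2) :=
      (hx.foldSystem hR D ha hψa hψ 0).mem_affineSolutionSpan (.inl (.inl i))
    refine ⟨_, h1, ?_⟩
    filter_upwards [hleft] with t ht
    simp [ht]

end Fold

/-! ### Choice of the zeros and poles of `ρ` on the negative axis. -/

/-- A finite set of positive reals is listed by a monotone positive sequence. -/
theorem exists_monotone_enumeration (N : Finset ℝ) (hN : ∀ x ∈ N, 0 < x) :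
    ∃ τ : ℕ → ℝ, Monotone τ ∧ (∀ i, 0 < τ i) ∧ (∀ i < N.card, τ i ∈ N) ∧
      ∀ x ∈ N, ∃ i < N.card, τ i = x := by
  induction N using Finset.induction_on_max with
  | empty => exact ⟨fun _ => 1, monotone_const, fun _ => one_pos, by simp, by simp⟩
  | insert x N hx ih =>
    have hxN : x ∉ N := fun h => lt_irrefl x (hx x h)
    obtain ⟨τ, hm, hp, hmem, hsurj⟩ := ih fun y hy => hN y (Finset.mem_insert_of_mem hy)
    rw [Finset.card_insert_of_notMem hxN]
    -- Beyond the list the sequence is constant at the maximum, so scales exist for every index.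
    refine ⟨fun i => if i < N.card then τ i else x, ?_, ?_, ?_, ?_⟩
    · intro i j hij
      by_cases hi : i < N.card <;> by_cases hj : j < N.card
      · simpa [hi, hj] using hm hij
      · simpa [hi, hj] using (hx _ (hmem i hi)).le
      · omega
      · simp [hi, hj]
    · intro i
      by_cases hi : i < N.card
      · simpa [hi] using hp i
      · simpa [hi] using hN x (Finset.mem_insert_self x N)
    · intro i _
      by_cases hi : i < N.card
      · simpa [hi] using Or.inr (hmem i hi)
      · simp [hi]
    · intro y hy
      rcases Finset.mem_insert.1 hy with rfl | hy
      · exact ⟨N.card, by omega, by simp⟩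
      · obtain ⟨i, hi, hiy⟩ := hsurj y hy
        exact ⟨i, by omega, by simp [hi, hiy]⟩

/-- Some negative integer multiple of `s` is far, relative to `s`, from a given finite set. -/
theorem exists_far_multiple (F : Finset ℂ) {s : ℝ} (hs : 0 < s) {L : ℕ} (hL : F.card < L) :
    ∃ k : ℕ, 1 ≤ k ∧ k ≤ L ∧ ∀ p ∈ F, s / 2 ≤ ‖-((k : ℂ) * s) - p‖ := by
  by_contra! h
  choose! g hg using h
  have hcard : F.card < (Finset.Icc 1 L).card := by simpa using hL
  -- Pigeonhole: were every multiple close to `F`, two of them would share a close point and differ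
  -- by less than `s`, yet distinct multiples differ by at least `s`.
  obtain ⟨k, hk, k', hk', hne, heq⟩ := Finset.exists_ne_map_eq_of_card_lt_of_maps_to (f := g) hcard
    (fun k hk => by
      rw [Finset.coe_Icc, Set.mem_Icc] at hk
      exact (hg k hk.1 hk.2).1)
  rw [Finset.mem_Icc] at hk hk'
  have h1 := (hg k hk.1 hk.2).2
  have h2 := (hg k' hk'.1 hk'.2).2
  rw [← heq] at h2
  have h3 : ‖((k : ℂ) - k') * s‖ < s := by
    calc ‖((k : ℂ) - k') * s‖ = ‖(-((k' : ℂ) * s) - g k) - (-((k : ℂ) * s) - g k)‖ := by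
          congr 1
          ring
      _ ≤ _ := norm_sub_le _ _
      _ < s := by linarith
  rw [norm_mul, Complex.norm_real, Real.norm_of_nonneg hs.le] at h3
  have h4 : (1 : ℝ) ≤ ‖(k : ℂ) - k'‖ := by
    have h5 : (k : ℂ) - k' = (((k : ℤ) - k' : ℤ) : ℂ) := by push_cast; rfl
    rw [h5, Complex.norm_intCast]
    have : (k : ℤ) - k' ≠ 0 := by omega
    exact_mod_cast Int.one_le_abs this
  nlinarith

/-- Greedy choice: at each stage `F` and the points already chosen still number fewer than `L`. -/
theorem exists_far_sequence (F : Finset ℂ) {s : ℕ → ℝ} (hs : ∀ i, 0 < s i) {L : ℕ} (n : ℕ)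
    (hL : F.card + n ≤ L) :
    ∃ k : ℕ → ℕ, ∀ i < n, 1 ≤ k i ∧ k i ≤ L ∧
      (∀ p ∈ F, s i / 2 ≤ ‖-((k i : ℂ) * s i) - p‖) ∧
      ∀ j < i, s i / 2 ≤ ‖-((k i : ℂ) * s i) - -((k j : ℂ) * s j)‖ := by
  induction n with
  | zero => exact ⟨fun _ => 0, by simp⟩
  | succ n ih =>
    obtain ⟨k, hk⟩ := ih (by omega)
    have hcard : (F ∪ (Finset.range n).image fun j => -((k j : ℂ) * s j)).card < L := by
      have h1 := Finset.card_union_le F ((Finset.range n).image fun j => -((k j : ℂ) * s j))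
      have h2 : ((Finset.range n).image fun j => -((k j : ℂ) * s j)).card ≤ n := by
        simpa using Finset.card_image_le (s := Finset.range n) (f := fun j => -((k j : ℂ) * s j))
      omega
    obtain ⟨q, hq1, hq2, hq⟩ := exists_far_multiple _ (hs n) hcard
    refine ⟨Function.update k n q, fun i hi => ?_⟩
    rcases Nat.lt_succ_iff_lt_or_eq.1 hi with hi | rfl
    · rw [Function.update_of_ne hi.ne]
      refine ⟨(hk i hi).1, (hk i hi).2.1, (hk i hi).2.2.1, fun j hj => ?_⟩
      rw [Function.update_of_ne (hj.trans hi).ne]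
      exact (hk i hi).2.2.2 j hj
    · rw [Function.update_self]
      refine ⟨hq1, hq2, fun p hp => hq p (Finset.mem_union_left _ hp), fun j hj => ?_⟩
      rw [Function.update_of_ne hj.ne]
      exact hq _ (Finset.mem_union_right _ (Finset.mem_image_of_mem _ (Finset.mem_range.2 hj)))

/-- Two points are separated relative to their size. -/
def RelSep (K : ℝ) (p q : ℂ) : Prop := ‖p‖ ≤ K * ‖p - q‖ ∧ ‖q‖ ≤ K * ‖p - q‖

theorem RelSep.symm {K : ℝ} {p q : ℂ} (h : RelSep K p q) : RelSep K q p := by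
  rw [RelSep, norm_sub_rev]
  exact ⟨h.2, h.1⟩

/-- An absolute distance of half the scale is a relative one, since `q` is at most `L` scales long;
`p` is then controlled by the triangle inequality, which adds the `1`. -/
theorem RelSep.of_le {L s : ℝ} {p q : ℂ} (hL : 0 ≤ L) (hq : ‖q‖ ≤ L * s) (h : s / 2 ≤ ‖q - p‖) :
    RelSep (2 * L + 1) p q := by
  have h1 : ‖q‖ ≤ 2 * L * ‖p - q‖ := by
    rw [norm_sub_rev]
    nlinarith
  have h2 : ‖p‖ ≤ ‖p - q‖ + ‖q‖ := by simpa using norm_add_le (p - q) q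
  constructor <;> linarith [norm_nonneg (p - q)]

/-- Points `a`, `b` on the negative axis interlacing, in a logarithmic scale, the absolute values
of the elements of `T`, and relatively separated from each other and from the squares of the
elements of `T`. -/
structure FoldScale (m : ℕ) (T : Finset ℂ) where
  τ : ℕ → ℝ
  a : ℕ → ℂ
  b : ℕ → ℂ
  mono : Monotone τ
  pos : ∀ i, 0 < τ i
  exists_scale : ∀ d ∈ T, d ≠ 0 → ∃ j ≤ m, τ j = ‖d‖
  le_norm_a : ∀ l < m, τ l * τ (l + 1) ≤ ‖a l‖
  norm_a_le : ∀ l < m, ‖a l‖ ≤ (3 * m + 1) * (τ l * τ (l + 1))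
  le_norm_b : ∀ l < m, τ l * τ l ≤ ‖b l‖
  norm_b_le : ∀ l < m, ‖b l‖ ≤ (3 * m + 1) * (τ l * τ l)
  sep_aa : ∀ l < m, ∀ k < m, l ≠ k → RelSep (2 * (3 * m + 1) + 1) (a l) (a k)
  sep_bb : ∀ l < m, ∀ k < m, l ≠ k → RelSep (2 * (3 * m + 1) + 1) (b l) (b k)
  sep_ab : ∀ l < m, ∀ k < m, RelSep (2 * (3 * m + 1) + 1) (a l) (b k)
  sep_sq_a : ∀ d ∈ T, ∀ l < m, RelSep (2 * (3 * m + 1) + 1) (d ^ 2) (a l)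
  sep_sq_b : ∀ d ∈ T, ∀ l < m, RelSep (2 * (3 * m + 1) + 1) (d ^ 2) (b l)
  im_a : ∀ l, (a l).im = 0
  im_b : ∀ l, (b l).im = 0

theorem nonempty_foldScale {m : ℕ} {T : Finset ℂ} (hT : T.card ≤ m) : Nonempty (FoldScale m T) := by
  obtain ⟨τ, hmono, hpos, -, hsurj⟩ := exists_monotone_enumeration
    ((T.filter fun d => d ≠ 0).image fun d => ‖d‖) (by
      intro x hx
      obtain ⟨d, hd, rfl⟩ := Finset.mem_image.1 hx
      exact norm_pos_iff.2 (Finset.mem_filter.1 hd).2)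
  have hcard : ((T.filter fun d => d ≠ 0).image fun d => ‖d‖).card ≤ m :=
    Finset.card_image_le.trans ((Finset.card_filter_le _ _).trans hT)
  -- Even indices give the scales `τ_l²` of the poles, odd ones the scales `τ_l τ_(l+1)` of the
  -- zeros.
  set s : ℕ → ℝ := fun i => τ (i / 2) * τ ((i + 1) / 2) with hs
  have hspos : ∀ i, 0 < s i := fun i => mul_pos (hpos _) (hpos _)
  -- At most `m` squares and `2 * m` chosen points have to be avoided.
  have hFcard : (T.image fun d => d ^ 2).card + 2 * m ≤ 3 * m + 1 := by
    have := Finset.card_image_le (s := T) (f := fun d : ℂ => d ^ 2)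
    omega
  obtain ⟨k, hk⟩ := exists_far_sequence (T.image fun d => d ^ 2) hspos (2 * m) hFcard
  set x : ℕ → ℂ := fun i => -((k i : ℂ) * s i) with hx
  have hnorm : ∀ i, ‖x i‖ = k i * s i := fun i => by
    rw [hx, norm_neg, norm_mul, Complex.norm_natCast, Complex.norm_real,
      Real.norm_of_nonneg (hspos i).le]
  have hle : ∀ i < 2 * m, s i ≤ ‖x i‖ := fun i hi => by
    rw [hnorm]
    have : (1 : ℝ) ≤ k i := by exact_mod_cast (hk i hi).1
    nlinarith [hspos i]
  have hge : ∀ i < 2 * m, ‖x i‖ ≤ (3 * m + 1) * s i := fun i hi => by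
    rw [hnorm]
    have : (k i : ℝ) ≤ 3 * m + 1 := by exact_mod_cast (hk i hi).2.1
    nlinarith [hspos i]
  have hL : (0 : ℝ) ≤ 3 * m + 1 := by positivity
  have hsepF : ∀ d ∈ T, ∀ i < 2 * m, RelSep (2 * (3 * m + 1) + 1) (d ^ 2) (x i) := fun d hd i hi =>
    RelSep.of_le hL (hge i hi) ((hk i hi).2.2.1 _ (Finset.mem_image_of_mem _ hd))
  have hseplt : ∀ i < 2 * m, ∀ j < i, RelSep (2 * (3 * m + 1) + 1) (x j) (x i) := fun i hi j hj =>
    RelSep.of_le hL (hge i hi) ((hk i hi).2.2.2 j hj)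
  have hsep : ∀ i < 2 * m, ∀ j < 2 * m, i ≠ j → RelSep (2 * (3 * m + 1) + 1) (x i) (x j) := by
    intro i hi j hj hij
    rcases lt_or_gt_of_ne hij with h | h
    · exact hseplt j hj i h
    · exact (hseplt i hi j h).symm
  have him : ∀ i, (x i).im = 0 := fun i => by simp [hx]
  have hse : ∀ l, s (2 * l) = τ l * τ l := fun l => by
    have h1 : 2 * l / 2 = l := by omega
    have h2 : (2 * l + 1) / 2 = l := by omega
    simp only [hs, h1, h2]
  have hso : ∀ l, s (2 * l + 1) = τ l * τ (l + 1) := fun l => by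
    have h1 : (2 * l + 1) / 2 = l := by omega
    have h2 : (2 * l + 1 + 1) / 2 = l + 1 := by omega
    simp only [hs, h1, h2]
  exact ⟨{
    τ := τ
    a := fun l => x (2 * l + 1)
    b := fun l => x (2 * l)
    mono := hmono
    pos := hpos
    exists_scale := fun d hd hd0 => by
      obtain ⟨i, hi, hid⟩ := hsurj ‖d‖ (Finset.mem_image_of_mem _ (Finset.mem_filter.2 ⟨hd, hd0⟩))
      exact ⟨i, by omega, hid⟩
    le_norm_a := fun l hl => hso l ▸ hle (2 * l + 1) (by omega)
    norm_a_le := fun l hl => hso l ▸ hge (2 * l + 1) (by omega)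
    le_norm_b := fun l hl => hse l ▸ hle (2 * l) (by omega)
    norm_b_le := fun l hl => hse l ▸ hge (2 * l) (by omega)
    sep_aa := fun l hl k hk hlk => hsep _ (by omega) _ (by omega) (by omega)
    sep_bb := fun l hl k hk hlk => hsep _ (by omega) _ (by omega) (by omega)
    sep_ab := fun l hl k hk => hsep _ (by omega) _ (by omega) (by omega)
    sep_sq_a := fun d hd l hl => hsepF d hd _ (by omega)
    sep_sq_b := fun d hd l hl => hsepF d hd _ (by omega)
    im_a := fun l => him _
    im_b := fun l => him _ }⟩

/-! ### Partial fractions and bounds for their residues. -/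

section PartialFraction

/-- The partial fraction expansion of `P / ∏ (z - v i)`. -/
noncomputable def partialFraction (s : Finset ℕ) (v : ℕ → ℂ) (P : Polynomial ℂ) : ℂ →₀ ℂ :=
  ∑ i ∈ s, Finsupp.single (v i) (P.eval (v i) * Lagrange.nodalWeight s v i)

variable {s : Finset ℕ} {v : ℕ → ℂ}

/-- A polynomial of degree below the number of nodes is its own Lagrange interpolant; the
barycentric formula divided by the nodal polynomial is the expansion. -/
theorem polarPart_partialFraction (hv : Set.InjOn v s) {P : Polynomial ℂ} (hP : P.degree < s.card)
    {z : ℂ} (hz : ∀ i ∈ s, z ≠ v i) :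
    polarPart (partialFraction s v P) z = P.eval z * (∏ i ∈ s, (z - v i))⁻¹ := by
  have h1 := Lagrange.eval_interpolate_not_at_node (fun i => P.eval (v i)) hz
  rw [← Lagrange.eq_interpolate hv hP, Lagrange.eval_nodal] at h1
  have h2 : ∏ i ∈ s, (z - v i) ≠ 0 := Finset.prod_ne_zero_iff.2 fun i hi => sub_ne_zero.2 (hz i hi)
  rw [h1, mul_comm, ← mul_assoc, inv_mul_cancel₀ h2, one_mul, partialFraction, polarPart_sum]
  refine Finset.sum_congr rfl fun i _ => ?_
  rw [polarPart_single, smul_eq_mul]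
  ring

theorem support_partialFraction_subset (s : Finset ℕ) (v : ℕ → ℂ) (P : Polynomial ℂ) :
    (partialFraction s v P).support ⊆ s.image v := by
  intro z hz
  by_contra hmem
  rw [Finsupp.mem_support_iff, partialFraction, Finsupp.finsetSum_apply] at hz
  refine hz (Finset.sum_eq_zero fun i hi => Finsupp.single_eq_of_ne fun h => hmem ?_)
  rw [h]
  exact Finset.mem_image_of_mem v hi

theorem norm_sum_single_le {κ : Type*} (s : Finset κ) (v : κ → ℂ) (w : κ → ℂ) {C : ℝ}
    (hw : ∀ i ∈ s, ‖w i‖ ≤ C) (z : ℂ) : ‖(∑ i ∈ s, Finsupp.single (v i) (w i)) z‖ ≤ s.card * C := by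
  rw [Finsupp.finsetSum_apply]
  refine (norm_sum_le _ _).trans ?_
  rw [← nsmul_eq_mul]
  refine Finset.sum_le_card_nsmul _ _ _ fun i hi => ?_
  rw [Finsupp.single_apply]
  split_ifs
  · exact hw i hi
  · simpa using (norm_nonneg _).trans (hw i hi)

end PartialFraction

section Gap

/-- The distance from `p` to `q`, with the diagonal values replaced by the absolute value. -/
noncomputable def gap (p q : ℂ) : ℝ := if p = q then (if p = 0 then 1 else ‖p‖) else ‖p - q‖

theorem gap_pos (p q : ℂ) : 0 < gap p q := by
  unfold gap
  split_ifs with h h'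
  · exact one_pos
  · exact norm_pos_iff.2 h'
  · exact norm_pos_iff.2 (sub_ne_zero.2 h)

theorem gap_of_ne {p q : ℂ} (h : p ≠ q) : gap p q = ‖p - q‖ := if_neg h

theorem gap_self {p : ℂ} (h : p ≠ 0) : gap p p = ‖p‖ := by simp [gap, h]

theorem gap_zero_right (p : ℂ) : gap p 0 = gap p p := by
  by_cases h : p = 0
  · rw [h]
  · rw [gap_of_ne h, gap_self h, sub_zero]

theorem gap_le {p q : ℂ} (hq : q ≠ 0) : gap p q ≤ ‖p‖ + ‖q‖ := by
  by_cases h : p = q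
  · subst h
    rw [gap_self hq]
    linarith [norm_nonneg p]
  · rw [gap_of_ne h]
    exact norm_sub_le p q

/-- Two points are relatively separated or coincide. -/
def FarOrEq (K : ℝ) (p q : ℂ) : Prop := p = q ∨ RelSep K p q

theorem FarOrEq.norm_le {K : ℝ} {p q : ℂ} (hK : 1 ≤ K) (hq : q ≠ 0) (h : FarOrEq K p q) :
    ‖p‖ ≤ K * gap p q ∧ ‖q‖ ≤ K * gap p q := by
  by_cases hpq : p = q
  · subst hpq
    rw [gap_self hq]
    constructor <;> nlinarith [norm_nonneg p]
  · rw [gap_of_ne hpq]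
    exact h.resolve_left hpq

theorem RelSep.ne {K : ℝ} {p q : ℂ} (h : RelSep K p q) (hq : q ≠ 0) : p ≠ q := by
  rintro rfl
  simpa [hq] using h.1

/-- The diagonal value of `gap` cancels, so the product may run over all nodes and be compared
uniformly with products over `a` and `b`. -/
theorem norm_nodalWeight {s : Finset ℕ} {v : ℕ → ℂ} (hv : Set.InjOn v s) {i : ℕ} (hi : i ∈ s) :
    ‖Lagrange.nodalWeight s v i‖ = gap (v i) (v i) / ∏ j ∈ s, gap (v i) (v j) := by
  rw [← Finset.mul_prod_erase s _ hi, div_mul_eq_div_div, div_self (gap_pos _ _).ne',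
    Lagrange.nodalWeight, norm_prod, one_div, ← Finset.prod_inv_distrib]
  refine Finset.prod_congr rfl fun j hj => ?_
  rw [gap_of_ne fun h => (Finset.ne_of_mem_erase hj)
    (hv (Finset.mem_of_mem_erase hj) hi h.symm), norm_inv]

theorem norm_eval_nodal {s : Finset ℕ} {v : ℕ → ℂ} {p : ℂ} (hp : ∀ i ∈ s, p ≠ v i) (c : ℂ) :
    ‖(Polynomial.C c * Lagrange.nodal s v).eval p‖ = ‖c‖ * ∏ i ∈ s, gap p (v i) := by
  rw [Polynomial.eval_mul, Polynomial.eval_C, Lagrange.eval_nodal, norm_mul, norm_prod]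
  congr 1
  exact Finset.prod_congr rfl fun i hi => (gap_of_ne (hp i hi)).symm

/-- The sequence `x, f 0, f 1, …`. -/
def consSeq (x : ℂ) (f : ℕ → ℂ) : ℕ → ℂ
  | 0 => x
  | i + 1 => f i

theorem forall_consSeq {x : ℂ} {f : ℕ → ℂ} {m : ℕ} {P : ℂ → Prop} (hx : P x)
    (hf : ∀ i < m, P (f i)) : ∀ i ∈ Finset.range (m + 1), P (consSeq x f i) := by
  rintro (_ | i) hi
  · exact hx
  · exact hf i (by simpa using hi)

theorem injOn_consSeq {x : ℂ} {f : ℕ → ℂ} {m : ℕ} (hx : ∀ i < m, x ≠ f i)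
    (hf : Set.InjOn f (Finset.range m)) : Set.InjOn (consSeq x f) (Finset.range (m + 1)) := by
  rintro (_ | i) hi (_ | j) hj h
  · rfl
  · exact absurd h (hx j (by simpa using hj))
  · exact absurd h.symm (hx i (by simpa using hi))
  · exact congrArg _ (hf (by simpa using hi) (by simpa using hj) h)

theorem prod_consSeq {M : Type*} [CommMonoid M] (x : ℂ) (f : ℕ → ℂ) (m : ℕ) (g : ℂ → M) :
    ∏ i ∈ Finset.range (m + 1), g (consSeq x f i) = (∏ i ∈ Finset.range m, g (f i)) * g x :=
  Finset.prod_range_succ' _ _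

end Gap

/-- The factors with `l < c` are `1` and the others telescope. -/
theorem prod_range_max_div {τ : ℕ → ℝ} (hτ : ∀ i, 0 < τ i) (c m : ℕ) :
    ∏ l ∈ Finset.range m, τ (max c (l + 1)) / τ (max c l) = τ (max c m) / τ c := by
  induction m with
  | zero => simp [div_self (hτ c).ne']
  | succ m ih =>
    rw [Finset.prod_range_succ, ih]
    have := (hτ (max c m)).ne'
    have := (hτ c).ne'
    field_simp

theorem ratio_estimate {κ₁ κ₂ A B w w' : ℝ} (hw : 0 < w) (hw' : 0 < w') (hκ₁ : 0 < κ₁)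
    (hκ₂ : 0 < κ₂) (hB : 0 < B) (hA : 0 < A) (h1 : A ≤ κ₁ * w) (h2 : w ≤ κ₂ * A)
    (h3 : B ≤ κ₁ * w') (h4 : w' ≤ κ₂ * B) :
    A ≤ κ₁ * κ₂ * (w / w' * B) ∧ w / w' * B ≤ κ₁ * κ₂ * A := by
  constructor
  · rw [div_mul_eq_mul_div, mul_div_assoc', le_div_iff₀ hw']
    calc A * w' ≤ (κ₁ * w) * (κ₂ * B) := mul_le_mul h1 h4 hw'.le (by positivity)
      _ = _ := by ring
  · rw [div_mul_eq_mul_div, div_le_iff₀ hw']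
    calc w * B ≤ (κ₂ * A) * (κ₁ * w') := mul_le_mul h2 h3 hB.le (by positivity)
      _ = _ := by ring

namespace FoldScale

variable {m : ℕ} {T : Finset ℂ} (F : FoldScale m T)

theorem a_ne_zero {l : ℕ} (hl : l < m) : F.a l ≠ 0 :=
  norm_pos_iff.1 ((mul_pos (F.pos _) (F.pos _)).trans_le (F.le_norm_a l hl))

theorem b_ne_zero {l : ℕ} (hl : l < m) : F.b l ≠ 0 :=
  norm_pos_iff.1 ((mul_pos (F.pos _) (F.pos _)).trans_le (F.le_norm_b l hl))

theorem τ_mul_le {i j k l : ℕ} (h : i ≤ k) (h' : j ≤ l) : F.τ i * F.τ j ≤ F.τ k * F.τ l :=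
  mul_le_mul (F.mono h) (F.mono h') (F.pos _).le (F.pos _).le

/-- The point `p` lies, in the logarithmic scale, between `a (c - 1)` and `b c`. -/
structure IsCut (p : ℂ) (c : ℕ) : Prop where
  le : c ≤ m
  le_norm : ∀ l < m, l < c → F.τ l * F.τ (l + 1) ≤ ‖p‖
  norm_le : ∀ l < m, c ≤ l → ‖p‖ ≤ (3 * m + 1) * (F.τ l * F.τ l)
  far_a : ∀ l < m, FarOrEq (2 * (3 * m + 1) + 1) p (F.a l)
  far_b : ∀ l < m, FarOrEq (2 * (3 * m + 1) + 1) p (F.b l)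

theorem isCut_zero : F.IsCut 0 0 where
  le := Nat.zero_le m
  le_norm l _ h := absurd h (Nat.not_lt_zero l)
  norm_le l _ _ := by
    have := mul_pos (F.pos l) (F.pos l)
    rw [norm_zero]
    positivity
  far_a l _ := Or.inr ⟨by rw [norm_zero]; positivity, by
    rw [zero_sub, norm_neg]
    nlinarith [norm_nonneg (F.a l), Nat.cast_nonneg (α := ℝ) m]⟩
  far_b l _ := Or.inr ⟨by rw [norm_zero]; positivity, by
    rw [zero_sub, norm_neg]
    nlinarith [norm_nonneg (F.b l), Nat.cast_nonneg (α := ℝ) m]⟩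

theorem le_mul_of_le {x y : ℝ} (hy : 0 ≤ y) (h : x ≤ y) : x ≤ (3 * m + 1) * y := by
  nlinarith [Nat.cast_nonneg (α := ℝ) m]

theorem isCut_sq {d : ℂ} (hd : d ∈ T) {j : ℕ} (hj : j ≤ m) (hjd : F.τ j = ‖d‖) :
    F.IsCut (d ^ 2) j where
  le := hj
  le_norm l _ h := by
    rw [norm_pow, ← hjd, pow_two]
    exact F.τ_mul_le h.le h
  norm_le l _ h := by
    rw [norm_pow, ← hjd, pow_two]
    exact le_mul_of_le (mul_pos (F.pos _) (F.pos _)).le (F.τ_mul_le h h)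
  far_a l hl := Or.inr (F.sep_sq_a d hd l hl)
  far_b l hl := Or.inr (F.sep_sq_b d hd l hl)

theorem isCut_b {i : ℕ} (hi : i < m) : F.IsCut (F.b i) i where
  le := hi.le
  le_norm l _ h := (F.τ_mul_le h.le h).trans (F.le_norm_b i hi)
  norm_le l _ h := (F.norm_b_le i hi).trans
    (mul_le_mul_of_nonneg_left (F.τ_mul_le h h) (by positivity))
  far_a l hl := Or.inr (F.sep_ab l hl i hi).symm
  far_b l hl := by
    by_cases h : i = l
    · exact Or.inl (by rw [h])
    · exact Or.inr (F.sep_bb i hi l hl h)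

theorem isCut_a {i : ℕ} (hi : i < m) : F.IsCut (F.a i) (i + 1) where
  le := hi
  le_norm l _ h := (F.τ_mul_le (by omega) (by omega)).trans (F.le_norm_a i hi)
  norm_le l _ h := (F.norm_a_le i hi).trans
    (mul_le_mul_of_nonneg_left (F.τ_mul_le (by omega) (by omega)) (by positivity))
  far_b l hl := Or.inr (F.sep_ab i hi l hl)
  far_a l hl := by
    by_cases h : i = l
    · exact Or.inl (by rw [h])
    · exact Or.inr (F.sep_aa i hi l hl h)

variable {F}

/-- For `l < c` both distances are comparable with `‖p‖`. For `l ≥ c` they are comparable with `τ_l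
τ_(l+1)` and `τ_l²`, whose quotient is `τ_(l+1) / τ_l`. Relative separation gives the lower bounds
for the distances. -/
theorem IsCut.ratio {p : ℂ} {c : ℕ} (h : F.IsCut p c) {l : ℕ} (hl : l < m) :
    gap p (F.a l) ≤ 2 * (3 * m + 1) * (2 * (3 * m + 1) + 1) *
      (F.τ (max c (l + 1)) / F.τ (max c l) * gap p (F.b l)) ∧
    F.τ (max c (l + 1)) / F.τ (max c l) * gap p (F.b l) ≤
      2 * (3 * m + 1) * (2 * (3 * m + 1) + 1) * gap p (F.a l) := by
  have hm : (0 : ℝ) ≤ m := Nat.cast_nonneg m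
  have hK : (1 : ℝ) ≤ 2 * (3 * m + 1) + 1 := by linarith
  have ha := (h.far_a l hl).norm_le hK (F.a_ne_zero hl)
  have hb := (h.far_b l hl).norm_le hK (F.b_ne_zero hl)
  have ha' := gap_le (p := p) (F.a_ne_zero hl)
  have hb' := gap_le (p := p) (F.b_ne_zero hl)
  have h1 := F.norm_a_le l hl
  have h2 := F.norm_b_le l hl
  have hL : (0 : ℝ) < 2 * (3 * m + 1) := by positivity
  have hK0 : (0 : ℝ) < 2 * (3 * m + 1) + 1 := by positivity
  have hτ := F.pos l
  have hτ' := F.pos (l + 1)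
  have hmono : F.τ l * F.τ l ≤ F.τ l * F.τ (l + 1) := F.τ_mul_le le_rfl (Nat.le_succ l)
  rcases lt_or_ge l c with hlc | hlc
  · have h3 := h.le_norm l hl hlc
    have hp : 0 < ‖p‖ := lt_of_lt_of_le (mul_pos hτ hτ') h3
    have key := ratio_estimate hp hp hL hK0 (gap_pos p (F.b l)) (gap_pos p (F.a l)) (by nlinarith)
      ha.1 (by nlinarith) hb.1
    rw [div_self hp.ne'] at key
    rwa [max_eq_left hlc.le, max_eq_left hlc, div_self (F.pos c).ne']
  · have h3 := h.norm_le l hl hlc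
    rw [max_eq_right hlc, max_eq_right (hlc.trans (Nat.le_succ l)),
      ← mul_div_mul_left _ _ hτ.ne']
    refine ratio_estimate (mul_pos hτ hτ') (mul_pos hτ hτ) hL hK0 (gap_pos _ _) (gap_pos _ _)
      ?_ ((F.le_norm_a l hl).trans ha.2) ?_ ((F.le_norm_b l hl).trans hb.2)
    · nlinarith
    · nlinarith

/-- After the normalisation by `τ_m` this says that `|ρ(p)|` is comparable with `1 / τ_c`, up to the
usual modification of vanishing factors. -/
theorem IsCut.prod_ratio {p : ℂ} {c : ℕ} (h : F.IsCut p c) :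
    ∏ l ∈ Finset.range m, gap p (F.a l) ≤ (2 * (3 * m + 1) * (2 * (3 * m + 1) + 1)) ^ m *
      (F.τ m / F.τ c * ∏ l ∈ Finset.range m, gap p (F.b l)) ∧
    F.τ m / F.τ c * ∏ l ∈ Finset.range m, gap p (F.b l) ≤
      (2 * (3 * m + 1) * (2 * (3 * m + 1) + 1)) ^ m * ∏ l ∈ Finset.range m, gap p (F.a l) := by
  have hp := prod_range_max_div F.pos c m
  rw [max_eq_right h.le] at hp
  have hc : (2 * (3 * m + 1) * (2 * (3 * m + 1) + 1) : ℝ) ^ m =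
      ∏ _l ∈ Finset.range m, (2 * (3 * m + 1) * (2 * (3 * m + 1) + 1) : ℝ) := by simp
  rw [← hp, hc, ← Finset.prod_mul_distrib, ← Finset.prod_mul_distrib, ← Finset.prod_mul_distrib]
  constructor
  · exact Finset.prod_le_prod (fun l _ => (gap_pos _ _).le)
      fun l hl => (h.ratio (Finset.mem_range.1 hl)).1
  · exact Finset.prod_le_prod
      (fun l _ => mul_nonneg (div_pos (F.pos _) (F.pos _)).le (gap_pos _ _).le)
      fun l hl => (h.ratio (Finset.mem_range.1 hl)).2

end FoldScale

/-- A bound for the coefficients of the fold data. -/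
def foldConst (m : ℕ) : ℕ :=
  (m + 2) * ((3 * m + 1) * (2 * (3 * m + 1) + 1) *
    (2 * (3 * m + 1) * (2 * (3 * m + 1) + 1)) ^ m) + 2 * m

namespace FoldScale

variable {m : ℕ} {T : Finset ℂ} (F : FoldScale m T)

theorem injOn_a : Set.InjOn F.a (Finset.range m) := by
  intro i hi j hj h
  simp only [Finset.coe_range, Set.mem_Iio] at hi hj
  by_contra hij
  exact (F.sep_aa i hi j hj hij).ne (F.a_ne_zero hj) h

theorem injOn_b : Set.InjOn F.b (Finset.range m) := by
  intro i hi j hj h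
  simp only [Finset.coe_range, Set.mem_Iio] at hi hj
  by_contra hij
  exact (F.sep_bb i hi j hj hij).ne (F.b_ne_zero hj) h

/-- The nodes `d², b 0, …, b (m - 1)`. -/
def fNodes (d : ℂ) : ℕ → ℂ := consSeq (d ^ 2) F.b

/-- The nodes `0, d², a 0, …, a (m - 1)`. -/
def hNodes (d : ℂ) : ℕ → ℂ := consSeq 0 (consSeq (d ^ 2) F.a)

theorem injOn_fNodes {d : ℂ} (hd : d ∈ T) : Set.InjOn (F.fNodes d) (Finset.range (m + 1)) :=
  injOn_consSeq (fun i hi => (F.sep_sq_b d hd i hi).ne (F.b_ne_zero hi)) F.injOn_b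

theorem injOn_hNodes {d : ℂ} (hd : d ∈ T) (hd0 : d ≠ 0) :
    Set.InjOn (F.hNodes d) (Finset.range (m + 1 + 1)) :=
  injOn_consSeq (fun i hi => forall_consSeq (P := fun q => 0 ≠ q) (pow_ne_zero 2 hd0).symm
    (fun _ hi => (F.a_ne_zero hi).symm) i (Finset.mem_range.2 hi))
    (injOn_consSeq (fun i hi => (F.sep_sq_a d hd i hi).ne (F.a_ne_zero hi)) F.injOn_a)

/-- The partial fractions of `d ρ / (z - d²)`. -/
noncomputable def fPart (d : ℂ) : ℂ →₀ ℂ :=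
  partialFraction (Finset.range (m + 1)) (F.fNodes d)
    (Polynomial.C (d * (F.τ m : ℂ)⁻¹) * Lagrange.nodal (Finset.range m) F.a)

/-- The partial fractions of `d / (z ρ (z - d²))`. -/
noncomputable def hPart (d : ℂ) : ℂ →₀ ℂ :=
  partialFraction (Finset.range (m + 1 + 1)) (F.hNodes d)
    (Polynomial.C (d * (F.τ m : ℂ)) * Lagrange.nodal (Finset.range m) F.b)

/-- The rational function `τ_m⁻¹ ∏ (z - a l) / (z - b l)`. -/
noncomputable def rho (z : ℂ) : ℂ :=
  (F.τ m : ℂ)⁻¹ * ∏ l ∈ Finset.range m, (z - F.a l) / (z - F.b l)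

theorem τ_ne_zero (i : ℕ) : (F.τ i : ℂ) ≠ 0 := Complex.ofReal_ne_zero.2 (F.pos i).ne'

theorem degree_C_mul_nodal_le (c : ℂ) (v : ℕ → ℂ) :
    (Polynomial.C c * Lagrange.nodal (Finset.range m) v).degree ≤ m := by
  refine (Polynomial.degree_mul_le _ _).trans
    ((add_le_add Polynomial.degree_C_le le_rfl).trans ?_)
  rw [zero_add, Lagrange.degree_nodal, Finset.card_range]

theorem polarPart_fPart {d : ℂ} (hd : d ∈ T) {z : ℂ} (hz : z ≠ d ^ 2) (hb : ∀ l < m, z ≠ F.b l) :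
    polarPart (F.fPart d) z = d * F.rho z * (z - d ^ 2)⁻¹ := by
  rw [fPart, polarPart_partialFraction (F.injOn_fNodes hd)
    ((degree_C_mul_nodal_le _ _).trans_lt (by rw [Finset.card_range]; exact_mod_cast m.lt_succ_self))
    (forall_consSeq hz hb), fNodes, prod_consSeq (d ^ 2) F.b m (fun q => z - q),
    Polynomial.eval_mul, Polynomial.eval_C, Lagrange.eval_nodal, rho, Finset.prod_div_distrib,
    mul_inv]
  ring

theorem polarPart_hPart {d : ℂ} (hd : d ∈ T) (hd0 : d ≠ 0) {z : ℂ} (hz0 : z ≠ 0) (hz : z ≠ d ^ 2)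
    (ha : ∀ l < m, z ≠ F.a l) :
    polarPart (F.hPart d) z = d * (z * F.rho z)⁻¹ * (z - d ^ 2)⁻¹ := by
  rw [hPart, polarPart_partialFraction (F.injOn_hNodes hd hd0)
    ((degree_C_mul_nodal_le _ _).trans_lt (by rw [Finset.card_range]; exact_mod_cast by omega))
    (forall_consSeq hz0 fun i hi => forall_consSeq hz ha i (Finset.mem_range.2 hi)), hNodes,
    prod_consSeq 0 (consSeq (d ^ 2) F.a) (m + 1) (fun q => z - q),
    prod_consSeq (d ^ 2) F.a m (fun q => z - q),
    Polynomial.eval_mul, Polynomial.eval_C, Lagrange.eval_nodal, rho, Finset.prod_div_distrib,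
    mul_inv, mul_inv, mul_inv, mul_inv, inv_inv, inv_div, sub_zero]
  ring

theorem rho_ne_zero {z : ℂ} (ha : ∀ l < m, z ≠ F.a l) (hb : ∀ l < m, z ≠ F.b l) : F.rho z ≠ 0 :=
  mul_ne_zero (inv_ne_zero (F.τ_ne_zero m)) (Finset.prod_ne_zero_iff.2 fun l hl =>
    div_ne_zero (sub_ne_zero.2 (ha l (Finset.mem_range.1 hl)))
      (sub_ne_zero.2 (hb l (Finset.mem_range.1 hl))))

/-- The logarithmic derivative of `rho`. -/
noncomputable def logPart : ℂ →₀ ℂ :=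
  ∑ l ∈ Finset.range m, Finsupp.single (F.a l) 1 - ∑ l ∈ Finset.range m, Finsupp.single (F.b l) 1

theorem hasDerivAt_rho {z : ℂ} (ha : ∀ l < m, z ≠ F.a l) (hb : ∀ l < m, z ≠ F.b l) :
    HasDerivAt F.rho (polarPart F.logPart z * F.rho z) z := by
  refine ((hasDerivAt_prod_ratio (Finset.range m) F.a F.b
    (fun l hl => ha l (Finset.mem_range.1 hl))
    (fun l hl => hb l (Finset.mem_range.1 hl))).const_mul (F.τ m : ℂ)⁻¹).congr_deriv ?_
  rw [logPart, polarPart_sub, polarPart_sum, polarPart_sum, rho]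
  simp only [polarPart_single, smul_eq_mul, mul_one, Finset.sum_sub_distrib]
  ring

theorem norm_logPart_le (z : ℂ) : ‖F.logPart z‖ ≤ 2 * m := by
  rw [logPart, Finsupp.sub_apply]
  have h1 := norm_sum_single_le (Finset.range m) F.a (fun _ => 1) (C := 1) (by simp) z
  have h2 := norm_sum_single_le (Finset.range m) F.b (fun _ => 1) (C := 1) (by simp) z
  rw [Finset.card_range] at h1 h2
  linarith [norm_sub_le ((∑ l ∈ Finset.range m, Finsupp.single (F.a l) (1 : ℂ)) z)
    ((∑ l ∈ Finset.range m, Finsupp.single (F.b l) (1 : ℂ)) z)]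

/-- The zeros and poles of `rho`. -/
noncomputable def zeroPoleSet : Finset ℂ := (Finset.range m).image F.a ∪ (Finset.range m).image F.b

theorem support_logPart : F.logPart.support ⊆ F.zeroPoleSet := by
  intro z hz
  by_contra hmem
  rw [zeroPoleSet, Finset.mem_union, not_or] at hmem
  rw [Finsupp.mem_support_iff, logPart, Finsupp.sub_apply, Finsupp.finsetSum_apply,
    Finsupp.finsetSum_apply, Finset.sum_eq_zero, Finset.sum_eq_zero, sub_zero] at hz
  · exact hz rfl
  · exact fun i hi => Finsupp.single_eq_of_ne fun h =>
      hmem.2 (h ▸ Finset.mem_image_of_mem F.b hi)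
  · exact fun i hi => Finsupp.single_eq_of_ne fun h =>
      hmem.1 (h ▸ Finset.mem_image_of_mem F.a hi)

variable {F}

theorem IsCut.norm_fResidue_le {p d : ℂ} {c : ℕ} (h : F.IsCut p c) (hd0 : d ≠ 0)
    (hp0 : p ≠ 0) (hpc : ‖p‖ ≤ (3 * m + 1) * (F.τ c * F.τ c))
    (hpd : FarOrEq (2 * (3 * m + 1) + 1) p (d ^ 2)) :
    ‖d‖ * (F.τ m)⁻¹ * (∏ l ∈ Finset.range m, gap p (F.a l)) *
      (gap p p / ((∏ l ∈ Finset.range m, gap p (F.b l)) * gap p (d ^ 2))) ≤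
    (3 * m + 1) * (2 * (3 * m + 1) + 1) * (2 * (3 * m + 1) * (2 * (3 * m + 1) + 1)) ^ m := by
  have hm : (0 : ℝ) ≤ m := Nat.cast_nonneg m
  have hf := hpd.norm_le (by linarith) (pow_ne_zero 2 hd0)
  rw [norm_pow] at hf
  have hr := h.prod_ratio.1
  have hB : 0 < ∏ l ∈ Finset.range m, gap p (F.b l) := Finset.prod_pos fun _ _ => gap_pos _ _
  have hg := gap_pos p (d ^ 2)
  have hτm := F.pos m
  have hτc := F.pos c
  rw [gap_self hp0]
  set A := ∏ l ∈ Finset.range m, gap p (F.a l)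
  set B := ∏ l ∈ Finset.range m, gap p (F.b l)
  set g := gap p (d ^ 2)
  set Q : ℝ := (2 * (3 * m + 1) * (2 * (3 * m + 1) + 1)) ^ m with hQ
  have hQ0 : 0 ≤ Q := by positivity
  set K : ℝ := 2 * (3 * m + 1) + 1 with hK
  have hK0 : 0 < K := by rw [hK]; positivity
  -- Geometric mean: `‖d‖ ^ 2` and one factor `‖p‖` are bounded by `K * g`, the other factor `‖p‖`
  -- by the scale `τ_c²`.
  have key : ‖d‖ * ‖p‖ ≤ (3 * m + 1) * K * (g * F.τ c) := by
    refine abs_le_of_sq_le_sq' ?_ (by positivity) |>.2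
    calc (‖d‖ * ‖p‖) ^ 2 = ‖d‖ ^ 2 * (‖p‖ * ‖p‖) := by ring
      _ ≤ (K * g) * ((K * g) * ((3 * m + 1) * (F.τ c * F.τ c))) := by
        refine mul_le_mul hf.2 (mul_le_mul hf.1 hpc (norm_nonneg _) (by positivity))
          (by positivity) (by positivity)
      _ = (3 * m + 1) * (K * (g * F.τ c)) ^ 2 := by ring
      _ ≤ (3 * m + 1) ^ 2 * (K * (g * F.τ c)) ^ 2 :=
        mul_le_mul_of_nonneg_right (by nlinarith) (by positivity)
      _ = ((3 * m + 1) * K * (g * F.τ c)) ^ 2 := by ring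
  calc ‖d‖ * (F.τ m)⁻¹ * A * (‖p‖ / (B * g))
      ≤ ‖d‖ * (F.τ m)⁻¹ * (Q * (F.τ m / F.τ c * B)) * (‖p‖ / (B * g)) := by gcongr
    _ = Q * ((‖d‖ * ‖p‖) / (g * F.τ c)) := by field_simp
    _ ≤ Q * ((3 * m + 1) * K) := by
      refine mul_le_mul_of_nonneg_left ?_ hQ0
      rwa [div_le_iff₀ (by positivity)]
    _ = (3 * m + 1) * K * Q := by ring

theorem IsCut.norm_hResidue_le {p d : ℂ} {c : ℕ} (h : F.IsCut p c)
    (hpd : ‖d‖ * F.τ c ≤ (2 * (3 * m + 1) + 1) * gap p (d ^ 2)) :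
    ‖d‖ * F.τ m * (∏ l ∈ Finset.range m, gap p (F.b l)) *
      (gap p p / ((∏ l ∈ Finset.range m, gap p (F.a l)) * gap p (d ^ 2) * gap p 0)) ≤
    (3 * m + 1) * (2 * (3 * m + 1) + 1) * (2 * (3 * m + 1) * (2 * (3 * m + 1) + 1)) ^ m := by
  have hm : (0 : ℝ) ≤ m := Nat.cast_nonneg m
  have hr := h.prod_ratio.2
  have hA : 0 < ∏ l ∈ Finset.range m, gap p (F.a l) := Finset.prod_pos fun _ _ => gap_pos _ _
  have hB : 0 < ∏ l ∈ Finset.range m, gap p (F.b l) := Finset.prod_pos fun _ _ => gap_pos _ _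
  have hg := gap_pos p (d ^ 2)
  have hτm := F.pos m
  have hτc := F.pos c
  have hpp := gap_pos p p
  -- The factor `z` in the denominator cancels the diagonal term, also at the node `0`.
  rw [gap_zero_right]
  set A := ∏ l ∈ Finset.range m, gap p (F.a l)
  set B := ∏ l ∈ Finset.range m, gap p (F.b l)
  set g := gap p (d ^ 2)
  set Q : ℝ := (2 * (3 * m + 1) * (2 * (3 * m + 1) + 1)) ^ m with hQ
  have hQ0 : 0 ≤ Q := by positivity
  set K : ℝ := 2 * (3 * m + 1) + 1 with hK
  have hK0 : 0 < K := by rw [hK]; positivity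
  calc ‖d‖ * F.τ m * B * (gap p p / (A * g * gap p p))
      = (‖d‖ * F.τ c) / (A * g) * (F.τ m / F.τ c * B) := by field_simp
    _ ≤ (K * g) / (A * g) * (Q * A) := by gcongr
    _ = K * Q := by field_simp
    _ ≤ (3 * m + 1) * K * Q := by
      refine mul_le_mul_of_nonneg_right ?_ hQ0
      nlinarith

variable (F)

theorem norm_fPart_le {d : ℂ} (hd : d ∈ T) (hd0 : d ≠ 0) (z : ℂ) : ‖F.fPart d z‖ ≤ foldConst m := by
  have hm : (0 : ℝ) ≤ m := Nat.cast_nonneg m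
  obtain ⟨j, hj, hjd⟩ := F.exists_scale d hd hd0
  have hcut : ∀ i ∈ Finset.range (m + 1), ∃ c, F.IsCut (F.fNodes d i) c ∧ F.fNodes d i ≠ 0 ∧
      ‖F.fNodes d i‖ ≤ (3 * m + 1) * (F.τ c * F.τ c) ∧
      FarOrEq (2 * (3 * m + 1) + 1) (F.fNodes d i) (d ^ 2) ∧
      ∀ l ∈ Finset.range m, F.fNodes d i ≠ F.a l := by
    refine forall_consSeq (P := fun p => ∃ c, F.IsCut p c ∧ p ≠ 0 ∧
      ‖p‖ ≤ (3 * m + 1) * (F.τ c * F.τ c) ∧ FarOrEq (2 * (3 * m + 1) + 1) p (d ^ 2) ∧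
      ∀ l ∈ Finset.range m, p ≠ F.a l) ?_ ?_
    · refine ⟨j, F.isCut_sq hd hj hjd, pow_ne_zero 2 hd0, ?_, Or.inl rfl, fun l hl =>
        (F.sep_sq_a d hd l (Finset.mem_range.1 hl)).ne (F.a_ne_zero (Finset.mem_range.1 hl))⟩
      rw [norm_pow, ← hjd, pow_two]
      exact le_mul_of_le (mul_pos (F.pos _) (F.pos _)).le le_rfl
    · intro i hi
      exact ⟨i, F.isCut_b hi, F.b_ne_zero hi, F.norm_b_le i hi, Or.inr (F.sep_sq_b d hd i hi).symm,
        fun l hl => ((F.sep_ab l (Finset.mem_range.1 hl) i hi).ne (F.b_ne_zero hi)).symm⟩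
  refine (norm_sum_single_le _ _ _ (C := (3 * m + 1) * (2 * (3 * m + 1) + 1) *
    (2 * (3 * m + 1) * (2 * (3 * m + 1) + 1)) ^ m) (fun i hi => ?_) z).trans ?_
  · obtain ⟨c, h1, h2, h3, h4, h5⟩ := hcut i hi
    rw [norm_mul, norm_eval_nodal h5, norm_nodalWeight (F.injOn_fNodes hd) hi,
      show ∏ k ∈ Finset.range (m + 1), gap (F.fNodes d i) (F.fNodes d k) = _ from
        prod_consSeq (d ^ 2) F.b m (gap (F.fNodes d i)), norm_mul, norm_inv, Complex.norm_real,
      Real.norm_of_nonneg (F.pos m).le]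
    exact h1.norm_fResidue_le hd0 h2 h3 h4
  · rw [foldConst, Finset.card_range]
    push_cast
    have : (0 : ℝ) ≤ (3 * m + 1) * (2 * (3 * m + 1) + 1) *
      (2 * (3 * m + 1) * (2 * (3 * m + 1) + 1)) ^ m := by positivity
    nlinarith

theorem norm_hPart_le {d : ℂ} (hd : d ∈ T) (hd0 : d ≠ 0) (z : ℂ) : ‖F.hPart d z‖ ≤ foldConst m := by
  have hm : (0 : ℝ) ≤ m := Nat.cast_nonneg m
  have hK : (1 : ℝ) ≤ 2 * (3 * m + 1) + 1 := by linarith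
  obtain ⟨j, hj, hjd⟩ := F.exists_scale d hd hd0
  have hd2 : d ^ 2 ≠ 0 := pow_ne_zero 2 hd0
  have hdpos := norm_pos_iff.2 hd0
  have hcut : ∀ i ∈ Finset.range (m + 1 + 1), ∃ c, F.IsCut (F.hNodes d i) c ∧
      ‖d‖ * F.τ c ≤ (2 * (3 * m + 1) + 1) * gap (F.hNodes d i) (d ^ 2) ∧
      ∀ l ∈ Finset.range m, F.hNodes d i ≠ F.b l := by
    refine forall_consSeq (P := fun p => ∃ c, F.IsCut p c ∧
      ‖d‖ * F.τ c ≤ (2 * (3 * m + 1) + 1) * gap p (d ^ 2) ∧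
      ∀ l ∈ Finset.range m, p ≠ F.b l) ?_ fun i hi => forall_consSeq (P := fun p => ∃ c,
      F.IsCut p c ∧ ‖d‖ * F.τ c ≤ (2 * (3 * m + 1) + 1) * gap p (d ^ 2) ∧
      ∀ l ∈ Finset.range m, p ≠ F.b l) ?_ ?_ i (Finset.mem_range.2 hi)
    · refine ⟨0, F.isCut_zero, ?_, fun l hl => (F.b_ne_zero (Finset.mem_range.1 hl)).symm⟩
      have h1 : F.τ 0 ≤ ‖d‖ := hjd ▸ F.mono (Nat.zero_le j)
      rw [gap_of_ne hd2.symm, zero_sub, norm_neg, norm_pow]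
      nlinarith
    · refine ⟨j, F.isCut_sq hd hj hjd, ?_, fun l hl =>
        (F.sep_sq_b d hd l (Finset.mem_range.1 hl)).ne (F.b_ne_zero (Finset.mem_range.1 hl))⟩
      rw [gap_self hd2, hjd, norm_pow]
      nlinarith
    · intro i hi
      refine ⟨i + 1, F.isCut_a hi, ?_, fun l hl =>
        (F.sep_ab i hi l (Finset.mem_range.1 hl)).ne (F.b_ne_zero (Finset.mem_range.1 hl))⟩
      have hf := FarOrEq.norm_le hK hd2 (Or.inr (F.sep_sq_a d hd i hi).symm)
      rw [norm_pow] at hf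
      -- If `a i` lies below the scale of `d²`, the bound comes from `‖d‖ ^ 2`; otherwise it comes
      -- from `‖a i‖`, since `‖d‖ * τ_(i+1) ≤ τ_i τ_(i+1)`.
      rcases Nat.lt_or_ge i j with hij | hij
      · have h1 : F.τ (i + 1) ≤ ‖d‖ := hjd ▸ F.mono hij
        nlinarith [hf.2]
      · have h1 : ‖d‖ ≤ F.τ i := hjd ▸ F.mono hij
        nlinarith [hf.1, F.le_norm_a i hi, F.pos (i + 1)]
  refine (norm_sum_single_le _ _ _ (C := (3 * m + 1) * (2 * (3 * m + 1) + 1) *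
    (2 * (3 * m + 1) * (2 * (3 * m + 1) + 1)) ^ m) (fun i hi => ?_) z).trans ?_
  · obtain ⟨c, h1, h2, h3⟩ := hcut i hi
    rw [norm_mul, norm_eval_nodal h3, norm_nodalWeight (F.injOn_hNodes hd hd0) hi,
      show ∏ k ∈ Finset.range (m + 1 + 1), gap (F.hNodes d i) (F.hNodes d k) = _ from
        prod_consSeq 0 (consSeq (d ^ 2) F.a) (m + 1) (gap (F.hNodes d i)),
      prod_consSeq (d ^ 2) F.a m (gap (F.hNodes d i)), norm_mul, Complex.norm_real,
      Real.norm_of_nonneg (F.pos m).le]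
    exact h1.norm_hResidue_le h2
  · rw [foldConst, Finset.card_range]
    push_cast
    nlinarith

/-- The fold data defined by a scale. -/
noncomputable def foldData : FoldData T :=
  have hE : ∀ z ∉ insert 0 (F.zeroPoleSet ∪ T.image fun d => d ^ 2),
      z ≠ 0 ∧ (∀ l < m, z ≠ F.a l) ∧ (∀ l < m, z ≠ F.b l) ∧ ∀ d ∈ T, z ≠ d ^ 2 := fun z hz => by
    simp only [zeroPoleSet, Finset.mem_insert, Finset.mem_union, Finset.mem_image,
      Finset.mem_range, not_or, not_exists, not_and] at hz
    exact ⟨hz.1, fun l hl => Ne.symm (hz.2.1.1 l hl), fun l hl => Ne.symm (hz.2.1.2 l hl),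
      fun d hd => Ne.symm (hz.2.2 d hd)⟩
  { ρ := F.rho
    E := F.zeroPoleSet
    L := F.logPart
    -- For `d = 0` the expanded functions vanish identically because of their factor `d`.
    f := fun d => if d = 0 then 0 else F.fPart d
    h := fun d => if d = 0 then 0 else F.hPart d
    ρ_ne_zero := fun z hz => F.rho_ne_zero (hE z hz).2.1 (hE z hz).2.2.1
    hasDerivAt_ρ := fun z hz => F.hasDerivAt_rho (hE z hz).2.1 (hE z hz).2.2.1
    polarPart_f := fun z hz d hd => by
      split_ifs with h
      · simp [h]
      · exact F.polarPart_fPart hd ((hE z hz).2.2.2 d hd) (hE z hz).2.2.1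
    polarPart_h := fun z hz d hd => by
      split_ifs with h
      · simp [h]
      · exact F.polarPart_hPart hd h (hE z hz).1 ((hE z hz).2.2.2 d hd) (hE z hz).2.1
    support_L := F.support_logPart.trans
      (Finset.subset_union_left.trans (Finset.subset_insert _ _))
    support_f := fun d hd => by
      split_ifs with h
      · simp
      · refine (support_partialFraction_subset _ _ _).trans (Finset.image_subset_iff.2 ?_)
        refine forall_consSeq (P := fun q => q ∈ insert 0 (F.zeroPoleSet ∪ T.image fun d => d ^ 2))
          ?_ fun i hi => ?_
        · exact Finset.mem_insert_of_mem (Finset.mem_union_right _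
            (Finset.mem_image_of_mem (fun d => d ^ 2) hd))
        · exact Finset.mem_insert_of_mem (Finset.mem_union_left _ (Finset.mem_union_right _
            (Finset.mem_image_of_mem F.b (Finset.mem_range.2 hi))))
    support_h := fun d hd => by
      split_ifs with h
      · simp
      · refine (support_partialFraction_subset _ _ _).trans (Finset.image_subset_iff.2 ?_)
        refine forall_consSeq (P := fun q => q ∈ insert 0 (F.zeroPoleSet ∪ T.image fun d => d ^ 2))
          (Finset.mem_insert_self _ _) fun i hi => ?_
        refine forall_consSeq (P := fun q => q ∈ insert 0 (F.zeroPoleSet ∪ T.image fun d => d ^ 2))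
          ?_ (fun i hi => ?_) i (Finset.mem_range.2 hi)
        · exact Finset.mem_insert_of_mem (Finset.mem_union_right _
            (Finset.mem_image_of_mem (fun d => d ^ 2) hd))
        · exact Finset.mem_insert_of_mem (Finset.mem_union_left _ (Finset.mem_union_left _
            (Finset.mem_image_of_mem F.a (Finset.mem_range.2 hi)))) }

end FoldScale

/-- Fold data exist with real zeros and poles, and with coefficients bounded in terms of the number
of points only. -/
theorem exists_foldData {m : ℕ} {T : Finset ℂ} (hT : T.card ≤ m) :
    ∃ D : FoldData T, (∀ z ∈ D.E, z.im = 0) ∧ D.E.card ≤ 2 * m ∧ (∀ z, ‖D.L z‖ ≤ foldConst m) ∧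
      (∀ d ∈ T, ∀ z, ‖D.f d z‖ ≤ foldConst m) ∧ ∀ d ∈ T, ∀ z, ‖D.h d z‖ ≤ foldConst m := by
  obtain ⟨F⟩ := nonempty_foldScale hT
  refine ⟨F.foldData, ?_, ?_, fun z => ?_, fun d hd z => ?_, fun d hd z => ?_⟩
  · intro z hz
    rcases Finset.mem_union.1 hz with hz | hz <;> obtain ⟨l, -, rfl⟩ := Finset.mem_image.1 hz
    · exact F.im_a l
    · exact F.im_b l
  · refine (Finset.card_union_le _ _).trans ?_
    have h1 := Finset.card_image_le (s := Finset.range m) (f := F.a)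
    have h2 := Finset.card_image_le (s := Finset.range m) (f := F.b)
    rw [Finset.card_range] at h1 h2
    omega
  · refine (F.norm_logPart_le z).trans ?_
    have : 2 * m ≤ foldConst m := Nat.le_add_left _ _
    exact_mod_cast this
  · by_cases h : d = 0
    · simp [FoldScale.foldData, h]
    · simpa [FoldScale.foldData, h] using F.norm_fPart_le hd h z
  · by_cases h : d = 0
    · simp [FoldScale.foldData, h]
    · simpa [FoldScale.foldData, h] using F.norm_hPart_le hd h z

/-! ### Iterated folding and the final real system. -/

/-- Bounds for the dimension, the number of singular points and the residues of a system. -/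
structure SystemBounds {ι : Type} [Fintype ι] (R : ℂ →₀ Matrix ι ι ℂ) (σ : Finset ℂ)
    (q : ℕ × ℕ × ℕ) : Prop where
  dim : Fintype.card ι ≤ q.1
  support : R.support ⊆ σ
  card : σ.card ≤ q.2.1
  norm : ∀ z i j, ‖R z i j‖ ≤ q.2.2

/-- The effect of one fold on the bounds. -/
def foldStep (q : ℕ × ℕ × ℕ) : ℕ × ℕ × ℕ :=
  (2 * q.1 + 1, 3 * q.2.1 + 1,
    q.2.1 * (q.2.2 + foldConst q.2.1 * q.2.2 + foldConst q.2.1 * q.2.2) + foldConst q.2.1 + 1)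

theorem im_sq_eq_zero {z : ℂ} (h : z.re = 0 ∨ z.im = 0) : (z ^ 2).im = 0 := by
  rw [pow_two, Complex.mul_im]
  rcases h with h | h <;> rw [h] <;> ring

/-- Squaring with respect to a suitable real centre decreases the number of nonreal points. -/
theorem exists_center {k : ℕ} (σ : Finset ℂ) (hσ : (σ.filter fun z => z.im ≠ 0).card ≤ k + 1) :
    ∃ c : ℂ, ((σ.image fun p => (p - c) ^ 2).filter fun z => z.im ≠ 0).card ≤ k := by
  have hsub : ∀ c : ℂ, c.im = 0 → ((σ.image fun p => (p - c) ^ 2).filter fun z => z.im ≠ 0) ⊆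
      ((σ.filter fun z => z.im ≠ 0).filter fun p => p.re ≠ c.re).image fun p => (p - c) ^ 2 := by
    intro c hc z hz
    obtain ⟨hz1, hz2⟩ := Finset.mem_filter.1 hz
    obtain ⟨p, hp, rfl⟩ := Finset.mem_image.1 hz1
    refine Finset.mem_image_of_mem (fun p => (p - c) ^ 2)
      (Finset.mem_filter.2 ⟨Finset.mem_filter.2 ⟨hp, fun h => hz2 ?_⟩, fun h => hz2 ?_⟩)
    · exact im_sq_eq_zero (Or.inr (by simp [h, hc]))
    · exact im_sq_eq_zero (Or.inl (by simp [h]))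
  rcases (σ.filter fun z => z.im ≠ 0).eq_empty_or_nonempty with h | ⟨p, hp⟩
  · refine ⟨0, (Finset.card_le_card (hsub 0 rfl)).trans ?_⟩
    simp [h]
  -- The centre lies under the nonreal point `p`, so `p - c` is imaginary with real square and at
  -- least one nonreal point is lost.
  · refine ⟨(p.re : ℂ), (Finset.card_le_card (hsub _ (Complex.ofReal_im _))).trans
      (Finset.card_image_le.trans (Nat.le_of_lt_succ (lt_of_lt_of_le (Finset.card_lt_card ?_) hσ)))⟩
    exact Finset.filter_ssubset.2 ⟨p, hp, by simp⟩

/-- A system with at most `k` nonreal singular points is dominated, through a polynomial map of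
degree `2 ^ k`, by a system with only real singular points. -/
theorem exists_real_dominating (k : ℕ) : ∀ {ι : Type} [Fintype ι] [DecidableEq ι]
    {R : ℂ →₀ Matrix ι ι ℂ} {σ : Finset ℂ} {q : ℕ × ℕ × ℕ}, SystemBounds R σ q →
    (σ.filter fun z => z.im ≠ 0).card ≤ k →
    ∃ (P : Polynomial ℂ) (κ : Type) (_ : Fintype κ) (_ : DecidableEq κ) (R' : ℂ →₀ Matrix κ κ ℂ)
      (σ' : Finset ℂ), P.natDegree = 2 ^ k ∧ Dominates (fun t => P.eval t) R σ R' σ' ∧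
      (∀ z ∈ σ', z.im = 0) ∧ SystemBounds R' σ' (foldStep^[k] q) := by
  induction k with
  | zero =>
    intro ι _ _ R σ q hq hσ
    refine ⟨Polynomial.X, ι, inferInstance, inferInstance, R, σ, by simp, ?_, ?_, hq⟩
    · simp only [Polynomial.eval_X]
      exact Dominates.refl R σ
    · intro z hz
      by_contra h
      simp only [nonpos_iff_eq_zero, Finset.card_eq_zero] at hσ
      exact Finset.notMem_empty z (hσ ▸ Finset.mem_filter.2 ⟨hz, h⟩)
  | succ k ih =>
    intro ι _ _ R σ q hq hσ
    obtain ⟨c, hc⟩ := exists_center σ hσ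
    have hT : (σ.image fun p => p - c).card ≤ q.2.1 := Finset.card_image_le.trans hq.card
    obtain ⟨D, hD1, hD2, hD3, hD4, hD5⟩ := exists_foldData hT
    have hsq : ((σ.image fun p => p - c).image fun d => d ^ 2) = σ.image fun p => (p - c) ^ 2 := by
      rw [Finset.image_image]
      rfl
    have hbound : SystemBounds (foldSystem R σ c D) D.sing (foldStep q) := by
      refine ⟨?_, support_foldSystem_subset R σ c D, ?_, fun z i j => ?_⟩
      · have := hq.dim
        simp only [Fintype.card_sum, Fintype.card_unit, foldStep]
        omega
      · refine (Finset.card_insert_le _ _).trans (Nat.succ_le_succ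
          ((Finset.card_union_le _ _).trans ?_))
        have h1 := Finset.card_image_le (s := σ.image fun p => p - c) (f := fun d : ℂ => d ^ 2)
        omega
      · refine (norm_foldSystem_le (K := foldConst q.2.1) hq.norm (Nat.cast_nonneg _)
          (Nat.cast_nonneg _) hD3 hD4 hD5 z i j).trans ?_
        have h1 : (σ.card : ℝ) ≤ q.2.1 := by exact_mod_cast hq.card
        simp only [foldStep]
        push_cast
        gcongr
    -- The origin and the zeros and poles of `ρ` are real, so only the squares can contribute
    -- nonreal points.
    have hnonreal : (D.sing.filter fun z => z.im ≠ 0).card ≤ k := by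
      refine (Finset.card_le_card fun z hz => ?_).trans hc
      obtain ⟨hz1, hz2⟩ := Finset.mem_filter.1 hz
      refine Finset.mem_filter.2 ⟨?_, hz2⟩
      rcases Finset.mem_insert.1 hz1 with rfl | hz1
      · exact absurd rfl hz2
      · rcases Finset.mem_union.1 hz1 with hz1 | hz1
        · exact absurd (hD1 z hz1) hz2
        · rwa [hsq] at hz1
    obtain ⟨P, κ, _, _, R', σ', hP, hdom, hreal, hb⟩ := ih hbound hnonreal
    refine ⟨P.comp ((Polynomial.X - Polynomial.C c) ^ 2), κ, inferInstance, inferInstance, R', σ',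
      ?_, ?_, hreal, hb⟩
    · rw [Polynomial.natDegree_comp, hP, Polynomial.natDegree_pow, Polynomial.natDegree_X_sub_C,
        pow_succ, mul_one]
    · have := (dominates_foldSystem hq.support c D).trans hdom
      convert this using 1
      funext t
      simp

theorem exists_real_notMem (σ : Finset ℂ) : ∃ c : ℂ, c.im = 0 ∧ c ∉ σ := by
  obtain ⟨x, hx⟩ := Infinite.exists_notMem_finset (σ.image Complex.re)
  exact ⟨x, Complex.ofReal_im x, fun h => hx (Finset.mem_image.2 ⟨x, h, Complex.ofReal_re x⟩)⟩

/-- The entry bound of the final system. -/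
def finalEntryBound (q : ℕ × ℕ × ℕ) : ℕ := q.2.1 * (2 * q.2.2) + (q.2.1 + 1) * 2 + 2

/-- A system with real singular points is dominated, through a Möbius map, by a system with real
residues and no singularity at infinity. -/
theorem exists_real_fuchsianSystem {ι : Type} [Fintype ι] [DecidableEq ι]
    {R : ℂ →₀ Matrix ι ι ℂ} {σ : Finset ℂ} {q : ℕ × ℕ × ℕ} (hq : SystemBounds R σ q)
    (hσ : ∀ z ∈ σ, z.im = 0) :
    ∃ (c : ℂ) (n' : ℕ) (S' : FuchsianSystem n'),
      Dominates (fun z => (z - c)⁻¹) R σ S'.residue S'.poles ∧ n' ≤ 2 * (q.1 + 2) ∧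
      S'.poles.card ≤ q.2.1 + 2 ∧ (∀ z i j, ‖S'.residue z i j‖ ≤ finalEntryBound q) ∧
      (∀ z ∈ S'.poles, z.im = 0) ∧ S'.residueInfty = 0 ∧ ∀ z i j, (S'.residue z i j).im = 0 := by
  -- Real `c` and `e` keep all singular points real; their positions do not affect the residue
  -- bounds.
  obtain ⟨c, hc0, hc⟩ := exists_real_notMem σ
  obtain ⟨e, he0, he⟩ := exists_real_notMem (mobiusPoints σ c)
  set Q := mobiusSystem R σ c e with hQ
  have hsupp : Q.support = insert e (mobiusPoints σ c) := support_mobiusSystem R he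
  have hreal : ∀ z ∈ insert e (mobiusPoints σ c), z.im = 0 := by
    intro z hz
    simp only [mobiusPoints, Finset.mem_insert, Finset.mem_image] at hz
    rcases hz with rfl | rfl | ⟨p, hp, rfl⟩
    · exact he0
    · rfl
    · simp [Complex.inv_im, hσ p hp, hc0]
  let E := Fintype.equivFin ((Bool ⊕ ι) ⊕ (Bool ⊕ ι))
  let S' : FuchsianSystem (Fintype.card ((Bool ⊕ ι) ⊕ (Bool ⊕ ι))) :=
    ⟨(realification Q).mapRange (Matrix.reindexLinearEquiv ℂ ℂ E E) (map_zero _)⟩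
  have hpoles : S'.poles = insert e (mobiusPoints σ c) := by
    rw [← hsupp, ← support_realification Q]
    exact Finsupp.support_mapRange_of_injective (map_zero (Matrix.reindexLinearEquiv ℂ ℂ E E)) _
      (LinearEquiv.injective _)
  have hres : ∀ z i j, S'.residue z i j = realification Q z (E.symm i) (E.symm j) := fun z i j => rfl
  refine ⟨c, _, S', ?_, ?_, ?_, ?_, ?_, ?_, ?_⟩
  · rw [hpoles]
    exact ((dominates_mobiusSystem hq.support hc he).trans
      (dominates_realification (hsupp ▸ hreal) hreal)).trans (dominates_reindex E _ _)
  · have := hq.dim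
    simp only [Fintype.card_sum, Fintype.card_bool]
    omega
  · rw [hpoles, ← hsupp]
    exact (card_support_mobiusSystem_le R he).trans (Nat.add_le_add_right hq.card 2)
  · intro z i j
    rw [hres]
    refine norm_realification_le (fun z i j => ?_) z _ _
    refine (norm_mobiusSystem_le σ c e hq.norm (Nat.cast_nonneg _) z i j).trans ?_
    have h1 : (σ.card : ℝ) ≤ q.2.1 := by exact_mod_cast hq.card
    simp only [finalEntryBound]
    push_cast
    gcongr
  · rw [hpoles]
    exact hreal
  · have h0 := sum_realification (sum_mobiusSystem R σ c e)
    rw [← hQ, support_realification, hsupp, ← hpoles] at h0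
    have h1 : ∑ a ∈ S'.poles, S'.residue a =
        Matrix.reindexLinearEquiv ℂ ℂ E E (∑ a ∈ S'.poles, realification Q a) := by
      rw [map_sum]
      rfl
    rw [FuchsianSystem.residueInfty, h1, h0, map_zero, neg_zero]
  · intro z i j
    rw [hres]
    exact im_realification Q z _ _

/-! ### Comparison of height and entry bounds. -/

section Height

attribute [local instance] Matrix.linftyOpNormedAddCommGroup

theorem norm_entry_le_linftyOpNorm {n : ℕ} (A : Matrix (Fin n) (Fin n) ℂ) (i j : Fin n) :
    ‖A i j‖ ≤ ‖A‖ := by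
  rw [Matrix.linfty_opNorm_def]
  have h1 : ‖A i j‖₊ ≤ ∑ k, ‖A i k‖₊ :=
    Finset.single_le_sum (f := fun k => ‖A i k‖₊) (fun _ _ => zero_le) (Finset.mem_univ j)
  exact NNReal.coe_le_coe.2 (h1.trans
    (Finset.le_sup (f := fun i => ∑ k, ‖A i k‖₊) (Finset.mem_univ i)))

theorem linftyOpNorm_le {n : ℕ} {A : Matrix (Fin n) (Fin n) ℂ} {C : ℕ} (h : ∀ i j, ‖A i j‖ ≤ C) :
    ‖A‖ ≤ (n * C : ℕ) := by
  rw [Matrix.linfty_opNorm_def, ← NNReal.coe_natCast]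
  refine NNReal.coe_le_coe.2 (Finset.sup_le fun i _ => ?_)
  rw [Nat.cast_mul, ← nsmul_eq_mul]
  refine (Finset.sum_le_card_nsmul _ _ (C : NNReal) fun j _ => ?_).trans_eq (by simp)
  exact NNReal.coe_le_coe.1 (by simpa using h i j)

namespace FuchsianSystem

variable {n : ℕ} {S : FuchsianSystem n}

theorem InClass.systemBounds {m r : ℕ} (h : S.InClass m r) :
    SystemBounds S.residue S.poles (n, m, r) := by
  refine ⟨by simp, subset_rfl, (Nat.le_add_right _ _).trans h.1, fun z i j => ?_⟩
  refine (norm_entry_le_linftyOpNorm _ i j).trans (le_trans ?_ h.2)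
  have h0 : 0 ≤ ∑ a ∈ S.poles, ‖S.residue a‖ := Finset.sum_nonneg fun a _ => norm_nonneg _
  rw [height]
  by_cases hz : z ∈ S.poles
  · have := Finset.single_le_sum (f := fun a => ‖S.residue a‖) (fun _ _ => norm_nonneg _) hz
    linarith [norm_nonneg S.residueInfty]
  · rw [Finsupp.notMem_support_iff.1 hz, norm_zero]
    exact add_nonneg h0 (norm_nonneg _)

theorem inClass_of_bounds {m N C : ℕ} (hm : S.poles.card ≤ m) (hn : n ≤ N)
    (hC : ∀ z i j, ‖S.residue z i j‖ ≤ C) (hinf : S.residueInfty = 0) :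
    S.InClass m (m * (N * C)) := by
  refine ⟨by simpa [numSingular, hinf] using hm, ?_⟩
  rw [height, hinf, norm_zero, add_zero]
  have h1 : ∑ a ∈ S.poles, ‖S.residue a‖ ≤ S.poles.card • ((n * C : ℕ) : ℝ) :=
    Finset.sum_le_card_nsmul _ _ _ fun a _ => linftyOpNorm_le fun i j => hC a i j
  refine h1.trans ?_
  rw [nsmul_eq_mul]
  exact_mod_cast Nat.mul_le_mul hm (Nat.mul_le_mul_right C hn)

end FuchsianSystem

end Height

/-- The bounds after all folds. -/
def foldedBounds (q : ℕ × ℕ × ℕ) : ℕ × ℕ × ℕ := foldStep^[q.2.1] q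

/-- Every system of the class is dominated by a real system, with explicit bounds. -/
theorem exists_dominating_fuchsianSystem {n m r : ℕ} {S : FuchsianSystem n} (hS : S.InClass m r) :
    ∃ (P : Polynomial ℂ) (c : ℂ) (n' : ℕ) (S' : FuchsianSystem n'), P.natDegree = 2 ^ m ∧
      Dominates (fun t => (P.eval t - c)⁻¹) S.residue S.poles S'.residue S'.poles ∧
      n' ≤ 2 * ((foldedBounds (n, m, r)).1 + 2) ∧
      S'.InClass ((foldedBounds (n, m, r)).2.1 + 2) (((foldedBounds (n, m, r)).2.1 + 2) *
        (2 * ((foldedBounds (n, m, r)).1 + 2) * finalEntryBound (foldedBounds (n, m, r)))) ∧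
      (∀ z ∈ S'.poles, z.im = 0) ∧ S'.residueInfty = 0 ∧ ∀ z i j, (S'.residue z i j).im = 0 := by
  obtain ⟨P, κ, _, _, R', σ', hP, hdom, hreal, hb⟩ := exists_real_dominating m hS.systemBounds
    ((Finset.card_filter_le _ _).trans hS.systemBounds.card)
  obtain ⟨c, n', S', hdom', hn', hcard, hnorm, hr, hinf, him⟩ := exists_real_fuchsianSystem hb hreal
  exact ⟨P, c, n', S', hP, hdom.trans hdom', hn',
    FuchsianSystem.inClass_of_bounds hcard hn' hnorm hinf, hr, hinf, him⟩

/-! ### Degrees in Picard–Vessiot fields. -/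

section Homogenization

variable {ι κ : Type}

/-- The substitution of `ℓ i / ℓ₁` for the variables, multiplied by `ℓ₁ ^ d`. -/
noncomputable def substHomogeneous (d : ℕ) (ℓ₁ : MvPolynomial κ ℂ) (ℓ : ι → MvPolynomial κ ℂ)
    (P : MvPolynomial ι ℂ) : MvPolynomial κ ℂ :=
  ∑ s ∈ P.support, MvPolynomial.C (P.coeff s) * ℓ₁ ^ (d - s.sum fun _ e => e) *
    s.prod fun i e => ℓ i ^ e

theorem totalDegree_substHomogeneous_le {d : ℕ} {ℓ₁ : MvPolynomial κ ℂ}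
    {ℓ : ι → MvPolynomial κ ℂ} {P : MvPolynomial ι ℂ} (h1 : ℓ₁.totalDegree ≤ 1)
    (h : ∀ i, (ℓ i).totalDegree ≤ 1) (hP : P.totalDegree ≤ d) :
    (substHomogeneous d ℓ₁ ℓ P).totalDegree ≤ d := by
  refine (MvPolynomial.totalDegree_finsetSum _ _).trans (Finset.sup_le fun s hs => ?_)
  have hsd := (MvPolynomial.le_totalDegree hs).trans hP
  have hA : (ℓ₁ ^ (d - s.sum fun _ e => e)).totalDegree ≤ d - s.sum fun _ e => e :=
    (MvPolynomial.totalDegree_pow _ _).trans (by nlinarith)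
  have hB : (s.prod fun i e => ℓ i ^ e).totalDegree ≤ s.sum fun _ e => e := by
    refine (MvPolynomial.totalDegree_finsetProd _ _).trans (Finset.sum_le_sum fun i _ => ?_)
    exact (MvPolynomial.totalDegree_pow _ _).trans (by nlinarith [h i])
  have h2 := MvPolynomial.totalDegree_mul (MvPolynomial.C (P.coeff s) *
    ℓ₁ ^ (d - s.sum fun _ e => e)) (s.prod fun i e => ℓ i ^ e)
  have h3 := MvPolynomial.totalDegree_mul (MvPolynomial.C (P.coeff s))
    (ℓ₁ ^ (d - s.sum fun _ e => e))
  rw [MvPolynomial.totalDegree_C] at h3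
  omega

/-- The powers of `ℓ₁` complete every monomial to degree `d`, so a common factor `w ^ d` comes out.
-/
theorem eval_substHomogeneous {d : ℕ} {ℓ₁ : MvPolynomial κ ℂ}
    {ℓ : ι → MvPolynomial κ ℂ} {P : MvPolynomial ι ℂ} (hP : P.totalDegree ≤ d) {x : κ → ℂ}
    {y : ι → ℂ} {w : ℂ} (h1 : MvPolynomial.eval x ℓ₁ = w)
    (h : ∀ i, MvPolynomial.eval x (ℓ i) = w * y i) :
    MvPolynomial.eval x (substHomogeneous d ℓ₁ ℓ P) = w ^ d * MvPolynomial.eval y P := by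
  rw [MvPolynomial.eval_eq y P, substHomogeneous, map_sum,
    Finset.mul_sum]
  refine Finset.sum_congr rfl fun s hs => ?_
  have hsd := (MvPolynomial.le_totalDegree hs).trans hP
  have hprod : MvPolynomial.eval x (s.prod fun i e => ℓ i ^ e) =
      w ^ (s.sum fun _ e => e) * ∏ i ∈ s.support, y i ^ s i := by
    rw [Finsupp.prod, map_prod, Finsupp.sum, ← Finset.prod_pow_eq_pow_sum, ← Finset.prod_mul_distrib]
    refine Finset.prod_congr rfl fun i _ => ?_
    rw [map_pow, h, mul_pow]
  rw [map_mul, map_mul, MvPolynomial.eval_C, map_pow, h1, hprod]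
  rw [← pow_sub_mul_pow w hsd]
  ring

end Homogenization

/-- The functions generating the Picard–Vessiot field. -/
def pvFun {n : ℕ} (X : ℂ → Matrix (Fin n) (Fin n) ℂ) : Option (Fin n × Fin n) → ℂ → ℂ
  | none => fun t => t
  | some ij => fun t => X t ij.1 ij.2

theorem pvGenerators_eq {n : ℕ} (X : ℂ → Matrix (Fin n) (Fin n) ℂ) (b : ℂ) :
    pvGenerators X b = fun k => (pvFun X k : PuncturedGerm b) := by
  funext k
  cases k <;> rfl

theorem PuncturedGerm.evalPoly_coe {ι : Type} {b : ℂ} (G : ι → ℂ → ℂ) (P : MvPolynomial ι ℂ) :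
    evalPoly (fun k => (G k : PuncturedGerm b)) P =
      ((fun t => MvPolynomial.eval (fun k => G k t) P : ℂ → ℂ) : PuncturedGerm b) := by
  unfold evalPoly
  induction P using MvPolynomial.induction_on with
  | C a =>
    simp only [MvPolynomial.eval₂_C, MvPolynomial.eval_C]
    rfl
  | add p q hp hq =>
    simp only [MvPolynomial.eval₂_add, map_add, hp, hq]
    rfl
  | mul_X p k hp =>
    simp only [MvPolynomial.eval₂_mul, MvPolynomial.eval₂_X, map_mul, MvPolynomial.eval_X, hp]
    rfl

theorem PuncturedGerm.coe_ne_zero {b : ℂ} {f : ℂ → ℂ} (h : ∀ᶠ t in 𝓝[≠] b, f t ≠ 0) :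
    (f : PuncturedGerm b) ≠ 0 := by
  intro h0
  obtain ⟨t, h1, h2⟩ := (h.and (Germ.coe_eq.1 h0)).exists
  exact h1 h2

namespace FuchsianSystem

variable {n : ℕ} {S : FuchsianSystem n}

theorem IsSolutionNear.analyticAt {b : ℂ} {X : ℂ → Matrix (Fin n) (Fin n) ℂ}
    (h : S.IsSolutionNear b X) (i j : Fin n) : AnalyticAt ℂ (fun t => X t i j) b :=
  Complex.analyticAt_iff_eventually_differentiableAt.2
    (h.mono fun _ ht => (ht i j).differentiableAt)

theorem IsSolutionNear.analyticAt_pvFun {b : ℂ} {X : ℂ → Matrix (Fin n) (Fin n) ℂ}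
    (h : S.IsSolutionNear b X) (k : Option (Fin n × Fin n)) : AnalyticAt ℂ (pvFun X k) b := by
  cases k with
  | none => exact analyticAt_id
  | some ij => exact h.analyticAt ij.1 ij.2

theorem IsSolutionNear.pvFun_mem_affineSolutionSpan {b : ℂ} {X : ℂ → Matrix (Fin n) (Fin n) ℂ}
    (h : S.IsSolutionNear b X) (k : Option (Fin n × Fin n)) :
    pvFun X k ∈ affineSolutionSpan S.residue b := by
  cases k with
  | none => exact id_mem_affineSolutionSpan _ _
  | some ij => exact (isSolutionNear_iff.1 h ij.2).mem_affineSolutionSpan ij.1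

/-- Affine combinations of solutions are values of linear polynomials at a fundamental solution. -/
theorem IsFundamentalAt.exists_linear {b : ℂ} {Y : ℂ → Matrix (Fin n) (Fin n) ℂ}
    (hY : S.IsFundamentalAt b Y) (hb : b ∉ S.poles) {F : ℂ → ℂ}
    (hF : F ∈ affineSolutionSpan S.residue b) :
    ∃ ℓ : MvPolynomial (Option (Fin n × Fin n)) ℂ, ℓ.totalDegree ≤ 1 ∧
      ∀ᶠ z in 𝓝 b, MvPolynomial.eval (fun k => pvFun Y k z) ℓ = F z := by
  refine Submodule.span_induction (p := fun F _ =>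
    ∃ ℓ : MvPolynomial (Option (Fin n × Fin n)) ℂ, ℓ.totalDegree ≤ 1 ∧
      ∀ᶠ z in 𝓝 b, MvPolynomial.eval (fun k => pvFun Y k z) ℓ = F z) ?_ ?_ ?_ ?_ hF
  · rintro F ((rfl | rfl) | ⟨x, i, hx, rfl⟩)
    · exact ⟨1, by simp, by simp⟩
    · exact ⟨MvPolynomial.X none, by simp, by simp [pvFun]⟩
    · set c := (Y b)⁻¹.mulVec (x b) with hc
      refine ⟨∑ j, MvPolynomial.C (c j) * MvPolynomial.X (some (i, j)), ?_, ?_⟩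
      · refine (MvPolynomial.totalDegree_finsetSum _ _).trans (Finset.sup_le fun j _ => ?_)
        refine (MvPolynomial.totalDegree_mul _ _).trans ?_
        simp
      · have h0 : (Y b).mulVec c = x b := by
          rw [hc, Matrix.mulVec_mulVec, Matrix.mul_nonsing_inv _ (Ne.isUnit hY.2),
            Matrix.one_mulVec]
        filter_upwards [(hY.1.mulVec c).eventually_eq hx hb h0] with z hz
        rw [← hz, map_sum, Matrix.mulVec, dotProduct]
        refine Finset.sum_congr rfl fun j _ => ?_
        simp [pvFun, mul_comm]
  · exact ⟨0, by simp, by simp⟩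
  · rintro F G _ _ ⟨ℓ, h1, h2⟩ ⟨ℓ', h1', h2'⟩
    refine ⟨ℓ + ℓ', (MvPolynomial.totalDegree_add _ _).trans (max_le h1 h1'), ?_⟩
    filter_upwards [h2, h2'] with z h h'
    rw [map_add, h, h', Pi.add_apply]
  · rintro c F _ ⟨ℓ, h1, h2⟩
    refine ⟨c • ℓ, (MvPolynomial.totalDegree_smul_le _ _).trans h1, ?_⟩
    filter_upwards [h2] with z h
    rw [MvPolynomial.smul_eval, h, Pi.smul_apply, smul_eq_mul]

end FuchsianSystem

section Pullback

variable {φ : RatFunc ℂ} {ψ : ℂ → ℂ} {b a : ℂ}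

theorem IsInverseBranch.pullback_coe (hψ : IsInverseBranch φ ψ b a) (f : ℂ → ℂ) :
    hψ.pullback (f : PuncturedGerm a) = ((fun z => f (ψ z) : ℂ → ℂ) : PuncturedGerm b) := rfl

theorem IsInverseBranch.tendsto_nhds (hψ : IsInverseBranch φ ψ b a) : Tendsto ψ (𝓝 b) (𝓝 a) := by
  have := hψ.analyticAt.continuousAt.tendsto
  rwa [hψ.map_base] at this

variable {n : ℕ} {S : FuchsianSystem n} {X : ℂ → Matrix (Fin n) (Fin n) ℂ}

theorem IsInverseBranch.pullback_generators (hψ : IsInverseBranch φ ψ b a)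
    (X : ℂ → Matrix (Fin n) (Fin n) ℂ) :
    (fun k => hψ.pullback (pvGenerators X a k)) =
      fun k => ((fun z => pvFun X k (ψ z) : ℂ → ℂ) : PuncturedGerm b) := by
  rw [pvGenerators_eq]
  rfl

/-- Germs of arbitrary functions may be nonzero without being invertible. Solutions are analytic, so
a nonzero denominator has no zeros on a punctured neighbourhood, and this survives pullback. -/
theorem eventually_eval_ne_zero (hX : S.IsSolutionNear a X)
    {Q : MvPolynomial (Option (Fin n × Fin n)) ℂ}
    (hQ : PuncturedGerm.evalPoly (pvGenerators X a) Q ≠ 0) :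
    ∀ᶠ t in 𝓝[≠] a, MvPolynomial.eval (fun k => pvFun X k t) Q ≠ 0 := by
  rw [pvGenerators_eq, PuncturedGerm.evalPoly_coe] at hQ
  have han : AnalyticAt ℂ (fun t => MvPolynomial.eval (fun k => pvFun X k t) Q) a := by
    simp only [MvPolynomial.eval_eq]
    exact Finset.analyticAt_fun_sum _ fun s _ => analyticAt_const.mul
      (Finset.analyticAt_fun_prod _ fun k _ => (hX.analyticAt_pvFun k).pow _)
  rcases han.eventually_eq_zero_or_eventually_ne_zero with h | h
  · exact absurd (Germ.coe_eq.2 (h.filter_mono nhdsWithin_le_nhds)) hQ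
  · exact h

/-- Pulling back the Picard–Vessiot field amounts to pulling back its generators. -/
theorem IsInverseBranch.pullback_pvField (hψ : IsInverseBranch φ ψ b a) (hX : S.IsSolutionNear a X) :
    hψ.pullback '' pvField X a =
      PuncturedGerm.generatedField (fun k => hψ.pullback (pvGenerators X a k)) := by
  ext g
  constructor
  · rintro ⟨f, ⟨d, P, Q, hP, hQ, hQ0, rfl⟩, rfl⟩
    have hne := hψ.tendsto.eventually (eventually_eval_ne_zero hX hQ0)
    refine ⟨d, P, Q, hP, hQ, ?_, ?_⟩
    · rw [hψ.pullback_generators, PuncturedGerm.evalPoly_coe]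
      exact PuncturedGerm.coe_ne_zero hne
    · rw [hψ.pullback_generators, PuncturedGerm.evalPoly_coe, PuncturedGerm.evalPoly_coe,
        pvGenerators_eq, PuncturedGerm.evalPoly_coe, PuncturedGerm.evalPoly_coe]
      rfl
  · rintro ⟨d, P, Q, hP, hQ, hQ0, rfl⟩
    refine ⟨_, ⟨d, P, Q, hP, hQ, fun h0 => hQ0 ?_, rfl⟩, ?_⟩
    · rw [pvGenerators_eq, PuncturedGerm.evalPoly_coe] at h0
      rw [hψ.pullback_generators, PuncturedGerm.evalPoly_coe]
      exact congrArg hψ.pullback h0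
    · rw [hψ.pullback_generators, PuncturedGerm.evalPoly_coe, PuncturedGerm.evalPoly_coe,
        pvGenerators_eq, PuncturedGerm.evalPoly_coe, PuncturedGerm.evalPoly_coe]
      rfl

/-- Domination does not increase degrees. -/
theorem Dominates.pvDegreeLE_pullback {n' : ℕ} {S' : FuchsianSystem n'} {Φ : ℂ → ℂ}
    (hdom : Dominates Φ S.residue S.poles S'.residue S'.poles)
    (hψ : IsInverseBranch φ ψ b a) (hΦ : ∀ᶠ z in 𝓝 b, Φ (ψ z) = z) (hb : b ∉ S'.poles)
    {Y : ℂ → Matrix (Fin n') (Fin n') ℂ} (hX : S.IsSolutionNear a X) (hY : S'.IsFundamentalAt b Y)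
    {f : PuncturedGerm a} {d : ℕ} (hf : PVDegreeLE X a d f) :
    PVDegreeLE Y b d (hψ.pullback f) := by
  obtain ⟨P, Q, hP, hQ, hQ0, rfl⟩ := hf
  have hΦa : Φ a = b := by
    have := hΦ.self_of_nhds
    rwa [hψ.map_base] at this
  obtain ⟨v, hv, hlift⟩ := hdom.lift a (hΦa.symm ▸ hb)
  rw [hΦa] at hlift
  have hlin : ∀ g ∈ affineSolutionSpan S.residue a,
      ∃ ℓ : MvPolynomial (Option (Fin n' × Fin n')) ℂ, ℓ.totalDegree ≤ 1 ∧
        ∀ᶠ z in 𝓝 b, MvPolynomial.eval (fun k => pvFun Y k z) ℓ = v (ψ z) * g (ψ z) := by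
    intro g hg
    obtain ⟨F, hF, hFg⟩ := hlift g hg
    obtain ⟨ℓ, hℓ, hℓF⟩ := hY.exists_linear hb hF
    refine ⟨ℓ, hℓ, ?_⟩
    filter_upwards [hℓF, hΦ, hψ.tendsto_nhds.eventually hFg] with z h1 h2 h3
    rw [h1, ← h3, h2]
  -- The lift of the constant `1` expresses the common factor `v` itself; it plays the role of the
  -- homogenising variable.
  obtain ⟨ℓ₁, hℓ₁, h1⟩ := hlin _ (one_mem_affineSolutionSpan _ _)
  choose ℓ hℓ hℓg using fun k => hlin _ (hX.pvFun_mem_affineSolutionSpan k)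
  have hne := hψ.tendsto.eventually (eventually_eval_ne_zero hX hQ0)
  have hv' : ∀ᶠ z in 𝓝[≠] b, v (ψ z) ≠ 0 :=
    (hψ.tendsto_nhds.eventually hv).filter_mono nhdsWithin_le_nhds
  have heval : ∀ A : MvPolynomial (Option (Fin n × Fin n)) ℂ, A.totalDegree ≤ d →
      ∀ᶠ z in 𝓝[≠] b, MvPolynomial.eval (fun k => pvFun Y k z) (substHomogeneous d ℓ₁ ℓ A) =
        v (ψ z) ^ d * MvPolynomial.eval (fun k => pvFun X k (ψ z)) A := by
    intro A hA
    refine Eventually.filter_mono nhdsWithin_le_nhds ?_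
    filter_upwards [h1, eventually_all.2 hℓg] with z hz1 hz2
    exact eval_substHomogeneous hA (by rw [hz1, mul_one]) hz2
  refine ⟨substHomogeneous d ℓ₁ ℓ P, substHomogeneous d ℓ₁ ℓ Q,
    totalDegree_substHomogeneous_le hℓ₁ hℓ hP, totalDegree_substHomogeneous_le hℓ₁ hℓ hQ, ?_, ?_⟩
  · rw [pvGenerators_eq, PuncturedGerm.evalPoly_coe]
    refine PuncturedGerm.coe_ne_zero ?_
    filter_upwards [heval Q hQ, hne, hv'] with z hz1 hz2 hz3
    rw [hz1]
    exact mul_ne_zero (pow_ne_zero d hz3) hz2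
  · rw [pvGenerators_eq, pvGenerators_eq, PuncturedGerm.evalPoly_coe, PuncturedGerm.evalPoly_coe,
      PuncturedGerm.evalPoly_coe, PuncturedGerm.evalPoly_coe, ← Germ.coe_div, ← Germ.coe_div,
      hψ.pullback_coe]
    refine Germ.coe_eq.2 ?_
    filter_upwards [heval P hP, heval Q hQ, hv'] with z hz1 hz2 hz3
    rw [Pi.div_apply, Pi.div_apply, hz1, hz2, mul_div_mul_left _ _ (pow_ne_zero d hz3)]

end Pullback

/-! ### Reciprocals of polynomials as rational maps. -/

section RationalMap

variable {q : Polynomial ℂ}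

/-- This avoids the normalised numerator and denominator: coprimality makes the numerator a unit, so
degree and values are those of `1 / q`. -/
theorem num_inv_algebraMap_mul (hq : q ≠ 0) :
    ((algebraMap (Polynomial ℂ) (RatFunc ℂ) q)⁻¹).num * q =
      ((algebraMap (Polynomial ℂ) (RatFunc ℂ) q)⁻¹).denom := by
  have := (RatFunc.num_mul_eq_mul_denom_iff (x := (algebraMap (Polynomial ℂ) (RatFunc ℂ) q)⁻¹)
    (p := 1) hq).2 (by rw [map_one, one_div])
  rwa [one_mul] at this

theorem ratMapDegree_inv_algebraMap (hq : q ≠ 0) :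
    ratMapDegree (algebraMap (Polynomial ℂ) (RatFunc ℂ) q)⁻¹ = q.natDegree := by
  have h := num_inv_algebraMap_mul hq
  have hunit : IsUnit ((algebraMap (Polynomial ℂ) (RatFunc ℂ) q)⁻¹).num :=
    (RatFunc.isCoprime_num_denom _).isUnit_of_dvd' dvd_rfl ⟨q, h.symm⟩
  have h0 := Polynomial.natDegree_eq_zero_of_isUnit hunit
  rw [ratMapDegree, ← h, Polynomial.natDegree_mul hunit.ne_zero hq, h0]
  simp

theorem IsInverseBranch.inv_eval (hq : q ≠ 0) {ψ : ℂ → ℂ} {b a : ℂ}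
    (hψ : IsInverseBranch (algebraMap (Polynomial ℂ) (RatFunc ℂ) q)⁻¹ ψ b a) :
    ∀ᶠ z in 𝓝 b, (q.eval (ψ z))⁻¹ = z := by
  filter_upwards [hψ.right_inverse] with z hz
  have h := congrArg (Polynomial.eval (ψ z)) (num_inv_algebraMap_mul hq)
  rw [Polynomial.eval_mul] at h
  rw [← h] at hz
  have h2 := hz.2
  rw [RatFunc.eval, Polynomial.eval₂_id, Polynomial.eval₂_id, ← h,
    div_mul_cancel_left₀ (left_ne_zero_of_mul hz.1)] at h2
  exact h2

end RationalMap

/-! ### Primitive recursiveness of the bounds and conclusion. -/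

theorem primrec_pow : Primrec₂ fun a b : ℕ => a ^ b := by
  have h : Primrec₂ fun a b : ℕ => Nat.rec (motive := fun _ => ℕ) 1 (fun _ y => y * a) b :=
    Primrec.nat_rec (f := fun _ : ℕ => 1) (g := fun (a : ℕ) (p : ℕ × ℕ) => p.2 * a)
      (Primrec.const 1) (Primrec.nat_mul.comp (Primrec.snd.comp Primrec.snd) Primrec.fst)
  refine h.of_eq fun a b => ?_
  induction b with
  | zero => rfl
  | succ b ih => rw [pow_succ, ← ih]

theorem primrec_foldConst : Primrec foldConst := by
  have hm : Primrec fun m : ℕ => m := Primrec.id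
  have hL : Primrec fun m : ℕ => 3 * m + 1 :=
    Primrec.nat_add.comp (Primrec.nat_mul.comp (Primrec.const 3) hm) (Primrec.const 1)
  have h2L : Primrec fun m : ℕ => 2 * (3 * m + 1) := Primrec.nat_mul.comp (Primrec.const 2) hL
  have hK : Primrec fun m : ℕ => 2 * (3 * m + 1) + 1 := Primrec.nat_add.comp h2L (Primrec.const 1)
  exact Primrec.nat_add.comp
    (Primrec.nat_mul.comp (Primrec.nat_add.comp hm (Primrec.const 2))
      (Primrec.nat_mul.comp (Primrec.nat_mul.comp hL hK)
        (primrec_pow.comp (Primrec.nat_mul.comp h2L hK) hm)))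
    (Primrec.nat_mul.comp (Primrec.const 2) hm)

theorem primrec_foldStep : Primrec foldStep := by
  have h1 : Primrec fun q : ℕ × ℕ × ℕ => q.1 := Primrec.fst
  have h2 : Primrec fun q : ℕ × ℕ × ℕ => q.2.1 := Primrec.fst.comp Primrec.snd
  have h3 : Primrec fun q : ℕ × ℕ × ℕ => q.2.2 := Primrec.snd.comp Primrec.snd
  have hc : Primrec fun q : ℕ × ℕ × ℕ => foldConst q.2.1 := primrec_foldConst.comp h2
  have hcr := Primrec.nat_mul.comp hc h3
  refine Primrec.pair ?_ (Primrec.pair ?_ ?_)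
  · exact Primrec.nat_add.comp (Primrec.nat_mul.comp (Primrec.const 2) h1) (Primrec.const 1)
  · exact Primrec.nat_add.comp (Primrec.nat_mul.comp (Primrec.const 3) h2) (Primrec.const 1)
  · exact Primrec.nat_add.comp (Primrec.nat_add.comp (Primrec.nat_mul.comp h2
      (Primrec.nat_add.comp (Primrec.nat_add.comp h3 hcr) hcr)) hc) (Primrec.const 1)

theorem primrec_foldedBounds : Primrec foldedBounds :=
  Primrec.nat_iterate (Primrec.fst.comp Primrec.snd) Primrec.id
    (primrec_foldStep.comp Primrec.snd).to₂

theorem primrec_finalEntryBound : Primrec finalEntryBound := by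
  have h2 : Primrec fun q : ℕ × ℕ × ℕ => q.2.1 := Primrec.fst.comp Primrec.snd
  have h3 : Primrec fun q : ℕ × ℕ × ℕ => q.2.2 := Primrec.snd.comp Primrec.snd
  exact Primrec.nat_add.comp (Primrec.nat_add.comp
    (Primrec.nat_mul.comp h2 (Primrec.nat_mul.comp (Primrec.const 2) h3))
    (Primrec.nat_mul.comp (Primrec.nat_add.comp h2 (Primrec.const 1)) (Primrec.const 2)))
    (Primrec.const 2)

theorem mainTheorem9 :
    ∃ D N M R : ℕ × ℕ × ℕ → ℕ, Primrec D ∧ Primrec N ∧ Primrec M ∧ Primrec R ∧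
      ∀ (n m r : ℕ) (S : FuchsianSystem n), S.InClass m r →
        ∃ (φ : RatFunc ℂ) (n' : ℕ) (S' : FuchsianSystem n'),
          -- `φ` is a nonconstant rational map; its degree and the parameters of the new field
          -- are computably bounded
          1 ≤ ratMapDegree φ ∧ ratMapDegree φ ≤ D (n, m, r) ∧
          n' ≤ N (n, m, r) ∧ S'.InClass (M (n, m, r)) (R (n, m, r)) ∧
          -- for every branch `ψ` of the inverse of `φ` and all fundamental solutions `X`, `Y`:
          (∀ (b a : ℂ) (ψ : ℂ → ℂ) (hψ : IsInverseBranch φ ψ b a),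
            b ∉ S'.poles → a ∉ S.poles →
            ∀ (X : ℂ → Matrix (Fin n) (Fin n) ℂ) (Y : ℂ → Matrix (Fin n') (Fin n') ℂ),
              S.IsFundamentalAt a X → S'.IsFundamentalAt b Y →
              -- `ψ*ℂ(X) = ℂ(ψ*X) ⊆ ℂ(Y)`
              hψ.pullback '' pvField X a =
                PuncturedGerm.generatedField (fun k => hψ.pullback (pvGenerators X a k)) ∧
              hψ.pullback '' pvField X a ⊆ pvField Y b ∧
              -- degrees do not increase
              ∀ (f : PuncturedGerm a) (d : ℕ),
                PVDegreeLE X a d f → PVDegreeLE Y b d (hψ.pullback f)) ∧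
          -- all singular points are finite and real, all residues are real
          (∀ z ∈ S'.poles, z.im = 0) ∧ S'.residueInfty = 0 ∧
          (∀ z ∈ S'.poles, ∀ i j, (S'.residue z i j).im = 0) ∧
          -- the simple-loop spectral condition is preserved
          (S.SpectralCondition → S'.SpectralCondition) := by
  have hN : Primrec fun q => 2 * ((foldedBounds q).1 + 2) :=
    Primrec.nat_mul.comp (Primrec.const 2)
      (Primrec.nat_add.comp (Primrec.fst.comp primrec_foldedBounds) (Primrec.const 2))
  have hM : Primrec fun q => (foldedBounds q).2.1 + 2 :=
    Primrec.nat_add.comp ((Primrec.fst.comp Primrec.snd).comp primrec_foldedBounds)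
      (Primrec.const 2)
  -- Exactly `m` folds are made, even if fewer points are nonreal, so the degree is `2 ^ m`.
  refine ⟨fun q => 2 ^ q.2.1, fun q => 2 * ((foldedBounds q).1 + 2),
    fun q => (foldedBounds q).2.1 + 2, fun q => ((foldedBounds q).2.1 + 2) *
      (2 * ((foldedBounds q).1 + 2) * finalEntryBound (foldedBounds q)),
    primrec_pow.comp (Primrec.const 2) (Primrec.fst.comp Primrec.snd), hN, hM,
    Primrec.nat_mul.comp hM
      (Primrec.nat_mul.comp hN (primrec_finalEntryBound.comp primrec_foldedBounds)), ?_⟩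
  intro n m r S hS
  obtain ⟨P, c, n', S', hP, hdom, hn', hclass, hreal, hinf, him⟩ :=
    exists_dominating_fuchsianSystem hS
  have hdeg : (P - Polynomial.C c).natDegree = 2 ^ m := by rw [Polynomial.natDegree_sub_C, hP]
  have hq : P - Polynomial.C c ≠ 0 := fun h => by
    rw [h, Polynomial.natDegree_zero] at hdeg
    exact (pow_pos two_pos m).ne hdeg
  have hφ := ratMapDegree_inv_algebraMap hq
  rw [hdeg] at hφ
  refine ⟨(algebraMap (Polynomial ℂ) (RatFunc ℂ) (P - Polynomial.C c))⁻¹, n', S',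
    hφ ▸ Nat.one_le_two_pow, hφ.le, hn', hclass, ?_, hreal, hinf, fun z _ => him z,
    fun h => (hdom.spec h.vec).spectralCondition⟩
  intro b a ψ hψ hb _ X Y hX hY
  have hΦ : ∀ᶠ z in 𝓝 b, (P.eval (ψ z) - c)⁻¹ = z := by
    simpa using hψ.inv_eval hq
  have hdegree : ∀ (f : PuncturedGerm a) (d : ℕ),
      PVDegreeLE X a d f → PVDegreeLE Y b d (hψ.pullback f) := fun f d hf =>
    hdom.pvDegreeLE_pullback hψ hΦ hb hX.1 hY hf
  refine ⟨hψ.pullback_pvField hX.1, ?_, hdegree⟩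
  rintro _ ⟨f, ⟨d, hf⟩, rfl⟩
  exact ⟨d, hdegree f d hf⟩
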